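/- **Model.** For $S\in\mathbb R^{p\times p}$ positive definite let $\mathcal A(S)$ be the neighborhood regression matrix of $N(0,S)$: zero diagonal and $\mathcal A(S)(l,k)=-\Omega(l,l)^{-1}\Omega(l,k)$ for $k\ne l$, where $\Omega=S^{-1}$. Let $x_1,\dots,x_n\in\mathbb R^p$ be independent with $x_t\sim N(0,\Sigma_j)$ for $t_{j-1}\le t<t_j$, $j=1,\dots,m_0+1$, where $1=t_0<t_1<\dots<t_{m_0}<t_{m_0+1}=n+1$, $m_0\ge1$; put $\Omega_j=\Sigma_j^{-1}$, $A_j^\star=\mathcal A(\Sigma_j)$, and suppose $A^\star_{j+1}\ne A^\star_j$ for $1\le j\le m_0$. Here $p$, $m_0$, the $t_j$ and the $\Sigma_j$ may all depend on $n$. Let $d_n^\star$ be the maximal number of nonzero entries of $A^\star_1,\dots,A^\star_{m_0+1}$, $\nu_n=\min_{1\le j\le m_0}\|A^\star_{j+1}-A^\star_j\|_F$ and $\mathrm{supp}(A)=\{(l,k):A(l,k)\neq0\}$. **Procedure (TBFL).** Let $b_n\ge1$ be an integer (the block size), $k_n=\lfloor n/b_n\rfloor$, $r_i=1+ib_n$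 for $0\le i<k_n$ and $r_{k_n}=n+1$. Let $\lambda_{1,n},\lambda_{2,n}>0$, $0<\kappa<\tfrac12$ and $\rho\ge1$. (I) $(\widehat\Theta_1,\dots,\widehat\Theta_{k_n})$ minimizes, over all $p\times p$ matrices with zero diagonal, $$\frac1n\sum_{i=1}^{k_n}\sum_{t=r_{i-1}}^{r_i-1}\Big\|x_t-\sum_{q\le i}\Theta_q x_t\Big\|_2^2+\lambda_{1,n}\sum_{i=1}^{k_n}\|\Theta_i\|_1+\lambda_{2,n}\sum_{i=1}^{k_n}\Big\|\sum_{q\le i}\Theta_q\Big\|_1,$$ where $\|\cdot\|_1$ is the entrywise $\ell_1$ norm. (II) The candidates are the $i\in\{2,\dots,k_n\}$ with $\|\widehat\Theta_i\|_F>\kappa\nu_n$. (III) The candidates are partitioned into the smallest possible number $\widetilde m^f$ of consecutive clusters $J_1<\dots<J_{\widetilde m^f}$ such that each $R_j=\{r_{i-1}:i\in J_j\}$ has diameter at most $\rho b_n$. With $J_0=\{1\}$, $J_{\widetilde m^f+1}=\{k_n\}$ put $\widehat A_j=\sum_{i=1}^{\lfloor(\max J_{j-1}+\min J_j)/2\rfloor}\widehat\Theta_i$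 for $1\le j\le\widetilde m^f+1$. For $1\le j\le\widetilde m^f$, $\widetilde t_j$ is a minimizer over the integers $s\in(l_j,u_j)$ of $$\sum_{t=\min R_j-b_n}^{s-1}\|x_t-\widehat A_jx_t\|_2^2+\sum_{t=s}^{\max R_j+b_n-1}\|x_t-\widehat A_{j+1}x_t\|_2^2,$$ where $(l_j,u_j)=(\min R_j-b_n,\max R_j+b_n)$ if $|R_j|=1$ and $(l_j,u_j)=(\min R_j,\max R_j)$ otherwise. **Assumptions.** (D1) For constants $C_1,C_2>0$, all eigenvalues of all $\Sigma_j$ lie in $[1/C_1,C_1]$, and $\Omega_j(l,l)^{-1}\ge 1/C_2$ for all $j,l$. (D2) $d_n^\star/p^2\to0$, and all entries of all $A_j^\star$ are bounded in absolute value by a constant $M_A>0$. (D3) $\min_{1\le j\le m_0+1}(t_j-t_{j-1})/b_n\to\infty$, $d_n^\star\log(p\vee n)/b_n\to0$, and $\nu_n\ge c_0\sqrt{d_n^\star\log(p\vee n)/b_n}$ for all large $n$. (D4) $\lambda_{1,n}=c_1\sqrt{\log(p\vee n)/n}\sqrt{b_n/n}$ and $\lambda_{2,n}=c_2\sqrt{\log(p\vee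 n)/n}\sqrt{b_n/n}$. **Theorem.** Let $c_1>0$. If $c_2$ is large enough (depending on $c_1$ and the constants in D1, D2) and $c_0$ is large enough (depending on these, $c_2$, $\kappa$ and $\rho$), then there is a constant $K>0$, depending only on the constants named so far, such that under D1–D4, as $n\to\infty$, the procedure has an output for all large $n$, and for all of its outputs (if minimizers or clusterings are not unique) $$\mathbb P\Big(\widetilde m^f=m_0,\ \max_{1\le j\le m_0}|\widetilde t_j-t_j|\le\frac{K d_n^\star\log(p\vee n)}{\nu_n^2}\Big)\to1,\qquad \max_{1\le j\le m_0+1}\|\widehat A_j-A_j^\star\|_F=O_p\Big(\sqrt{\tfrac{d_n^\star\log(p\vee n)}{b_n}}\Big).$$ Moreover, let $\eta_{n,j}=C_{n,j}\sqrt{\log(p\vee n)/b_n}$, where the $C_{n,j}$ are bounded below by a positive constant, and let $\widetilde A_j$ be $\widehat A_j$ with all entries of absolute value at most $\eta_{n,j}$ set to zero. Then $\max_{1\le j\le m_0+1}|\mathrm{supp}(\widetilde A_j)\setminus\mathrm{supp}(A_j^\star)|=O_p(d_n^\star)$. -/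

import Mathlib

open MeasureTheory ProbabilityTheory Filter Topology

noncomputable section

namespace TBFL

/-! ## Matrices -/

/-- Entrywise `ℓ₁` norm. -/
def l1Norm {p : ℕ} (A : Matrix (Fin p) (Fin p) ℝ) : ℝ := ∑ l, ∑ k, |A l k|

/-- Frobenius norm. -/
def frobNorm {p : ℕ} (A : Matrix (Fin p) (Fin p) ℝ) : ℝ := Real.sqrt (∑ l, ∑ k, A l k ^ 2)

/-- The support of a matrix. -/
def supp {p : ℕ} (A : Matrix (Fin p) (Fin p) ℝ) : Finset (Fin p × Fin p) :=
  Finset.univ.filter fun e => A e.1 e.2 ≠ 0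

/-- Elementwise hard thresholding: entries of absolute value at most `η` are set to zero. -/
def hardThreshold {p : ℕ} (η : ℝ) (A : Matrix (Fin p) (Fin p) ℝ) : Matrix (Fin p) (Fin p) ℝ :=
  Matrix.of fun l k => if η < |A l k| then A l k else 0

/-- The neighborhood regression matrix of a covariance matrix `S` with precision matrix
`Ω = S⁻¹`: zero diagonal, and `A(l,k) = - Ω(l,l)⁻¹ Ω(l,k)` for `k ≠ l`. -/
def coefMatrix {p : ℕ} (S : Matrix (Fin p) (Fin p) ℝ) : Matrix (Fin p) (Fin p) ℝ :=
  Matrix.of fun l k => if l = k then 0 else -((S⁻¹ l l)⁻¹ * S⁻¹ l k)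

/-! ## The piecewise constant Gaussian graphical model -/

/-- The deterministic part of the model: sample size `n`, dimension `p`, change points
`1 = t_0 < t_1 < ⋯ < t_{m₀} < t_{m₀+1} = n + 1` (`cp j` is `t_j`), and the nonsingular covariance
matrices `Σ_1, …, Σ_{m₀+1}` of the segments. The values of `cp` and `Sigma` at other indices play
no role. -/
structure Model where
  n : ℕ
  p : ℕ
  m₀ : ℕ
  cp : ℕ → ℕ
  Sigma : ℕ → Matrix (Fin p) (Fin p) ℝ
  one_le_m₀ : 1 ≤ m₀
  cp_zero : cp 0 = 1
  cp_last : cp (m₀ + 1) = n + 1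
  cp_lt : ∀ j ∈ Finset.Icc 1 (m₀ + 1), cp (j - 1) < cp j
  posDef : ∀ j ∈ Finset.Icc 1 (m₀ + 1), (Sigma j).PosDef
  /-- The regression coefficients do change at a change point. -/
  change : ∀ j ∈ Finset.Icc 1 m₀, coefMatrix (Sigma (j + 1)) ≠ coefMatrix (Sigma j)

namespace Model

/-- The coefficient matrix of the `j`-th segment. -/
def A (M : Model) (j : ℕ) : Matrix (Fin M.p) (Fin M.p) ℝ := coefMatrix (M.Sigma j)

/-- The maximal number of nonzero coefficients over the segments. -/
def dStar (M : Model) : ℕ := (Finset.Icc 1 (M.m₀ + 1)).sup fun j => (supp (M.A j)).card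

/-- The minimal jump size in Frobenius norm. -/
def jump (M : Model) : ℝ :=
  (Finset.Icc 1 M.m₀).inf' (Finset.nonempty_Icc.2 M.one_le_m₀)
    fun j => frobNorm (M.A (j + 1) - M.A j)

/-- The minimal length of a segment. -/
def spacing (M : Model) : ℕ :=
  (Finset.Icc 1 (M.m₀ + 1)).inf' (Finset.nonempty_Icc.2 (Nat.le_add_left 1 M.m₀))
    fun j => M.cp j - M.cp (j - 1)

/-- `log (p ∨ n)`. -/
def logpn (M : Model) : ℝ := Real.log (max M.p M.n : ℕ)

/-- `X_1, …, X_n` is a sample from the model: independent, with `X_t ∼ N(0, Σ_j)` for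
`t_{j-1} ≤ t < t_j`. -/
structure IsSample (M : Model) {Ω : Type*} [MeasurableSpace Ω] (μ : Measure Ω)
    (X : ℕ → Ω → EuclideanSpace ℝ (Fin M.p)) : Prop where
  law : ∀ j ∈ Finset.Icc 1 (M.m₀ + 1), ∀ t ∈ Finset.Ico (M.cp (j - 1)) (M.cp j),
    HasLaw (X t) (multivariateGaussian 0 (M.Sigma j)) μ
  indep : iIndepFun (fun t : Finset.Icc 1 M.n => X t) μ

end Model

/-! ## The procedure -/

/-- The block end points `r_0 = 1, …, r_k = n + 1` where `k = ⌊n / b⌋`: all blocks have length `b`,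
except that the last one also takes the remainder of `n` modulo `b`. -/
def blockEnd (n b i : ℕ) : ℕ := if i < n / b then 1 + i * b else n + 1

/-- `‖x - A x‖₂²`. -/
def residSq {p : ℕ} (A : Matrix (Fin p) (Fin p) ℝ) (x : EuclideanSpace ℝ (Fin p)) : ℝ :=
  ∑ l, (x l - ∑ k, A l k * x k) ^ 2

/-- The sum `Θ_1 + ⋯ + Θ_i`. -/
def partialSum {p : ℕ} (Θ : ℕ → Matrix (Fin p) (Fin p) ℝ) (i : ℕ) : Matrix (Fin p) (Fin p) ℝ :=
  ∑ q ∈ Finset.Icc 1 i, Θ q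

/-- The block fused lasso objective with penalty levels `lam₁`, `lam₂`; only `Θ_1, …, Θ_k`,
`k = ⌊n / b⌋`, enter. -/
def objective {p : ℕ} (n b : ℕ) (lam₁ lam₂ : ℝ) (x : ℕ → EuclideanSpace ℝ (Fin p))
    (Θ : ℕ → Matrix (Fin p) (Fin p) ℝ) : ℝ :=
  1 / (n : ℝ) * ∑ i ∈ Finset.Icc 1 (n / b),
      ∑ t ∈ Finset.Ico (blockEnd n b (i - 1)) (blockEnd n b i), residSq (partialSum Θ i) (x t)
    + lam₁ * ∑ i ∈ Finset.Icc 1 (n / b), l1Norm (Θ i)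
    + lam₂ * ∑ i ∈ Finset.Icc 1 (n / b), l1Norm (partialSum Θ i)

/-- Neighborhood regression: no variable is used as a predictor of itself. -/
def zeroDiag (p : ℕ) : Set (ℕ → Matrix (Fin p) (Fin p) ℝ) := {Θ | ∀ i l, Θ i l l = 0}

/-- The blocks whose estimated jump exceeds the threshold `w`. -/
def candidates {p : ℕ} (k : ℕ) (w : ℝ) (Θ : ℕ → Matrix (Fin p) (Fin p) ℝ) : Finset ℕ :=
  (Finset.Icc 2 k).filter fun i => w < frobNorm (Θ i)

/-- `J_1, …, J_m` is a partition of the set `I` of block indices into nonempty, increasingly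
ordered clusters, for which the corresponding sets `R_j = {r_{i-1} : i ∈ J_j}` of time points have
diameter at most `D`. -/
structure IsClustering (r : ℕ → ℕ) (D : ℝ) (I : Finset ℕ) (m : ℕ) (J : ℕ → Finset ℕ) : Prop where
  nonempty : ∀ j ∈ Finset.Icc 1 m, (J j).Nonempty
  cover : (Finset.Icc 1 m).biUnion J = I
  ordered : ∀ j ∈ Finset.Icc 1 m, ∀ j' ∈ Finset.Icc 1 m, j < j' →
    ∀ i ∈ J j, ∀ i' ∈ J j', i < i'
  diam : ∀ j ∈ Finset.Icc 1 m, ∀ i ∈ J j, ∀ i' ∈ J j,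
    |(r (i - 1) : ℝ) - (r (i' - 1) : ℝ)| ≤ D

/-- What the procedure returns: the block parameters `Θ_1, …, Θ_k`, the number `m` of clusters, the
clusters `J_1, …, J_m` of block indices, and the final change points `τ_1, …, τ_m`. -/
structure Output (p : ℕ) where
  Θ : ℕ → Matrix (Fin p) (Fin p) ℝ
  m : ℕ
  J : ℕ → Finset ℕ
  τ : ℕ → ℕ

namespace Output

variable {p : ℕ}

/-- Largest block index in `J_j`, with `J_0 = {1}`. -/
def maxJ (o : Output p) (j : ℕ) : ℕ := if j = 0 then 1 else (o.J j).sup id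

/-- Smallest block index in `J_j`, with `J_{m+1} = {k}`. -/
def minJ (o : Output p) (k j : ℕ) : ℕ := if j = o.m + 1 then k else sInf (o.J j : Set ℕ)

/-- The estimated coefficient matrix of the `j`-th segment,
`Θ_1 + ⋯ + Θ_{⌊(max J_{j-1} + min J_j) / 2⌋}`, for `1 ≤ j ≤ m + 1`. -/
def Ahat (o : Output p) (k j : ℕ) : Matrix (Fin p) (Fin p) ℝ :=
  partialSum o.Θ ((o.maxJ (j - 1) + o.minJ k j) / 2)

/-- `min R_j`. -/
def minR (o : Output p) (n b j : ℕ) : ℕ := blockEnd n b (o.minJ (n / b) j - 1)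

/-- `max R_j`. -/
def maxR (o : Output p) (n b j : ℕ) : ℕ := blockEnd n b (o.maxJ j - 1)

/-- The end point `l_j` of the search interval (`min R_j ≥ 1 + b`, so nothing is truncated). -/
def lo (o : Output p) (n b j : ℕ) : ℕ :=
  if (o.J j).card = 1 then o.minR n b j - b else o.minR n b j

/-- The end point `u_j` of the search interval. -/
def hi (o : Output p) (n b j : ℕ) : ℕ :=
  if (o.J j).card = 1 then o.maxR n b j + b else o.maxR n b j

/-- The local least squares criterion for placing the `j`-th change point at `s`. -/
def searchLoss (o : Output p) (n b : ℕ) (x : ℕ → EuclideanSpace ℝ (Fin p)) (j s : ℕ) : ℝ :=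
  ∑ t ∈ Finset.Ico (o.minR n b j - b) s, residSq (o.Ahat (n / b) j) (x t)
    + ∑ t ∈ Finset.Ico s (o.maxR n b j + b), residSq (o.Ahat (n / b) (j + 1)) (x t)

end Output

/-- `o` is an output of the three-step procedure on the data `x_1, …, x_n`, with block size `b`,
penalty levels `lam₁`, `lam₂`, jump threshold `w` and clusters of diameter at most `D`. -/
structure IsOutput {p : ℕ} (n b : ℕ) (lam₁ lam₂ w D : ℝ) (x : ℕ → EuclideanSpace ℝ (Fin p))
    (o : Output p) : Prop where
  /-- Block fused lasso. -/
  mem_zeroDiag : o.Θ ∈ zeroDiag p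
  isMin : IsMinOn (objective n b lam₁ lam₂ x) (zeroDiag p) o.Θ
  /-- Hard thresholding, and clustering of the candidates into the smallest possible number of
  clusters. -/
  clustering : IsClustering (blockEnd n b) D (candidates (n / b) w o.Θ) o.m o.J
  fewest : ∀ m' J', IsClustering (blockEnd n b) D (candidates (n / b) w o.Θ) m' J' → o.m ≤ m'
  /-- Exhaustive search. -/
  mem_search : ∀ j ∈ Finset.Icc 1 o.m, o.τ j ∈ Finset.Ioo (o.lo n b j) (o.hi n b j)
  search : ∀ j ∈ Finset.Icc 1 o.m, ∀ s ∈ Finset.Ioo (o.lo n b j) (o.hi n b j),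
    o.searchLoss n b x j (o.τ j) ≤ o.searchLoss n b x j s

/-- The penalty level `c √(log (p ∨ n) / n) √(b / n)`. -/
def Model.penalty (M : Model) (b : ℕ) (c : ℝ) : ℝ :=
  c * Real.sqrt (M.logpn / M.n) * Real.sqrt ((b : ℝ) / M.n)

/-- The set of outputs of the procedure for data from the model `M`, with block size `b`, penalty
levels `c₁ √(log (p ∨ n) / n) √(b / n)` and `c₂ √(log (p ∨ n) / n) √(b / n)`, jump threshold `κ`
times the minimal jump size, and clusters of diameter at most `ρ b`. -/
def Model.outputs (M : Model) (b : ℕ) (c₁ c₂ κ ρ : ℝ) (x : ℕ → EuclideanSpace ℝ (Fin M.p)) :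
    Set (Output M.p) :=
  {o | IsOutput M.n b (M.penalty b c₁) (M.penalty b c₂) (κ * M.jump) (ρ * b) x o}

/-! ## Assumptions on a model and on a sequence of models -/

/-- The eigenvalues of all `Σ_j` lie in `[1 / C₁, C₁]`, all `Ω_j(l,l)⁻¹` are at least `1 / C₂`, and
all entries of the coefficient matrices are bounded by `C_A`. -/
structure Model.Bounded (M : Model) (C₁ C₂ C_A : ℝ) : Prop where
  eig : ∀ j ∈ Finset.Icc 1 (M.m₀ + 1), ∀ z ∈ spectrum ℝ (M.Sigma j), 1 / C₁ ≤ z ∧ z ≤ C₁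
  var : ∀ j ∈ Finset.Icc 1 (M.m₀ + 1), ∀ l, 1 / C₂ ≤ ((M.Sigma j)⁻¹ l l)⁻¹
  coef : ∀ j ∈ Finset.Icc 1 (M.m₀ + 1), ∀ l k, |M.A j l k| ≤ C_A

/-- Asymptotic conditions: the sample size tends to infinity, the coefficient matrices are sparse,
`d* = o(p²)`, segments are long compared with blocks, `d* log (p ∨ n) / b → 0`, and eventually the
minimal jump size is at least `c₀ √(d* log (p ∨ n) / b)`. -/
structure Asymptotics (M : ℕ → Model) (b : ℕ → ℕ) (c₀ : ℝ) : Prop where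
  size : Tendsto (fun i => (M i).n) atTop atTop
  block_pos : ∀ i, 0 < b i
  sparse : Tendsto (fun i => ((M i).dStar : ℝ) / ((M i).p : ℝ) ^ 2) atTop (𝓝 0)
  spacing : Tendsto (fun i => ((M i).spacing : ℝ) / (b i : ℝ)) atTop atTop
  block : Tendsto (fun i => ((M i).dStar : ℝ) * ((M i).logpn / (b i : ℝ))) atTop (𝓝 0)
  jump : ∀ᶠ i in atTop,
    c₀ * Real.sqrt (((M i).dStar : ℝ) * (M i).logpn / (b i : ℝ)) ≤ (M i).jump

end TBFL

end

noncomputable section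
namespace TBFL

/-! ### Sparse approximation of quadratic forms -/

/-! The proof separates a deterministic analysis on regular data (`Good`) from the proof that the
data are regular with probability at least `1 - 8/n`. Write L = log(p ∨ n), d = d⋆, ν for the
minimal jump and e = √(dL/b).

Regularity is required of every stretch of at least 1024 L points inside one segment. It consists of
two-sided restricted eigenvalue bounds, an off-diagonal bound of order √(|I| L) on the correlation
of residuals and predictors, and a lower bound on the energy of each jump matrix A⋆_{j+1} - A⋆_j.
The eigenvalue bounds follow by Maurey's argument from finitely many sums of signed basis vectors.
The residual of x_l is uncorrelated with x_k for k ≠ l, so by polarization the noise term is a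
difference of two quadratic forms with equal means. Everything thus reduces to Chernoff bounds for
Gaussian quadratic forms and a union bound (`measure_energy_ge_le`,
`Model.IsSample.measure_not_good_le`).

Lasso step (`Good.lasso`): fix a block without change point. Adding H to Θ_i and subtracting it from
Θ_{i+1} changes only the i-th partial sum, and costs at most 2λ₁‖H‖₁ in the fused penalty. The
comparison with the true matrix in this one block is therefore an ordinary lasso basic inequality in
which λ₂ dominates both λ₁ and the noise. It yields the cone condition and the error bound 6 C₁ c₂
e, uniformly over such blocks and whatever happens in the others.

Clusters (`Accurate.candidate_near`, `Accurate.exists_candidate`, `IsClustering.eq_of_near`):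
between two adjacent pure blocks of one segment the estimated jump is at most twice the error, hence
below κν. Across a change point two consecutive Θ's add up to the true jump up to that error, so one
of them exceeds κν because κ < 1/2. Candidates thus sit in the block of a change point or the next
one, and segments much longer than ρb force exactly one cluster per change point. The index midway
between clusters lies in a pure block, so the estimates Â_j inherit the lasso rate.

Localization (`Regular.loss_lt`): if the selected point is farther than K dL/ν² from t_j, the points
in between lie in one segment but are fitted with the estimate for the other one. Moving the split
to t_j strictly lowers the loss, since the energy of the jump outweighs estimation error and noise.
Such a stretch may have only of order L points, as ν² can be of order d; this is why the jump
energies are controlled separately.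

False positives: each one contributes at least η² to the squared Frobenius error. -/

lemma BilinForm_exists_sum_le {E ι : Type*} [AddCommGroup E] [Module ℝ E] [Fintype ι]
    (B : LinearMap.BilinForm ℝ E) (w : ι → ℝ) (hw : ∀ i, 0 ≤ w i) (hw1 : ∑ i, w i = 1)
    (u : ι → E) (s : ℕ) (a : E) :
    ∃ J : Fin s → ι, B (a + ∑ i, u (J i)) (a + ∑ i, u (J i)) ≤
      B (a + (s : ℝ) • ∑ i, w i • u i) (a + (s : ℝ) • ∑ i, w i • u i)
        + s * (∑ i, w i * B (u i) (u i) - B (∑ i, w i • u i) (∑ i, w i • u i)) := by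
  induction s generalizing a with
  | zero => exact ⟨Fin.elim0, by simp⟩
  | succ s ih =>
    set m := ∑ i, w i • u i with hm
    -- Derandomization of a random sum: the s draws still to come are replaced by their mean m, and
    -- only the first draw is random.
    set c := a + (s : ℝ) • m with hc
    have key : ∑ i, w i * B (c + u i) (c + u i) =
        B (c + m) (c + m) + (∑ i, w i * B (u i) (u i) - B m m) := by
      have h1 : ∑ i, w i * B c (u i) = B c m := by simp [hm]
      have h2 : ∑ i, w i * B (u i) c = B m c := by simp [hm]
      have h3 : ∀ i, w i * B (c + u i) (c + u i) =
          w i * B c c + w i * B c (u i) + w i * B (u i) c + w i * B (u i) (u i) := by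
        intro i; simp only [map_add, LinearMap.add_apply]; ring
      rw [Finset.sum_congr rfl fun i _ => h3 i, Finset.sum_add_distrib, Finset.sum_add_distrib,
        Finset.sum_add_distrib, ← Finset.sum_mul, hw1, h1, h2]
      simp only [map_add, LinearMap.add_apply]
      ring
    -- Some draw does no worse than the average; the induction continues from a + u j.
    obtain ⟨j, hj⟩ : ∃ j, B (c + u j) (c + u j) ≤
        B (c + m) (c + m) + (∑ i, w i * B (u i) (u i) - B m m) := by
      by_contra! hcon
      set R := B (c + m) (c + m) + (∑ i, w i * B (u i) (u i) - B m m) with hR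
      have h4 : ∑ i, w i * R < ∑ i, w i * B (c + u i) (c + u i) := by
        apply Finset.sum_lt_sum
        · exact fun i _ => mul_le_mul_of_nonneg_left (hcon i).le (hw i)
        · obtain ⟨i, -, hi⟩ : ∃ i ∈ Finset.univ, 0 < w i := by
            by_contra! h5
            have := Finset.sum_nonpos h5
            linarith
          exact ⟨i, Finset.mem_univ _, mul_lt_mul_of_pos_left (hcon i) hi⟩
      rw [← Finset.sum_mul, hw1, key] at h4
      linarith
    obtain ⟨J, hJ⟩ := ih (a + u j)
    refine ⟨Fin.cons j J, ?_⟩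
    simp only [Fin.sum_univ_succ, Fin.cons_zero, Fin.cons_succ]
    rw [← add_assoc]
    refine hJ.trans ?_
    have e1 : a + u j + (s : ℝ) • m = c + u j := by rw [hc]; abel
    have e2 : a + ((s + 1 : ℕ) : ℝ) • m = c + m := by
      rw [hc]; push_cast; rw [add_smul, one_smul]; abel
    rw [e1, e2]
    push_cast
    linarith

/-- A sum of signed standard basis vectors. -/
def signedSum {p s : ℕ} (f : Fin s → Fin p × Bool) : Fin p → ℝ :=
  ∑ i, (if (f i).2 then (1 : ℝ) else -1) • Pi.single (f i).1 (1 : ℝ)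

/-- Maurey's argument: a quadratic form that is nonnegative on sums of `r + 1` signed basis vectors
is bounded below by a multiple of the squared `ℓ₁` norm. -/
lemma BilinForm_ge_of_signedSum {p : ℕ} (B : LinearMap.BilinForm ℝ (Fin p → ℝ)) {r : ℕ}
    (hr : 0 < r) {H : ℝ} (hH : ∀ j, B (Pi.single j 1) (Pi.single j 1) ≤ H)
    (hB : ∀ f : Fin (r + 1) → Fin p × Bool, 0 ≤ B (signedSum f) (signedSum f))
    (v : Fin p → ℝ) : -(H / r) * (∑ k, |v k|) ^ 2 ≤ B v v := by
  set S := ∑ k, |v k| with hS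
  have hS0 : 0 ≤ S := Finset.sum_nonneg fun _ _ => abs_nonneg _
  rcases hS0.eq_or_lt with h0 | hpos
  · have hv : v = 0 := by
      funext k
      have := (Finset.sum_eq_zero_iff_of_nonneg (fun k _ => abs_nonneg (v k))).1 (hS ▸ h0.symm)
      simpa using this k (Finset.mem_univ _)
    simp [hv, ← h0]
  set u : Fin p → Fin p → ℝ := fun j => (if 0 ≤ v j then (1 : ℝ) else -1) • Pi.single j (1 : ℝ)
  have hm : ∑ j, (|v j| / S) • u j = S⁻¹ • v := by
    funext k
    simp only [u, Finset.sum_apply, Pi.smul_apply, smul_eq_mul, Pi.single_apply]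
    rw [Finset.sum_eq_single k (fun j _ hj => by simp [hj.symm]) (by simp)]
    split_ifs with h h'
    · rw [abs_of_nonneg h]; simp; ring
    · simp at *
    · rw [abs_of_neg (not_le.1 h)]; simp; ring
    · simp at *
  obtain ⟨J, hJ⟩ := BilinForm_exists_sum_le B (fun j => |v j| / S) (fun j => by positivity)
    (by rw [← Finset.sum_div, ← hS, div_self hpos.ne']) u (r + 1) 0
  rw [hm] at hJ
  have hJ0 := hB (fun i => (J i, decide (0 ≤ v (J i))))
  have e : signedSum (fun i => (J i, decide (0 ≤ v (J i)))) = ∑ i, u (J i) := by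
    simp [signedSum, u]
  rw [e] at hJ0
  have hu : ∀ j, B (u j) (u j) ≤ H := by
    intro j
    refine le_trans (le_of_eq ?_) (hH j)
    simp only [u]
    split_ifs <;> simp
  have hs : ∑ j, |v j| / S * B (u j) (u j) ≤ H := by
    calc _ ≤ ∑ j, |v j| / S * H :=
          Finset.sum_le_sum fun j _ => mul_le_mul_of_nonneg_left (hu j) (by positivity)
      _ = H := by rw [← Finset.sum_mul, ← Finset.sum_div, ← hS, div_self hpos.ne', one_mul]
  simp only [zero_add, map_smul, LinearMap.smul_apply, smul_eq_mul] at hJ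
  push_cast at hJ
  have hr' : (0 : ℝ) < r := by exact_mod_cast hr
  set Q := S⁻¹ * (S⁻¹ * B v v) with hQ
  -- With r + 1 draws the quadratic term is (r + 1)² Q, and the variance term takes away (r + 1) Q.
  -- Hence (r + 1)(rQ + H) ≥ 0, which explains r + 1 in the hypothesis and r in the conclusion.
  have h6 : 0 ≤ ((r : ℝ) + 1) * (r * Q + H) := by nlinarith
  have h7 : 0 ≤ r * Q + H := by
    by_contra! hc; nlinarith
  have h8 : B v v = S ^ 2 * Q := by rw [hQ]; field_simp
  rw [h8]
  have h9 : -(H / r) ≤ Q := by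
    rw [neg_le_iff_add_nonneg, ← sub_nonneg] 
    have : Q + H / r - 0 = (r * Q + H) / r := by field_simp; ring
    rw [this]; positivity
  nlinarith [sq_nonneg S]

/-! ### Linear forms and their energy on a set of time points -/

variable {p q : ℕ}

/-- The linear form `v · x`. -/
def linForm (v : Fin p → ℝ) (x : EuclideanSpace ℝ (Fin p)) : ℝ := ∑ k, v k * x k

/-- `∑ t ∈ I, (v · x_t)²`. -/
def quad (I : Finset ℕ) (x : ℕ → EuclideanSpace ℝ (Fin p)) (v : Fin p → ℝ) : ℝ :=
  ∑ t ∈ I, linForm v (x t) ^ 2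

/-- `∑ t ∈ I, ‖D x_t‖²`. -/
def energy (I : Finset ℕ) (x : ℕ → EuclideanSpace ℝ (Fin p)) (D : Matrix (Fin q) (Fin p) ℝ) : ℝ :=
  ∑ l, quad I x (D l)

lemma linForm_add (v w : Fin p → ℝ) (x) : linForm (v + w) x = linForm v x + linForm w x := by
  simp [linForm, add_mul, Finset.sum_add_distrib]

lemma linForm_smul (c : ℝ) (v : Fin p → ℝ) (x) : linForm (c • v) x = c * linForm v x := by
  simp [linForm, mul_assoc, Finset.mul_sum]

lemma linForm_neg (v : Fin p → ℝ) (x) : linForm (-v) x = -linForm v x := by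
  simp [linForm]

lemma linForm_sub (v w : Fin p → ℝ) (x) : linForm (v - w) x = linForm v x - linForm w x := by
  simp [linForm, sub_mul, Finset.sum_sub_distrib]

lemma linForm_single (k : Fin p) (x) : linForm (Pi.single k 1) x = x k := by
  simp [linForm, Pi.single_apply]

/-- The bilinear form with diagonal `α ∑ t ∈ I, (v · x_t)² + β ∑ v²`. -/
def quadBilin (α β : ℝ) (I : Finset ℕ) (x : ℕ → EuclideanSpace ℝ (Fin p)) :
    LinearMap.BilinForm ℝ (Fin p → ℝ) :=
  LinearMap.mk₂ ℝ
    (fun v w => α * ∑ t ∈ I, linForm v (x t) * linForm w (x t) + β * ∑ k, v k * w k)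
    (by intro u v w; simp [linForm_add, add_mul, Finset.sum_add_distrib]; ring)
    (by intro c v w; simp [linForm_smul, mul_assoc, ← Finset.mul_sum]; ring)
    (by intro u v w; simp [linForm_add, mul_add, Finset.sum_add_distrib]; ring)
    (by
      intro c v w
      simp [linForm_smul, mul_left_comm _ c, ← Finset.mul_sum]; ring)

lemma quadBilin_self (α β : ℝ) (I : Finset ℕ) (x : ℕ → EuclideanSpace ℝ (Fin p))
    (v : Fin p → ℝ) : quadBilin α β I x v v = α * quad I x v + β * ∑ k, v k ^ 2 := by
  simp [quadBilin, quad, sq]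

lemma sum_single_sq (j : Fin p) : ∑ k, (Pi.single j (1 : ℝ) : Fin p → ℝ) k ^ 2 = 1 := by
  simp [Pi.single_apply]

/-- Two-sided restricted eigenvalue bounds from bounds on sparse vectors. -/
lemma quad_bounds_of_signedSum {I : Finset ℕ} {x : ℕ → EuclideanSpace ℝ (Fin p)} {r : ℕ}
    (hr : 0 < r) {α β : ℝ} (hα : 0 ≤ α) (hsingle : ∀ j, quad I x (Pi.single j 1) ≤ β)
    (h : ∀ f : Fin (r + 1) → Fin p × Bool, α * ∑ k, signedSum f k ^ 2 ≤ quad I x (signedSum f) ∧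
      quad I x (signedSum f) ≤ β * ∑ k, signedSum f k ^ 2) (v : Fin p → ℝ) :
    α * ∑ k, v k ^ 2 - β / r * (∑ k, |v k|) ^ 2 ≤ quad I x v ∧
      quad I x v ≤ β * ∑ k, v k ^ 2 + β / r * (∑ k, |v k|) ^ 2 := by
  constructor
  -- Maurey's bound is used for the energy minus α‖v‖² and, below, for β‖v‖² minus the energy. Both
  -- forms are at most β on basis vectors.
  · have := BilinForm_ge_of_signedSum (quadBilin 1 (-α) I x) hr (H := β)
      (fun j => by rw [quadBilin_self, sum_single_sq]; linarith [hsingle j])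
      (fun f => by rw [quadBilin_self]; linarith [(h f).1]) v
    rw [quadBilin_self] at this
    linarith
  · have := BilinForm_ge_of_signedSum (quadBilin (-1) β I x) hr (H := β)
      (fun j => by
        rw [quadBilin_self, sum_single_sq]
        have : 0 ≤ quad I x (Pi.single j 1) := Finset.sum_nonneg fun _ _ => sq_nonneg _
        linarith)
      (fun f => by rw [quadBilin_self]; linarith [(h f).2]) v
    rw [quadBilin_self] at this
    linarith

/-! ### Entrywise norms -/

section Norms

variable {p : ℕ}

lemma l1Norm_nonneg (A : Matrix (Fin p) (Fin p) ℝ) : 0 ≤ l1Norm A :=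
  Finset.sum_nonneg fun _ _ => Finset.sum_nonneg fun _ _ => abs_nonneg _

lemma l1Norm_neg (A : Matrix (Fin p) (Fin p) ℝ) : l1Norm (-A) = l1Norm A := by
  simp [l1Norm]

lemma l1Norm_add_le (A B : Matrix (Fin p) (Fin p) ℝ) : l1Norm (A + B) ≤ l1Norm A + l1Norm B := by
  simp only [l1Norm, ← Finset.sum_add_distrib]
  exact Finset.sum_le_sum fun l _ => Finset.sum_le_sum fun k _ => abs_add_le _ _

lemma l1Norm_sub_le (A B : Matrix (Fin p) (Fin p) ℝ) : l1Norm (A - B) ≤ l1Norm A + l1Norm B := by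
  rw [sub_eq_add_neg, ← l1Norm_neg B]
  exact l1Norm_add_le _ _

lemma frobNorm_nonneg (A : Matrix (Fin p) (Fin p) ℝ) : 0 ≤ frobNorm A := Real.sqrt_nonneg _

lemma frobNorm_sq (A : Matrix (Fin p) (Fin p) ℝ) : frobNorm A ^ 2 = ∑ l, ∑ k, A l k ^ 2 :=
  Real.sq_sqrt (Finset.sum_nonneg fun _ _ => Finset.sum_nonneg fun _ _ => sq_nonneg _)

lemma frobNorm_eq_norm (A : Matrix (Fin p) (Fin p) ℝ) :
    frobNorm A = ‖(WithLp.toLp 2 fun e : Fin p × Fin p => A e.1 e.2)‖ := by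
  rw [EuclideanSpace.norm_eq, frobNorm, Fintype.sum_prod_type]
  simp

lemma frobNorm_neg (A : Matrix (Fin p) (Fin p) ℝ) : frobNorm (-A) = frobNorm A := by
  simp [frobNorm]

lemma frobNorm_add_le (A B : Matrix (Fin p) (Fin p) ℝ) :
    frobNorm (A + B) ≤ frobNorm A + frobNorm B := by
  simp only [frobNorm_eq_norm]
  exact norm_add_le (WithLp.toLp 2 fun e : Fin p × Fin p => A e.1 e.2)
    (WithLp.toLp 2 fun e : Fin p × Fin p => B e.1 e.2)

lemma frobNorm_sub_le (A B : Matrix (Fin p) (Fin p) ℝ) :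
    frobNorm (A - B) ≤ frobNorm A + frobNorm B := by
  rw [sub_eq_add_neg, ← frobNorm_neg B]
  exact frobNorm_add_le _ _

lemma l1Norm_eq_sum_prod (A : Matrix (Fin p) (Fin p) ℝ) :
    l1Norm A = ∑ e : Fin p × Fin p, |A e.1 e.2| := by
  rw [l1Norm, Fintype.sum_prod_type]

lemma frobNorm_sq_eq_sum_prod (A : Matrix (Fin p) (Fin p) ℝ) :
    frobNorm A ^ 2 = ∑ e : Fin p × Fin p, A e.1 e.2 ^ 2 := by
  rw [frobNorm_sq, Fintype.sum_prod_type]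

lemma frobNorm_pos {A : Matrix (Fin p) (Fin p) ℝ} (h : A ≠ 0) : 0 < frobNorm A := by
  by_contra! hc
  have h0 : ∑ e : Fin p × Fin p, A e.1 e.2 ^ 2 = 0 := by
    rw [← frobNorm_sq_eq_sum_prod, le_antisymm hc (frobNorm_nonneg A)]; simp
  rw [Finset.sum_eq_zero_iff_of_nonneg fun _ _ => sq_nonneg _] at h0
  exact h (Matrix.ext fun l k => by simpa using h0 (l, k) (Finset.mem_univ _))

lemma sum_abs_le_sqrt_mul_frobNorm (S : Finset (Fin p × Fin p)) {d : ℕ} (hS : S.card ≤ d)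
    (A : Matrix (Fin p) (Fin p) ℝ) :
    ∑ e ∈ S, |A e.1 e.2| ≤ Real.sqrt d * frobNorm A := by
  apply le_of_sq_le_sq _ (mul_nonneg (Real.sqrt_nonneg _) (frobNorm_nonneg A))
  rw [mul_pow, Real.sq_sqrt (Nat.cast_nonneg _), frobNorm_sq_eq_sum_prod]
  calc (∑ e ∈ S, |A e.1 e.2|) ^ 2 ≤ S.card * ∑ e ∈ S, |A e.1 e.2| ^ 2 := sq_sum_le_card_mul_sum_sq
    _ ≤ d * ∑ e : Fin p × Fin p, A e.1 e.2 ^ 2 := by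
        simp only [sq_abs]
        gcongr
        exact Finset.subset_univ S

lemma l1Norm_le_of_supp {d : ℕ} {A : Matrix (Fin p) (Fin p) ℝ} (h : (supp A).card ≤ d) :
    l1Norm A ≤ Real.sqrt d * frobNorm A := by
  refine le_trans (le_of_eq ?_) (sum_abs_le_sqrt_mul_frobNorm (supp A) h A)
  rw [l1Norm_eq_sum_prod]
  symm
  apply Finset.sum_subset (Finset.subset_univ _)
  intro e _ he
  simpa [supp] using he

/-- Restricted eigenvalue bounds hold row by row; this merges their ℓ₁ remainders into one for the
whole matrix. -/
lemma sum_sq_rows_le (A : Matrix (Fin p) (Fin p) ℝ) :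
    ∑ l, (∑ k, |A l k|) ^ 2 ≤ l1Norm A ^ 2 :=
  Finset.sum_sq_le_sq_sum_of_nonneg fun _ _ => Finset.sum_nonneg fun _ _ => abs_nonneg _

lemma supp_sub_card_le (A B : Matrix (Fin p) (Fin p) ℝ) :
    (supp (A - B)).card ≤ (supp A).card + (supp B).card := by
  refine (Finset.card_le_card ?_).trans (Finset.card_union_le _ _)
  intro e he
  by_contra hc
  simp only [supp, Finset.mem_union, Finset.mem_filter, Finset.mem_univ, true_and, not_or,
    not_not] at hc
  exact (Finset.mem_filter.1 he).2 (by rw [Matrix.sub_apply, hc.1, hc.2, sub_zero])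

lemma frobNorm_sq_le_of_supp {A : Matrix (Fin p) (Fin p) ℝ} {c : ℝ}
    (hA : ∀ l k, |A l k| ≤ c) : frobNorm A ^ 2 ≤ (supp A).card * c ^ 2 := by
  rw [frobNorm_sq_eq_sum_prod, ← nsmul_eq_mul, ← Finset.sum_const]
  rw [← Finset.sum_subset (Finset.subset_univ (supp A)) (by
    intro e _ he
    simpa [supp] using he)]
  exact Finset.sum_le_sum fun e _ => sq_le_sq.2 ((hA e.1 e.2).trans (le_abs_self c))

/-- Hard thresholding at level `η` produces few false positives. -/
lemma card_supp_hardThreshold_sdiff (η : ℝ) (hη : 0 ≤ η) (A B : Matrix (Fin p) (Fin p) ℝ) :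
    ((supp (hardThreshold η A) \ supp B).card : ℝ) * η ^ 2 ≤ frobNorm (A - B) ^ 2 := by
  set S := supp (hardThreshold η A) \ supp B
  rw [frobNorm_sq_eq_sum_prod, ← nsmul_eq_mul, ← Finset.sum_const]
  refine le_trans (Finset.sum_le_sum fun e he => ?_) (Finset.sum_le_sum_of_subset_of_nonneg
    (Finset.subset_univ S) fun _ _ _ => sq_nonneg _)
  simp only [S, supp, hardThreshold, Finset.mem_sdiff, Finset.mem_filter, Finset.mem_univ,
    true_and, not_not, Matrix.of_apply] at he
  obtain ⟨h1, h2⟩ := he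
  have h3 : η < |A e.1 e.2| := by
    by_contra hc
    simp [hc] at h1
  rw [Matrix.sub_apply, h2, sub_zero]
  exact sq_le_sq.2 (by rw [abs_of_nonneg hη]; exact h3.le)

end Norms

/-! ### Regular data on a stretch with constant coefficients -/

section Regular

variable {p : ℕ}

/-- Deterministic regularity of the data on a set `I` of time points with coefficient matrix `A`:
restricted eigenvalue bounds and small correlation of noise and predictors. -/
structure Regular (C₁ L : ℝ) (A : Matrix (Fin p) (Fin p) ℝ) (I : Finset ℕ)
    (x : ℕ → EuclideanSpace ℝ (Fin p)) : Prop where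
  lower : ∀ v : Fin p → ℝ, I.card / (2 * C₁) * ∑ k, v k ^ 2
    - 384 * C₁ * L * (∑ k, |v k|) ^ 2 ≤ quad I x v
  upper : ∀ v : Fin p → ℝ, quad I x v ≤ 3 / 2 * C₁ * I.card * ∑ k, v k ^ 2
    + 384 * C₁ * L * (∑ k, |v k|) ^ 2
  noise : ∀ l k, l ≠ k →
    |∑ t ∈ I, (x t l - linForm (A l) (x t)) * x t k| ≤ 16 * C₁ * Real.sqrt (I.card * L)

/-- `∑ t ∈ I, ⟨x_t - A x_t, D x_t⟩`. -/
def cross (A : Matrix (Fin p) (Fin p) ℝ) (I : Finset ℕ) (x : ℕ → EuclideanSpace ℝ (Fin p))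
    (D : Matrix (Fin p) (Fin p) ℝ) : ℝ :=
  ∑ t ∈ I, ∑ l, (x t l - linForm (A l) (x t)) * linForm (D l) (x t)

lemma energy_nonneg (I : Finset ℕ) (x : ℕ → EuclideanSpace ℝ (Fin p))
    (D : Matrix (Fin p) (Fin p) ℝ) : 0 ≤ energy I x D :=
  Finset.sum_nonneg fun _ _ => Finset.sum_nonneg fun _ _ => sq_nonneg _

/-- All comparisons of losses use this expansion around the true coefficients, in which the noise
enters only through a term linear in D. -/
lemma sum_residSq_add (A D : Matrix (Fin p) (Fin p) ℝ) (I : Finset ℕ)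
    (x : ℕ → EuclideanSpace ℝ (Fin p)) :
    ∑ t ∈ I, residSq (A + D) (x t) =
      ∑ t ∈ I, residSq A (x t) + energy I x D - 2 * cross A I x D := by
  simp only [energy, quad, cross]
  rw [Finset.sum_comm (s := Finset.univ), Finset.mul_sum, ← Finset.sum_add_distrib,
    ← Finset.sum_sub_distrib]
  refine Finset.sum_congr rfl fun t _ => ?_
  rw [residSq, residSq, Finset.mul_sum, ← Finset.sum_add_distrib, ← Finset.sum_sub_distrib]
  refine Finset.sum_congr rfl fun l _ => ?_
  have : ∑ k, (A + D) l k * x t k = linForm (A l) (x t) + linForm (D l) (x t) := by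
    simp [linForm, add_mul, Finset.sum_add_distrib]
  rw [this]
  change _ = (x t l - linForm (A l) (x t)) ^ 2 + _ - _
  ring

lemma cross_sub (A : Matrix (Fin p) (Fin p) ℝ) (I : Finset ℕ) (x : ℕ → EuclideanSpace ℝ (Fin p))
    (D E : Matrix (Fin p) (Fin p) ℝ) : cross A I x (D - E) = cross A I x D - cross A I x E := by
  have : ∀ l, (D - E) l = D l - E l := fun _ => rfl
  simp [cross, this, linForm_sub, mul_sub, Finset.sum_sub_distrib]

/-- Termwise, the difference of the two sides is (a + 2b)²/2. -/
lemma energy_add_ge (I : Finset ℕ) (x : ℕ → EuclideanSpace ℝ (Fin p))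
    (D E : Matrix (Fin p) (Fin p) ℝ) :
    1 / 2 * energy I x D - energy I x E ≤ energy I x (D + E) := by
  simp only [energy, quad, Finset.mul_sum, ← Finset.sum_sub_distrib]
  refine Finset.sum_le_sum fun l _ => Finset.sum_le_sum fun t _ => ?_
  have : (D + E) l = D l + E l := rfl
  rw [this, linForm_add]
  nlinarith [sq_nonneg (linForm (D l) (x t) + 2 * linForm (E l) (x t))]

lemma mul_linForm (c : ℝ) (v : Fin p → ℝ) (y : EuclideanSpace ℝ (Fin p)) :
    c * linForm v y = ∑ k, v k * (c * y k) := by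
  rw [linForm, Finset.mul_sum]
  exact Finset.sum_congr rfl fun k _ => by ring

variable {C₁ L : ℝ} {A : Matrix (Fin p) (Fin p) ℝ} {I : Finset ℕ}
  {x : ℕ → EuclideanSpace ℝ (Fin p)}

lemma Regular.energy_lower (h : Regular C₁ L A I x) (hC₁ : 0 ≤ C₁) (hL : 0 ≤ L)
    (D : Matrix (Fin p) (Fin p) ℝ) :
    I.card / (2 * C₁) * frobNorm D ^ 2 - 384 * C₁ * L * l1Norm D ^ 2 ≤ energy I x D := by
  have h1 := Finset.sum_le_sum fun l (_ : l ∈ Finset.univ) => h.lower (D l)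
  rw [Finset.sum_sub_distrib, ← Finset.mul_sum, ← Finset.mul_sum] at h1
  rw [frobNorm_sq]
  have h2 := mul_le_mul_of_nonneg_left (sum_sq_rows_le D) (by positivity : 0 ≤ 384 * C₁ * L)
  exact le_trans (by linarith) h1

lemma Regular.energy_upper (h : Regular C₁ L A I x) (hC₁ : 0 ≤ C₁) (hL : 0 ≤ L)
    (D : Matrix (Fin p) (Fin p) ℝ) :
    energy I x D ≤ 3 / 2 * C₁ * I.card * frobNorm D ^ 2 + 384 * C₁ * L * l1Norm D ^ 2 := by
  have h1 := Finset.sum_le_sum fun l (_ : l ∈ Finset.univ) => h.upper (D l)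
  rw [Finset.sum_add_distrib, ← Finset.mul_sum, ← Finset.mul_sum] at h1
  rw [frobNorm_sq]
  have h2 := mul_le_mul_of_nonneg_left (sum_sq_rows_le D) (by positivity : 0 ≤ 384 * C₁ * L)
  exact le_trans h1 (by linarith)

/-- Hölder's inequality between the entrywise maximum of the noise and the ℓ₁ norm. The diagonal of
D must vanish because a residual is correlated with its own variable. -/
lemma Regular.abs_cross_le (h : Regular C₁ L A I x) {D : Matrix (Fin p) (Fin p) ℝ}
    (hD : ∀ l, D l l = 0) :
    |cross A I x D| ≤ 16 * C₁ * Real.sqrt (I.card * L) * l1Norm D := by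
  have e : cross A I x D =
      ∑ l, ∑ k, D l k * ∑ t ∈ I, (x t l - linForm (A l) (x t)) * x t k := by
    rw [cross, Finset.sum_comm]
    refine Finset.sum_congr rfl fun l _ => ?_
    simp only [Finset.mul_sum]
    rw [Finset.sum_comm]
    exact Finset.sum_congr rfl fun t _ => mul_linForm _ _ _
  rw [e, l1Norm, Finset.mul_sum]
  refine (Finset.abs_sum_le_sum_abs _ _).trans (Finset.sum_le_sum fun l _ => ?_)
  rw [Finset.mul_sum]
  refine (Finset.abs_sum_le_sum_abs _ _).trans (Finset.sum_le_sum fun k _ => ?_)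
  rw [abs_mul, mul_comm]
  by_cases hlk : l = k
  · simp [← hlk, hD]
  · exact mul_le_mul_of_nonneg_right (h.noise l k hlk) (abs_nonneg _)

/-- The basic inequality of the lasso implies the cone condition and the estimation rate. -/
lemma Regular.lasso_bound (h : Regular C₁ L A I x) (hC₁ : 0 < C₁) (hL : 0 < L) {b c₁ c₂ : ℝ}
    {d : ℕ} (hb : 0 < b) (hI₁ : b ≤ I.card) (hI₂ : I.card ≤ 2 * b) (hc₁ : 0 ≤ c₁)
    (hc₂ : 2 * (2 * c₁ + 64 * C₁) ≤ c₂)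
    (hd : (supp A).card ≤ d) (hsmall : 24576 * C₁ ^ 2 * (d * L) ≤ b)
    {D : Matrix (Fin p) (Fin p) ℝ} (hD : ∀ l, D l l = 0)
    (hbasic : energy I x D - 2 * cross A I x D ≤ 2 * c₁ * Real.sqrt (b * L) * l1Norm D
      + c₂ * Real.sqrt (b * L) * (l1Norm A - l1Norm (A + D))) :
    l1Norm D ≤ 4 * Real.sqrt d * frobNorm D ∧
      frobNorm D ≤ 6 * C₁ * c₂ * Real.sqrt (d * L / b) := by
  set R := Real.sqrt (b * L) with hR
  have hRpos : 0 < R := Real.sqrt_pos.2 (by positivity)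
  have hc₂pos : 0 < c₂ := by linarith
  have hcr := (abs_le.1 (h.abs_cross_le hD)).2
  have hsq : Real.sqrt (I.card * L) ≤ 2 * R := by
    have hR2 : R ^ 2 = b * L := Real.sq_sqrt (by positivity)
    refine Real.sqrt_le_iff.2 ⟨by positivity, ?_⟩
    rw [mul_pow, hR2]
    nlinarith
  set T := ∑ e ∈ supp A, |D e.1 e.2| with hT
  have hT1 : T ≤ Real.sqrt d * frobNorm D := sum_abs_le_sqrt_mul_frobNorm _ hd D
  -- Decomposability of the ℓ₁ norm: off the support of A, the entries of D are pure cost.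
  have hpen : l1Norm A - l1Norm (A + D) ≤ 2 * T - l1Norm D := by
    simp only [l1Norm_eq_sum_prod]
    rw [hT, Finset.mul_sum]
    have : ∑ e ∈ supp A, 2 * |D e.1 e.2| =
        ∑ e : Fin p × Fin p, if e ∈ supp A then 2 * |D e.1 e.2| else 0 := by
      simp
    rw [this, ← Finset.sum_sub_distrib, ← Finset.sum_sub_distrib]
    refine Finset.sum_le_sum fun e _ => ?_
    split_ifs with he
    · have := abs_sub_abs_le_abs_sub (A e.1 e.2) ((A + D) e.1 e.2)
      rw [Matrix.add_apply, sub_add_cancel_left, abs_neg] at this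
      rw [Matrix.add_apply]
      linarith
    · have : A e.1 e.2 = 0 := by simpa [supp] using he
      rw [Matrix.add_apply, this]; simp
  have hl1 := l1Norm_nonneg D
  have hup : energy I x D ≤ c₂ * R * (2 * T - 1 / 2 * l1Norm D) := by
    have h1 : 2 * (16 * C₁ * Real.sqrt (I.card * L) * l1Norm D) ≤ 64 * C₁ * R * l1Norm D := by
      have := mul_le_mul_of_nonneg_right (mul_le_mul_of_nonneg_left hsq
        (by positivity : 0 ≤ 16 * C₁)) hl1
      linarith
    have h2 : c₂ * R * (l1Norm A - l1Norm (A + D)) ≤ c₂ * R * (2 * T - l1Norm D) :=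
      mul_le_mul_of_nonneg_left hpen (by positivity)
    have h3 : (2 * c₁ + 64 * C₁) * (R * l1Norm D) ≤ c₂ / 2 * (R * l1Norm D) :=
      mul_le_mul_of_nonneg_right (by linarith) (by positivity)
    linarith
  have hen := energy_nonneg I x D
  have hcone : l1Norm D ≤ 4 * T := by
    by_contra! hc
    have : c₂ * R * (2 * T - 1 / 2 * l1Norm D) < 0 :=
      mul_neg_of_pos_of_neg (by positivity) (by linarith)
    linarith
  have hcone' : l1Norm D ≤ 4 * Real.sqrt d * frobNorm D := by linarith
  refine ⟨hcone', ?_⟩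
  have hF := frobNorm_nonneg D
  have hlow := h.energy_lower hC₁.le hL.le D
  have h16 : l1Norm D ^ 2 ≤ 16 * d * frobNorm D ^ 2 := by
    calc l1Norm D ^ 2 ≤ (4 * Real.sqrt d * frobNorm D) ^ 2 := by gcongr
      _ = 16 * d * frobNorm D ^ 2 := by
        rw [mul_pow, mul_pow, Real.sq_sqrt (Nat.cast_nonneg _)]; ring
  -- In the cone the ℓ₁ remainder is at most 384 · 16 C₁ dL‖D‖², which takes at most half of the
  -- curvature; 24576 = 384 · 16 · 4.
  have hlow2 : b / (4 * C₁) * frobNorm D ^ 2 ≤ energy I x D := by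
    have h1 : 384 * C₁ * L * l1Norm D ^ 2 ≤ 384 * C₁ * L * (16 * d * frobNorm D ^ 2) :=
      mul_le_mul_of_nonneg_left h16 (by positivity)
    have h2 : 384 * C₁ * L * (16 * d) ≤ b / (4 * C₁) := by
      rw [le_div_iff₀ (by positivity)]; linarith
    have h3 := mul_le_mul_of_nonneg_right h2 (sq_nonneg (frobNorm D))
    have h4 : b / (2 * C₁) * frobNorm D ^ 2 ≤ I.card / (2 * C₁) * frobNorm D ^ 2 := by gcongr
    have h5 : b / (2 * C₁) * frobNorm D ^ 2 = 2 * (b / (4 * C₁) * frobNorm D ^ 2) := by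
      field_simp; ring
    linarith
  have hup2 : energy I x D ≤ 3 / 2 * c₂ * R * Real.sqrt d * frobNorm D := by
    have h0 : 2 * T - 1 / 2 * l1Norm D ≤ 3 / 2 * (Real.sqrt d * frobNorm D) := by
      have : T ≤ l1Norm D := by
        rw [l1Norm_eq_sum_prod]
        exact Finset.sum_le_sum_of_subset_of_nonneg (Finset.subset_univ _) fun _ _ _ => abs_nonneg _
      linarith
    have := mul_le_mul_of_nonneg_left h0 (by positivity : 0 ≤ c₂ * R)
    linarith
  have hkey : b * frobNorm D ≤ 6 * C₁ * c₂ * (R * Real.sqrt d) := by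
    rcases hF.eq_or_lt with h0 | hpos
    · rw [← h0, mul_zero]; positivity
    have h1 := hlow2.trans hup2
    have h2 : frobNorm D * (b * frobNorm D) ≤ frobNorm D * (6 * C₁ * c₂ * (R * Real.sqrt d)) := by
      have := mul_le_mul_of_nonneg_left h1 (by positivity : 0 ≤ 4 * C₁)
      have e : 4 * C₁ * (b / (4 * C₁) * frobNorm D ^ 2) = frobNorm D * (b * frobNorm D) := by
        field_simp
      rw [e] at this
      linarith
    exact le_of_mul_le_mul_left h2 hpos
  have e : R * Real.sqrt d = b * Real.sqrt (d * L / b) := by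
    rw [hR, ← Real.sqrt_mul (x := b * L) (by positivity)]
    rw [show b * L * d = b ^ 2 * (d * L / b) by field_simp, Real.sqrt_mul (x := b ^ 2) (by positivity),
      Real.sqrt_sq hb.le]
  rw [e] at hkey
  exact le_of_mul_le_mul_left (by linarith) hb

end Regular

/-! ### Comparing the losses of two estimates on one stretch -/

section Search

variable {p : ℕ} {C₁ L : ℝ} {A : Matrix (Fin p) (Fin p) ℝ} {I : Finset ℕ}
  {x : ℕ → EuclideanSpace ℝ (Fin p)}

/-- The energy of an estimation error in the cone. -/
lemma Regular.energy_error_le (h : Regular C₁ L A I x) (hC₁ : 0 < C₁) (hL : 0 < L) {d : ℕ}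
    {e B₀ c₀ Q y r : ℝ} (hr : r ^ 2 = I.card)
    (he : e ^ 2 ≤ 1) (hy : r * e ≤ y / c₀) (hr0 : 0 ≤ r) (he0 : 0 ≤ e)
    (hS : d * L ≤ (y / Q) ^ 2) {E : Matrix (Fin p) (Fin p) ℝ} (hE : frobNorm E ≤ B₀ * e)
    (hE1 : l1Norm E ≤ 4 * Real.sqrt d * frobNorm E) :
    energy I x E ≤ 3 / 2 * C₁ * B₀ ^ 2 * (y / c₀) ^ 2 + 6144 * C₁ * B₀ ^ 2 * (y / Q) ^ 2 := by
  have h1 := h.energy_upper hC₁.le hL.le E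
  have hF := frobNorm_nonneg E
  have h2 : frobNorm E ^ 2 ≤ B₀ ^ 2 * e ^ 2 := by rw [← mul_pow]; gcongr
  have h3 : l1Norm E ^ 2 ≤ 16 * d * (B₀ ^ 2 * e ^ 2) := by
    calc l1Norm E ^ 2 ≤ (4 * Real.sqrt d * frobNorm E) ^ 2 := by
          gcongr; exact l1Norm_nonneg E
      _ = 16 * d * frobNorm E ^ 2 := by
        rw [mul_pow, mul_pow, Real.sq_sqrt (Nat.cast_nonneg _)]; ring
      _ ≤ _ := by gcongr
  have h4 : (I.card : ℝ) * frobNorm E ^ 2 ≤ B₀ ^ 2 * (y / c₀) ^ 2 := by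
    calc (I.card : ℝ) * frobNorm E ^ 2 ≤ I.card * (B₀ ^ 2 * e ^ 2) := by gcongr
      _ = B₀ ^ 2 * (r * e) ^ 2 := by rw [← hr]; ring
      _ ≤ _ := by gcongr
  -- Here e ≤ 1 matters: the ℓ₁ remainder is of order dL e², and dL alone is only bounded by (y/Q)².
  have h5 : L * l1Norm E ^ 2 ≤ 16 * (B₀ ^ 2 * (y / Q) ^ 2) := by
    calc L * l1Norm E ^ 2 ≤ L * (16 * d * (B₀ ^ 2 * e ^ 2)) := by gcongr
      _ = 16 * (B₀ ^ 2 * ((d * L) * e ^ 2)) := by ring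
      _ ≤ 16 * (B₀ ^ 2 * ((y / Q) ^ 2 * 1)) := by gcongr
      _ = _ := by ring
  have h6 := mul_le_mul_of_nonneg_left h4 (by positivity : 0 ≤ 3 / 2 * C₁)
  have h7 := mul_le_mul_of_nonneg_left h5 (by positivity : 0 ≤ 384 * C₁)
  linarith

/-- On a long stretch with coefficients `A`, an estimate of `A` has a smaller loss than an estimate
of a different matrix `A'`. -/
lemma Regular.loss_lt (h : Regular C₁ L A I x) (hC₁ : 0 < C₁) (hL : 0 < L) {d : ℕ}
    {A' Ae Ae' : Matrix (Fin p) (Fin p) ℝ} {e B₀ c₀ Q ν : ℝ}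
    (hA : ∀ l, A l l = 0) (hAe : ∀ l, Ae l l = 0)
    (hAe' : ∀ l, Ae' l l = 0) (hd : (supp A).card ≤ d) (hd' : (supp A').card ≤ d)
    (hE : frobNorm (Ae - A) ≤ B₀ * e)
    (hE1 : l1Norm (Ae - A) ≤ 4 * Real.sqrt d * frobNorm (Ae - A))
    (hE' : frobNorm (Ae' - A') ≤ B₀ * e)
    (hE1' : l1Norm (Ae' - A') ≤ 4 * Real.sqrt d * frobNorm (Ae' - A'))
    (hc₀ : 0 < c₀) (hQ : 0 < Q) (hB₀ : 0 ≤ B₀) (he0 : 0 ≤ e) (he1 : e ≤ 1) (hν : 0 < ν)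
    (heν : c₀ * e ≤ ν) (hνA : ν ≤ frobNorm (A' - A))
    (hjump : I.card / (2 * C₁) * frobNorm (A' - A) ^ 2 ≤ energy I x (A' - A))
    (hlong : Q ^ 2 * (d * L) < I.card * ν ^ 2)
    (hconst : 3 * C₁ * B₀ ^ 2 / c₀ ^ 2 + 12288 * C₁ * B₀ ^ 2 / Q ^ 2
      + 32 * C₁ * (2 / Q + 8 * B₀ / (Q * c₀)) < 1 / (4 * C₁)) :
    ∑ t ∈ I, residSq Ae (x t) < ∑ t ∈ I, residSq Ae' (x t) := by
  set D := A' - A with hDdef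
  set E := Ae - A with hEdef
  set E' := Ae' - A' with hEdef'
  set r := Real.sqrt I.card with hr
  -- The square y² is the scale of the jump energy. Below, √(dL) ≤ y/Q and r e ≤ y/c₀, so every
  -- error term is a small multiple of y².
  set y := r * frobNorm D with hy
  set S := Real.sqrt (d * L) with hS
  have hr0 : 0 ≤ r := Real.sqrt_nonneg _
  have hr2 : r ^ 2 = I.card := Real.sq_sqrt (Nat.cast_nonneg _)
  have hS2 : S ^ 2 = d * L := Real.sq_sqrt (by positivity)
  have hS0 : 0 ≤ S := Real.sqrt_nonneg _
  have hD0 := frobNorm_nonneg D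
  have hrpos : 0 < r := by
    rcases hr0.eq_or_lt with h0 | h0
    · rw [← hr2, ← h0] at hlong
      have : 0 ≤ Q ^ 2 * (d * L) := by positivity
      simp at hlong; linarith
    · exact h0
  have hypos : 0 < y := mul_pos hrpos (hν.trans_le hνA)
  have hSy : S ≤ y / Q := by
    rw [le_div_iff₀ hQ]
    apply le_of_sq_le_sq _ hypos.le
    calc (S * Q) ^ 2 = Q ^ 2 * (d * L) := by rw [mul_pow, hS2]; ring
      _ ≤ I.card * ν ^ 2 := hlong.le
      _ ≤ I.card * frobNorm D ^ 2 := by gcongr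
      _ = y ^ 2 := by rw [hy, mul_pow, hr2]
  have hrey : r * e ≤ y / c₀ := by
    rw [le_div_iff₀ hc₀]
    calc r * e * c₀ = r * (c₀ * e) := by ring
      _ ≤ r * frobNorm D := by gcongr; exact heν.trans hνA
  have hS' : d * L ≤ (y / Q) ^ 2 := by rw [← hS2]; gcongr
  have he2 : e ^ 2 ≤ 1 := pow_le_one₀ he0 he1
  have hen := h.energy_error_le hC₁ hL hr2 he2 hrey hr0 he0 hS' hE hE1
  have hen' := h.energy_error_le hC₁ hL hr2 he2 hrey hr0 he0 hS' hE' hE1'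
  have hsum : ∑ t ∈ I, residSq Ae' (x t) - ∑ t ∈ I, residSq Ae (x t) =
      energy I x (D + E') - energy I x E - 2 * cross A I x (D + E' - E) := by
    have e1 : Ae = A + E := by rw [hEdef]; abel
    have e2 : Ae' = A + (D + E') := by rw [hEdef', hDdef]; abel
    have r1 := sum_residSq_add A E I x
    have r2 := sum_residSq_add A (D + E') I x
    rw [← e1] at r1
    rw [← e2] at r2
    have r3 := cross_sub A I x (D + E') E
    linarith
  have hdiag : ∀ l, (D + E' - E) l l = 0 := by
    intro l
    simp [hDdef, hEdef, hEdef', Matrix.sub_apply, hA, hAe, hAe']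
  have hcr := (abs_le.1 (h.abs_cross_le hdiag)).2
  have hl1 : l1Norm (D + E' - E) ≤ l1Norm D + l1Norm E' + l1Norm E :=
    (l1Norm_sub_le _ _).trans (add_le_add_left (l1Norm_add_le _ _) _)
  -- The bound 2d would do; 4d has the convenient root 2√d.
  have hdd : (supp D).card ≤ 4 * d := (supp_sub_card_le _ _).trans (by omega)
  have hDl1 : l1Norm D ≤ 2 * Real.sqrt d * frobNorm D := by
    refine (l1Norm_le_of_supp hdd).trans (le_of_eq ?_)
    push_cast
    rw [Real.sqrt_mul (by norm_num), show (4 : ℝ) = 2 ^ 2 by norm_num,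
      Real.sqrt_sq (by norm_num)]
  have hrS : Real.sqrt (I.card * L) * Real.sqrt d = r * S := by
    rw [hr, hS, ← Real.sqrt_mul (by positivity), ← Real.sqrt_mul (by positivity)]
    congr 1; ring
  have hsl : 0 ≤ Real.sqrt (I.card * L) := Real.sqrt_nonneg _
  have hb1 : Real.sqrt (I.card * L) * l1Norm D ≤ 2 * (y / Q) * y := by
    calc Real.sqrt (I.card * L) * l1Norm D
        ≤ Real.sqrt (I.card * L) * (2 * Real.sqrt d * frobNorm D) := by gcongr
      _ = 2 * (Real.sqrt (I.card * L) * Real.sqrt d) * frobNorm D := by ring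
      _ = 2 * S * y := by rw [hrS, hy]; ring
      _ ≤ _ := by gcongr
  have hb2 : ∀ F : Matrix (Fin p) (Fin p) ℝ, frobNorm F ≤ B₀ * e →
      l1Norm F ≤ 4 * Real.sqrt d * frobNorm F →
      Real.sqrt (I.card * L) * l1Norm F ≤ 4 * B₀ * (y / Q) * (y / c₀) := by
    intro F hF hF1
    calc Real.sqrt (I.card * L) * l1Norm F
        ≤ Real.sqrt (I.card * L) * (4 * Real.sqrt d * (B₀ * e)) := by
          gcongr
          exact hF1.trans (by gcongr)
      _ = 4 * B₀ * (Real.sqrt (I.card * L) * Real.sqrt d) * e := by ring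
      _ = 4 * B₀ * S * (r * e) := by rw [hrS]; ring
      _ ≤ _ := by gcongr
  have hb3 := hb2 E hE hE1
  have hb4 := hb2 E' hE' hE1'
  have hcr2 : cross A I x (D + E' - E) ≤
      16 * C₁ * (2 * (y / Q) * y + 8 * B₀ * (y / Q) * (y / c₀)) := by
    refine hcr.trans ?_
    have := mul_le_mul_of_nonneg_left hl1 (by positivity : 0 ≤ 16 * C₁ * Real.sqrt (I.card * L))
    have h2 := mul_le_mul_of_nonneg_left (add_le_add hb1 (add_le_add hb3 hb4))
      (by positivity : 0 ≤ 16 * C₁)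
    linarith
  have hlow := energy_add_ge I x D E'
  -- The jump energy is a separate hypothesis: the restricted eigenvalue bound has an ℓ₁ remainder
  -- of order dL‖D‖², which a stretch of order L points would not dominate.
  have hj : 1 / (2 * C₁) * y ^ 2 ≤ energy I x D := by
    refine le_trans (le_of_eq ?_) hjump
    rw [hy, mul_pow, hr2]; ring
  have hfin := mul_lt_mul_of_pos_right hconst (by positivity : 0 < y ^ 2)
  have e1 : (3 * C₁ * B₀ ^ 2 / c₀ ^ 2 + 12288 * C₁ * B₀ ^ 2 / Q ^ 2
      + 32 * C₁ * (2 / Q + 8 * B₀ / (Q * c₀))) * y ^ 2 =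
      2 * (3 / 2 * C₁ * B₀ ^ 2 * (y / c₀) ^ 2 + 6144 * C₁ * B₀ ^ 2 * (y / Q) ^ 2)
      + 2 * (16 * C₁ * (2 * (y / Q) * y + 8 * B₀ * (y / Q) * (y / c₀))) := by
    field_simp; ring
  have e2 : 1 / (4 * C₁) * y ^ 2 = 1 / 2 * (1 / (2 * C₁) * y ^ 2) := by field_simp; ring
  rw [e1, e2] at hfin
  linarith

/-- A stretch that is long compared with the squared jump is long compared with `L`. -/
lemma mul_le_of_long {p d : ℕ} {A A' : Matrix (Fin p) (Fin p) ℝ} {C_A K L ν : ℝ} {ℓ : ℕ}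
    (hC_A : 0 < C_A) (hL : 0 < L) (hdpos : 0 < d)
    (hd : (supp A).card ≤ d) (hd' : (supp A').card ≤ d)
    (hb : ∀ l k, |A l k| ≤ C_A) (hb' : ∀ l k, |A' l k| ≤ C_A) (hν : 0 < ν)
    (hνA : ν ≤ frobNorm (A' - A)) (hK : 8192 * C_A ^ 2 ≤ K)
    (hlong : K * (d * L) < ℓ * ν ^ 2) : 1024 * L ≤ ℓ := by
  have h1 : ν ^ 2 ≤ 2 * d * (2 * C_A) ^ 2 := by
    calc ν ^ 2 ≤ frobNorm (A' - A) ^ 2 := by gcongr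
      _ ≤ (supp (A' - A)).card * (2 * C_A) ^ 2 := frobNorm_sq_le_of_supp fun l k => by
          rw [Matrix.sub_apply]
          exact (abs_sub _ _).trans (by linarith [hb l k, hb' l k])
      _ ≤ _ := by
          gcongr
          have : (supp (A' - A)).card ≤ 2 * d := (supp_sub_card_le _ _).trans (by omega)
          exact_mod_cast this
  have hd0 : (0 : ℝ) < d := by exact_mod_cast hdpos
  have h2 : 8192 * C_A ^ 2 * (d * L) ≤ ℓ * (2 * d * (2 * C_A) ^ 2) :=
    calc _ ≤ K * (d * L) := by gcongr
      _ ≤ _ := hlong.le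
      _ ≤ _ := by gcongr
  have h3 : (8 * d * C_A ^ 2) * (1024 * L) ≤ (8 * d * C_A ^ 2) * ℓ := by linarith
  exact le_of_mul_le_mul_left h3 (by positivity)

end Search

/-! ### Blocks, change points and segments -/

namespace Model

variable {M : Model} {b S : ℕ}

/-- The index of the block that contains the change point `t_j`; block `0` for `j = 0`. -/
def cpBlock (M : Model) (b j : ℕ) : ℕ := if j = 0 then 0 else (M.cp j - 1) / b + 1

/-- The `i`-th block lies in the `j`-th segment. -/
structure InSegment (M : Model) (b j i : ℕ) : Prop where
  one_le : 1 ≤ i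
  le : i ≤ M.n / b
  left : M.cp (j - 1) ≤ blockEnd M.n b (i - 1)
  right : blockEnd M.n b i ≤ M.cp j

lemma spacing_le {j : ℕ} (hj : j ∈ Finset.Icc 1 (M.m₀ + 1)) :
    M.cp (j - 1) + M.spacing ≤ M.cp j := by
  have h1 : M.spacing ≤ M.cp j - M.cp (j - 1) := Finset.inf'_le _ hj
  have h2 := M.cp_lt j hj
  omega

lemma cp_mono {i j : ℕ} (hij : i ≤ j) (hj : j ≤ M.m₀ + 1) : M.cp i ≤ M.cp j := by
  induction j, hij using Nat.le_induction with
  | base => exact le_rfl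
  | succ j hij ih =>
    have := M.cp_lt (j + 1) (Finset.mem_Icc.2 ⟨by omega, hj⟩)
    simp only [Nat.add_sub_cancel] at this
    exact (ih (by omega)).trans this.le

lemma one_le_cp {j : ℕ} (hj : j ≤ M.m₀ + 1) : 1 ≤ M.cp j :=
  M.cp_zero ▸ cp_mono (Nat.zero_le j) hj

lemma cp_le {j : ℕ} (hj : j ≤ M.m₀ + 1) : M.cp j ≤ M.n + 1 := M.cp_last ▸ cp_mono hj le_rfl

lemma cpBlock_zero : M.cpBlock b 0 = 0 := by simp [cpBlock]

/-- The end n + 1 is assigned a fictitious block after the last one, and the start a fictitious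
block 0, so that the boundary segments need no separate treatment. -/
lemma cpBlock_last : M.cpBlock b (M.m₀ + 1) = M.n / b + 1 := by
  simp [cpBlock, M.cp_last]

lemma cpBlock_of_pos {j : ℕ} (hj : 1 ≤ j) : M.cpBlock b j = (M.cp j - 1) / b + 1 := by
  rw [cpBlock, if_neg (by omega)]

lemma cp_bounds (hb : 0 < b) {j : ℕ} (hj : j ∈ Finset.Icc 1 (M.m₀ + 1)) :
    (M.cpBlock b j - 1) * b + 1 ≤ M.cp j ∧ M.cp j ≤ M.cpBlock b j * b := by
  obtain ⟨h1, h2⟩ := Finset.mem_Icc.1 hj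
  rw [cpBlock_of_pos h1]
  have h3 := one_le_cp (M := M) h2
  have h4 := Nat.div_add_mod (M.cp j - 1) b
  have h5 := Nat.mod_lt (M.cp j - 1) hb
  constructor
  · rw [Nat.add_sub_cancel, mul_comm]
    omega
  · have : ((M.cp j - 1) / b + 1) * b = b * ((M.cp j - 1) / b) + b := by ring
    omega

lemma cpBlock_add_le (hb : 0 < b) (hS : S * b ≤ M.spacing) {j : ℕ}
    (hj : j ∈ Finset.Icc 1 (M.m₀ + 1)) : M.cpBlock b (j - 1) + S ≤ M.cpBlock b j := by
  obtain ⟨h1, h2⟩ := Finset.mem_Icc.1 hj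
  have h3 := spacing_le hj
  rw [cpBlock_of_pos h1]
  rcases h1.eq_or_lt with rfl | h1
  · simp only [Nat.sub_self, cpBlock_zero, M.cp_zero] at h3 ⊢
    have : S ≤ (M.cp 1 - 1) / b := (Nat.le_div_iff_mul_le hb).2 (by omega)
    omega
  · rw [cpBlock_of_pos (by omega)]
    have h4 := one_le_cp (M := M) (j := j - 1) (by omega)
    have : (M.cp (j - 1) - 1) / b + S ≤ (M.cp j - 1) / b := by
      rw [← Nat.add_mul_div_right _ _ hb]
      exact Nat.div_le_div_right (by omega)
    omega

lemma cpBlock_mono (hb : 0 < b) (hS : S * b ≤ M.spacing) {i j : ℕ} (hij : i ≤ j)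
    (hj : j ≤ M.m₀ + 1) : M.cpBlock b i ≤ M.cpBlock b j := by
  induction j, hij using Nat.le_induction with
  | base => exact le_rfl
  | succ j hij ih =>
    have := cpBlock_add_le hb hS (j := j + 1) (Finset.mem_Icc.2 ⟨by omega, hj⟩)
    simp only [Nat.add_sub_cancel] at this
    have := ih (by omega)
    omega

lemma cpBlock_add_le_of_lt (hb : 0 < b) (hS : S * b ≤ M.spacing) {i j : ℕ} (hij : i < j)
    (hj : j ≤ M.m₀ + 1) : M.cpBlock b i + S ≤ M.cpBlock b j := by
  have h1 := cpBlock_add_le hb hS (j := j) (Finset.mem_Icc.2 ⟨by omega, hj⟩)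
  have h2 := cpBlock_mono (i := i) (j := j - 1) hb hS (by omega) (by omega)
  omega

lemma cpBlock_add_le_last (hb : 0 < b) (hS : S * b ≤ M.spacing) {j : ℕ}
    (hj : j ∈ Finset.Icc 1 M.m₀) : M.cpBlock b j + S ≤ M.n / b + 1 := by
  rw [← cpBlock_last]
  exact cpBlock_add_le_of_lt hb hS (by have := Finset.mem_Icc.1 hj; omega) le_rfl

lemma exists_segment {i : ℕ} (hi1 : 1 ≤ i) (hi : i ≤ M.n / b) :
    ∃ j ∈ Finset.Icc 1 (M.m₀ + 1), M.cpBlock b (j - 1) < i ∧ i ≤ M.cpBlock b j := by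
  have hex : ∃ j, i ≤ M.cpBlock b j := ⟨M.m₀ + 1, by rw [cpBlock_last]; omega⟩
  classical
  have hpos : 0 < Nat.find hex := by
    rw [Nat.find_pos, cpBlock_zero]; omega
  have hle : Nat.find hex ≤ M.m₀ + 1 := Nat.find_le (by rw [cpBlock_last]; omega)
  exact ⟨Nat.find hex, Finset.mem_Icc.2 ⟨hpos, hle⟩,
    not_le.1 (Nat.find_min hex (by omega)), Nat.find_spec hex⟩

lemma blockEnd_of_lt {n i : ℕ} (h : i < n / b) : blockEnd n b i = 1 + i * b := if_pos h

lemma blockEnd_sub_bounds {n i : ℕ} (hb : 0 < b) (hi1 : 1 ≤ i) (hi : i ≤ n / b) :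
    b ≤ blockEnd n b i - blockEnd n b (i - 1) ∧
      blockEnd n b i - blockEnd n b (i - 1) ≤ 2 * b := by
  obtain ⟨i, rfl⟩ : ∃ i', i = i' + 1 := ⟨i - 1, by omega⟩
  simp only [Nat.add_sub_cancel]
  rw [blockEnd_of_lt (i := i) (by omega)]
  have e : (i + 1) * b = i * b + b := by ring
  rcases hi.eq_or_lt with h | h
  · rw [blockEnd, if_neg (by omega)]
    have h4 := Nat.div_add_mod n b
    have h5 := Nat.mod_lt n hb
    rw [← h, mul_comm, e] at h4
    omega
  · rw [blockEnd_of_lt h]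
    omega

lemma inSegment_of_lt (hb : 0 < b) (hS : S * b ≤ M.spacing) (hS1 : 1 ≤ S) {j i : ℕ} (hj : j ∈ Finset.Icc 1 (M.m₀ + 1))
    (h1 : M.cpBlock b (j - 1) < i) (h2 : i < M.cpBlock b j) : M.InSegment b j i := by
  obtain ⟨hj1, hj2⟩ := Finset.mem_Icc.1 hj
  have hik : i ≤ M.n / b := by
    rw [cpBlock_of_pos hj1] at h2
    have : (M.cp j - 1) / b ≤ M.n / b := Nat.div_le_div_right (by have := cp_le hj2; omega)
    omega
  refine ⟨by omega, hik, ?_, ?_⟩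
  · rw [blockEnd_of_lt (by omega)]
    rcases hj1.eq_or_lt with rfl | hj1
    · simp [M.cp_zero]
    · have h3 := (cp_bounds (M := M) hb (j := j - 1) (Finset.mem_Icc.2 ⟨by omega, by omega⟩)).2
      have h4 : M.cpBlock b (j - 1) * b ≤ (i - 1) * b := Nat.mul_le_mul_right _ (by omega)
      omega
  · rcases hj2.eq_or_lt with rfl | hj2
    · rw [M.cp_last, blockEnd]
      split_ifs with h
      · have h5 := (Nat.le_div_iff_mul_le hb).1 h.le
        omega
      · exact le_rfl
    · have h5 : i < M.n / b := by
        have := cpBlock_add_le_last hb hS (j := j) (Finset.mem_Icc.2 ⟨hj1, by omega⟩)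
        omega
      rw [blockEnd_of_lt h5]
      have h3 := (cp_bounds hb hj).1
      have h4 : i * b ≤ (M.cpBlock b j - 1) * b := Nat.mul_le_mul_right _ (by omega)
      omega

/-- A block that starts at a change point lies in the segment after it. -/
lemma inSegment_of_cp_eq (hb : 0 < b) (hS : S * b ≤ M.spacing) (hS1 : 3 ≤ S) {j : ℕ}
    (hj : j ∈ Finset.Icc 1 M.m₀) (h : M.cp j = (M.cpBlock b j - 1) * b + 1) :
    M.InSegment b (j + 1) (M.cpBlock b j) := by
  obtain ⟨hj1, hj2⟩ := Finset.mem_Icc.1 hj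
  have h0 : 1 ≤ M.cpBlock b j := by rw [cpBlock_of_pos hj1]; exact Nat.le_add_left 1 _
  have h1 := cpBlock_add_le_last hb hS hj
  have h2 := spacing_le (M := M) (j := j + 1) (Finset.mem_Icc.2 ⟨by omega, by omega⟩)
  simp only [Nat.add_sub_cancel] at h2
  refine ⟨h0, by omega, ?_, ?_⟩
  · rw [blockEnd_of_lt (by omega), Nat.add_sub_cancel]
    omega
  · rw [blockEnd_of_lt (by omega)]
    have h3 : 3 * b ≤ S * b := Nat.mul_le_mul_right _ hS1
    have h4 : M.cpBlock b j * b = (M.cpBlock b j - 1) * b + b := by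
      rw [← Nat.succ_mul, Nat.succ_eq_add_one, Nat.sub_add_cancel h0]
    omega

end Model

/-! ### Candidates and clusters -/

section Clusters

variable {M : Model} {b S : ℕ}

lemma partialSum_sub {p : ℕ} (Θ : ℕ → Matrix (Fin p) (Fin p) ℝ) {i : ℕ} (hi : 1 ≤ i) :
    partialSum Θ i = partialSum Θ (i - 1) + Θ i := by
  obtain ⟨i, rfl⟩ : ∃ i', i = i' + 1 := ⟨i - 1, by omega⟩
  rw [partialSum, Finset.sum_Icc_succ_top (by omega), Nat.add_sub_cancel, partialSum]

/-- The block estimates `Θ_1 + ⋯ + Θ_i` are accurate on all blocks without change points. -/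
def Accurate (M : Model) (b : ℕ) (δ : ℝ) (Θ : ℕ → Matrix (Fin M.p) (Fin M.p) ℝ) : Prop :=
  ∀ j ∈ Finset.Icc 1 (M.m₀ + 1), ∀ i, M.InSegment b j i → frobNorm (partialSum Θ i - M.A j) ≤ δ

variable {δ κ : ℝ} {Θ : ℕ → Matrix (Fin M.p) (Fin M.p) ℝ}

/-- Θ_i is the difference of two estimates of the same matrix. -/
lemma Accurate.frobNorm_le (h : Accurate M b δ Θ) {j i : ℕ}
    (hj : j ∈ Finset.Icc 1 (M.m₀ + 1)) (h1 : M.InSegment b j (i - 1)) (h2 : M.InSegment b j i) :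
    frobNorm (Θ i) ≤ 2 * δ := by
  have e : Θ i = (partialSum Θ i - M.A j) - (partialSum Θ (i - 1) - M.A j) := by
    rw [partialSum_sub Θ h2.one_le]; abel
  rw [e]
  refine (frobNorm_sub_le _ _).trans ?_
  linarith [h j hj _ h1, h j hj _ h2]

/-- A candidate cannot be preceded by a block of its own segment, so it contains a change point or
directly follows a block that does. If the change point opens its block, that block is itself pure,
which excludes the second case; the strict search interval later relies on this. -/
lemma Accurate.candidate_near (h : Accurate M b δ Θ) (hb : 0 < b) (hS : S * b ≤ M.spacing)
    (hS1 : 3 ≤ S) (hδ : 2 * δ ≤ κ * M.jump) {i : ℕ}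
    (hi : i ∈ candidates (M.n / b) (κ * M.jump) Θ) :
    ∃ j ∈ Finset.Icc 1 M.m₀, i = M.cpBlock b j ∨
      (i = M.cpBlock b j + 1 ∧ M.cp j ≠ (M.cpBlock b j - 1) * b + 1) := by
  obtain ⟨hik, hw⟩ := Finset.mem_filter.1 hi
  obtain ⟨hi2, hik⟩ := Finset.mem_Icc.1 hik
  obtain ⟨j, hj, hj1, hj2⟩ := Model.exists_segment (M := M) (b := b) (i := i) (by omega) hik
  obtain ⟨hj3, hj4⟩ := Finset.mem_Icc.1 hj
  rcases hj2.eq_or_lt with heq | hlt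
  · refine ⟨j, Finset.mem_Icc.2 ⟨hj3, ?_⟩, Or.inl heq⟩
    by_contra hc
    have : j = M.m₀ + 1 := by omega
    rw [heq, this, Model.cpBlock_last] at hik
    omega
  · have hin := Model.inSegment_of_lt hb hS (by omega) hj hj1 hlt
    by_cases hprev : M.cpBlock b (j - 1) < i - 1
    · have := h.frobNorm_le hj (Model.inSegment_of_lt hb hS (by omega) hj hprev (by omega)) hin
      linarith
    · have hj5 : j ≠ 1 := by
        rintro rfl
        rw [Nat.sub_self, Model.cpBlock_zero] at hprev
        omega
      have hj6 : j - 1 ∈ Finset.Icc 1 M.m₀ := Finset.mem_Icc.2 ⟨by omega, by omega⟩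
      refine ⟨j - 1, hj6, Or.inr ⟨by omega, fun hc => ?_⟩⟩
      have h1 := Model.inSegment_of_cp_eq hb hS hS1 hj6 hc
      rw [Nat.sub_add_cancel hj3, show M.cpBlock b (j - 1) = i - 1 by omega] at h1
      have := h.frobNorm_le hj h1 hin
      linarith

lemma Model.jump_le {j : ℕ} (hj : j ∈ Finset.Icc 1 M.m₀) :
    M.jump ≤ frobNorm (M.A (j + 1) - M.A j) := Finset.inf'_le _ hj

lemma Model.jump_pos : 0 < M.jump := by
  rw [Model.jump, Finset.lt_inf'_iff]
  exact fun j hj => frobNorm_pos (sub_ne_zero.2 (M.change j hj))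

/-- The blocks before and after the one with the change point are pure, in different segments. Hence
Θ_i + Θ_{i+1} is the true jump up to 2δ; two summands of norm at most κν could not produce it. -/
lemma Accurate.exists_candidate (h : Accurate M b δ Θ) (hb : 0 < b) (hS : S * b ≤ M.spacing)
    (hS1 : 3 ≤ S) (hδ : 2 * δ < (1 - 2 * κ) * M.jump) {j : ℕ} (hj : j ∈ Finset.Icc 1 M.m₀) :
    M.cpBlock b j ∈ candidates (M.n / b) (κ * M.jump) Θ ∨
      M.cpBlock b j + 1 ∈ candidates (M.n / b) (κ * M.jump) Θ := by
  obtain ⟨hj1, hj2⟩ := Finset.mem_Icc.1 hj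
  have hja : j ∈ Finset.Icc 1 (M.m₀ + 1) := Finset.mem_Icc.2 ⟨hj1, by omega⟩
  have hjb : j + 1 ∈ Finset.Icc 1 (M.m₀ + 1) := Finset.mem_Icc.2 ⟨by omega, by omega⟩
  have h1 := Model.cpBlock_add_le hb hS hja
  have h2 := Model.cpBlock_add_le hb hS hjb
  have h3 := Model.cpBlock_add_le_last hb hS hj
  simp only [Nat.add_sub_cancel] at h2
  set i := M.cpBlock b j
  have ha := h j hja (i - 1) (Model.inSegment_of_lt hb hS (by omega) hja (by omega) (by omega))
  have hb' := h (j + 1) hjb (i + 1) (Model.inSegment_of_lt hb hS (by omega) hjb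
    (by simp only [Nat.add_sub_cancel]; omega) (by omega))
  by_contra! hc
  have hc1 : frobNorm (Θ i) ≤ κ * M.jump := by
    by_contra! hlt
    exact hc.1 (Finset.mem_filter.2 ⟨Finset.mem_Icc.2 ⟨by omega, by omega⟩, hlt⟩)
  have hc2 : frobNorm (Θ (i + 1)) ≤ κ * M.jump := by
    by_contra! hlt
    exact hc.2 (Finset.mem_filter.2 ⟨Finset.mem_Icc.2 ⟨by omega, by omega⟩, hlt⟩)
  have e : M.A (j + 1) - M.A j = (Θ i + Θ (i + 1)) - (partialSum Θ (i + 1) - M.A (j + 1))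
      + (partialSum Θ (i - 1) - M.A j) := by
    rw [partialSum_sub Θ (i := i + 1) (by omega), Nat.add_sub_cancel,
      partialSum_sub Θ (i := i) (by omega)]
    abel
  have h4 := Model.jump_le hj
  rw [e] at h4
  have h5 := frobNorm_add_le ((Θ i + Θ (i + 1)) - (partialSum Θ (i + 1) - M.A (j + 1)))
    (partialSum Θ (i - 1) - M.A j)
  have h6 := frobNorm_sub_le (Θ i + Θ (i + 1)) (partialSum Θ (i + 1) - M.A (j + 1))
  have h7 := frobNorm_add_le (Θ i) (Θ (i + 1))
  linarith

/-- Every minimal clustering of candidates that surround the change points has exactly one cluster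
for each change point. -/
lemma IsClustering.eq_of_near {D : ℝ} {I : Finset ℕ} {m : ℕ} {J : ℕ → Finset ℕ}
    (hJ : IsClustering (blockEnd M.n b) D I m J)
    (hmin : ∀ m' J', IsClustering (blockEnd M.n b) D I m' J' → m ≤ m')
    (hb : 0 < b) (hS : S * b ≤ M.spacing) (hS1 : 4 ≤ S) (hbD : (b : ℝ) ≤ D)
    (hDS : D < (S - 1 : ℝ) * b)
    (hnear : ∀ i ∈ I, ∃ j ∈ Finset.Icc 1 M.m₀, i = M.cpBlock b j ∨ i = M.cpBlock b j + 1)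
    (hex : ∀ j ∈ Finset.Icc 1 M.m₀, M.cpBlock b j ∈ I ∨ M.cpBlock b j + 1 ∈ I) :
    m = M.m₀ ∧ ∀ j ∈ Finset.Icc 1 M.m₀, (J j).Nonempty ∧ J j ⊆ I ∧
      ∀ i ∈ J j, i = M.cpBlock b j ∨ i = M.cpBlock b j + 1 := by
  set g := M.cpBlock b with hg
  have hgap : ∀ j j', 1 ≤ j → j < j' → j' ≤ M.m₀ → g j + S ≤ g j' := fun j j' _ h h' =>
    Model.cpBlock_add_le_of_lt hb hS h (by omega)
  have hglast : ∀ j ∈ Finset.Icc 1 M.m₀, g j + S ≤ M.n / b + 1 := fun j hj =>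
    Model.cpBlock_add_le_last hb hS hj
  have hgpos : ∀ j ∈ Finset.Icc 1 M.m₀, 1 ≤ g j := fun j hj => by
    rw [hg, Model.cpBlock_of_pos (Finset.mem_Icc.1 hj).1]; exact Nat.le_add_left 1 _
  have hend : ∀ j ∈ Finset.Icc 1 M.m₀, ∀ i, i = g j ∨ i = g j + 1 →
      (blockEnd M.n b (i - 1) : ℝ) = 1 + (i - 1 : ℝ) * b := by
    intro j hj i hi
    have h1 := hglast j hj
    have h2 := hgpos j hj
    rw [Model.blockEnd_of_lt (by omega)]
    push_cast [Nat.cast_sub (show 1 ≤ i by omega)]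
    ring
  have hb0 : (0 : ℝ) < b := by exact_mod_cast hb
  -- the natural clustering
  have hle : m ≤ M.m₀ := by
    refine hmin M.m₀ (fun j => I.filter fun i => i = g j ∨ i = g j + 1) ⟨?_, ?_, ?_, ?_⟩
    · intro j hj
      rcases hex j hj with h | h
      · exact ⟨_, Finset.mem_filter.2 ⟨h, Or.inl rfl⟩⟩
      · exact ⟨_, Finset.mem_filter.2 ⟨h, Or.inr rfl⟩⟩
    · ext i
      simp only [Finset.mem_biUnion, Finset.mem_filter]
      exact ⟨fun ⟨j, _, h, _⟩ => h, fun h => by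
        obtain ⟨j, hj, hj'⟩ := hnear i h
        exact ⟨j, hj, h, hj'⟩⟩
    · intro j hj j' hj' hlt i hi i' hi'
      have h1 := (Finset.mem_filter.1 hi).2
      have h2 := (Finset.mem_filter.1 hi').2
      have h3 := hgap j j' (Finset.mem_Icc.1 hj).1 hlt (Finset.mem_Icc.1 hj').2
      omega
    · intro j hj i hi i' hi'
      have h1 := (Finset.mem_filter.1 hi).2
      have h2 := (Finset.mem_filter.1 hi').2
      rw [hend j hj i h1, hend j hj i' h2]
      have e : (1 + ((i : ℝ) - 1) * b) - (1 + ((i' : ℝ) - 1) * b) = ((i : ℝ) - i') * b := by ring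
      rw [e, abs_mul, abs_of_pos hb0]
      have : |(i : ℝ) - i'| ≤ 1 := by
        rcases h1 with rfl | rfl <;> rcases h2 with rfl | rfl <;> simp
      nlinarith
  -- points near different change points are in different clusters
  have hsep : ∀ a ∈ Finset.Icc 1 m, ∀ i ∈ J a, ∀ i' ∈ J a, ∀ j ∈ Finset.Icc 1 M.m₀,
      ∀ j' ∈ Finset.Icc 1 M.m₀, (i = g j ∨ i = g j + 1) → (i' = g j' ∨ i' = g j' + 1) →
      ¬ j < j' := by
    intro a ha i hi i' hi' j hj j' hj' h1 h2 hlt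
    have h3 := hJ.diam a ha i' hi' i hi
    rw [hend j hj i h1, hend j' hj' i' h2] at h3
    have h4 := hgap j j' (Finset.mem_Icc.1 hj).1 hlt (Finset.mem_Icc.1 hj').2
    have h5 : i + S ≤ i' + 1 := by omega
    have h6 : (i : ℝ) + S ≤ i' + 1 := by exact_mod_cast h5
    have h7 := (le_abs_self _).trans h3
    nlinarith
  have hmem : ∀ i ∈ I, ∃ a ∈ Finset.Icc 1 m, i ∈ J a := by
    intro i hi
    rw [← hJ.cover] at hi
    simpa using hi
  have hsub : ∀ a ∈ Finset.Icc 1 m, J a ⊆ I := by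
    intro a ha
    rw [← hJ.cover]
    exact Finset.subset_biUnion_of_mem J ha
  have hch : ∀ j, ∃ i a, j ∈ Finset.Icc 1 M.m₀ →
      (i = g j ∨ i = g j + 1) ∧ a ∈ Finset.Icc 1 m ∧ i ∈ J a := by
    intro j
    by_cases hj : j ∈ Finset.Icc 1 M.m₀
    · rcases hex j hj with h | h <;> obtain ⟨a, ha, hia⟩ := hmem _ h
      · exact ⟨_, a, fun _ => ⟨Or.inl rfl, ha, hia⟩⟩
      · exact ⟨_, a, fun _ => ⟨Or.inr rfl, ha, hia⟩⟩
    · exact ⟨0, 0, fun h => absurd h hj⟩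
  choose i φ hφ using hch
  have hmono : ∀ j ∈ Finset.Icc 1 M.m₀, ∀ j' ∈ Finset.Icc 1 M.m₀, j < j' → φ j < φ j' := by
    intro j hj j' hj' hlt
    obtain ⟨h1, h2, h3⟩ := hφ j hj
    obtain ⟨h4, h5, h6⟩ := hφ j' hj'
    by_contra! hc
    rcases hc.eq_or_lt with heq | hlt'
    · rw [heq] at h6
      exact hsep _ h2 _ h3 _ h6 j hj j' hj' h1 h4 hlt
    · have h7 := hJ.ordered _ h5 _ h2 hlt' _ h6 _ h3
      have h8 := hgap j j' (Finset.mem_Icc.1 hj).1 hlt (Finset.mem_Icc.1 hj').2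
      omega
  -- A strictly increasing map φ from {1, …, m₀} to {1, …, m} satisfies j ≤ φ j ≤ m - (m₀ - j). With
  -- m ≤ m₀ this forces m = m₀ and φ = id.
  have hlow : ∀ j, 1 ≤ j → j ≤ M.m₀ → j ≤ φ j := by
    intro j hj
    induction j, hj using Nat.le_induction with
    | base =>
      intro h
      exact (Finset.mem_Icc.1 (hφ 1 (Finset.mem_Icc.2 ⟨le_rfl, h⟩)).2.1).1
    | succ j hj ih =>
      intro h
      have := hmono j (Finset.mem_Icc.2 ⟨hj, by omega⟩) (j + 1)
        (Finset.mem_Icc.2 ⟨by omega, h⟩) (by omega)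
      have := ih (by omega)
      omega
  have hup : ∀ s, s < M.m₀ → φ (M.m₀ - s) ≤ m - s := by
    intro s
    induction s with
    | zero =>
      intro h
      exact (Finset.mem_Icc.1 (hφ M.m₀ (Finset.mem_Icc.2 ⟨M.one_le_m₀, le_rfl⟩)).2.1).2
    | succ s ih =>
      intro h
      have h1 := hmono (M.m₀ - (s + 1)) (Finset.mem_Icc.2 ⟨by omega, by omega⟩) (M.m₀ - s)
        (Finset.mem_Icc.2 ⟨by omega, by omega⟩) (by omega)
      have := ih (by omega)
      omega
  have hm : m = M.m₀ := by
    have h1 := hlow M.m₀ M.one_le_m₀ le_rfl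
    have h2 := hup 0 M.one_le_m₀
    simp only [Nat.sub_zero] at h2
    omega
  have hid : ∀ j ∈ Finset.Icc 1 M.m₀, φ j = j := by
    intro j hj
    obtain ⟨h1, h2⟩ := Finset.mem_Icc.1 hj
    have h3 := hlow j h1 h2
    have h4 := hup (M.m₀ - j) (by omega)
    rw [Nat.sub_sub_self h2, hm, Nat.sub_sub_self h2] at h4
    omega
  refine ⟨hm, fun j hj => ⟨hJ.nonempty j (hm ▸ hj), hsub j (hm ▸ hj), fun i' hi' => ?_⟩⟩
  obtain ⟨j', hj', h1⟩ := hnear i' (hsub j (hm ▸ hj) hi')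
  obtain ⟨h2, -, h3⟩ := hφ j hj
  rw [hid j hj] at h3
  have h4 := hsep j (hm ▸ hj) _ hi' _ h3 j' hj' j hj h1 h2
  have h5 := hsep j (hm ▸ hj) _ h3 _ hi' j hj j' hj' h2 h1
  have : j' = j := by omega
  exact this ▸ h1

end Clusters
-- Position of clusters and search intervals
section Geometry

variable {M : Model} {b S : ℕ} {o : Output M.p}

/-- The clusters of an output sit at the change points: `J_j ⊆ {i, i + 1}` where the `i`-th block
contains `t_j`, and `i + 1` only occurs if `t_j` is not the first point of its block. -/
structure Aligned (M : Model) (b : ℕ) (o : Output M.p) : Prop where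
  m_eq : o.m = M.m₀
  nonempty : ∀ j ∈ Finset.Icc 1 M.m₀, (o.J j).Nonempty
  near : ∀ j ∈ Finset.Icc 1 M.m₀, ∀ i ∈ o.J j, i = M.cpBlock b j ∨
    (i = M.cpBlock b j + 1 ∧ M.cp j ≠ (M.cpBlock b j - 1) * b + 1)

lemma Aligned.maxJ_mem (h : Aligned M b o) {j : ℕ} (hj : j ∈ Finset.Icc 1 M.m₀) :
    o.maxJ j ∈ o.J j := by
  rw [Output.maxJ, if_neg (by have := Finset.mem_Icc.1 hj; omega)]
  obtain ⟨i, hi, he⟩ := Finset.exists_mem_eq_sup (o.J j) (h.nonempty j hj) id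
  rw [he]
  exact hi

lemma Aligned.minJ_mem (h : Aligned M b o) (k : ℕ) {j : ℕ} (hj : j ∈ Finset.Icc 1 M.m₀) :
    o.minJ k j ∈ o.J j := by
  rw [Output.minJ, if_neg (by have := Finset.mem_Icc.1 hj; rw [h.m_eq]; omega)]
  exact Nat.sInf_mem (s := (o.J j : Set ℕ)) (h.nonempty j hj)

lemma Aligned.le_maxJ {j i : ℕ} (hj : j ∈ Finset.Icc 1 M.m₀) (hi : i ∈ o.J j) : i ≤ o.maxJ j := by
  rw [Output.maxJ, if_neg (by have := Finset.mem_Icc.1 hj; omega)]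
  exact Finset.le_sup (f := id) hi

lemma Aligned.minJ_le (h : Aligned M b o) (k : ℕ) {j i : ℕ} (hj : j ∈ Finset.Icc 1 M.m₀)
    (hi : i ∈ o.J j) : o.minJ k j ≤ i := by
  rw [Output.minJ, if_neg (by have := Finset.mem_Icc.1 hj; rw [h.m_eq]; omega)]
  exact Nat.sInf_le hi

/-- The two indices are within one block of consecutive change-point blocks, which are at least four
apart, so their rounded midpoint is strictly between. The conventions J_0 = {1} and J_{m+1} = {k}
are also one off from the fictitious blocks 0 and k + 1. -/
lemma Aligned.inSegment (h : Aligned M b o) (hb : 0 < b) (hS : S * b ≤ M.spacing) (hS1 : 4 ≤ S)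
    {j : ℕ} (hj : j ∈ Finset.Icc 1 (M.m₀ + 1)) :
    M.InSegment b j ((o.maxJ (j - 1) + o.minJ (M.n / b) j) / 2) := by
  obtain ⟨hj1, hj2⟩ := Finset.mem_Icc.1 hj
  have h1 := Model.cpBlock_add_le hb hS hj
  have h2 : M.cpBlock b (j - 1) ≤ o.maxJ (j - 1) ∧ o.maxJ (j - 1) ≤ M.cpBlock b (j - 1) + 1 := by
    rcases hj1.eq_or_lt with rfl | hj1
    · simp [Output.maxJ, Model.cpBlock_zero]
    · have hj' : j - 1 ∈ Finset.Icc 1 M.m₀ := Finset.mem_Icc.2 ⟨by omega, by omega⟩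
      have := h.near _ hj' _ (h.maxJ_mem hj')
      omega
  have h3 : M.cpBlock b j ≤ o.minJ (M.n / b) j + 1 ∧
      o.minJ (M.n / b) j ≤ M.cpBlock b j + 1 := by
    rcases hj2.eq_or_lt with rfl | hj2
    · rw [Output.minJ, if_pos (by rw [h.m_eq]), Model.cpBlock_last]
      omega
    · have hj' : j ∈ Finset.Icc 1 M.m₀ := Finset.mem_Icc.2 ⟨hj1, by omega⟩
      have := h.near _ hj' _ (h.minJ_mem (M.n / b) hj')
      omega
  exact Model.inSegment_of_lt hb hS (by omega) hj (by omega) (by omega)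

/-- Position of the search interval relative to the change points. -/
lemma Aligned.search_window (h : Aligned M b o) (hb : 0 < b) (hS : S * b ≤ M.spacing)
    (hS1 : 4 ≤ S) {j : ℕ} (hj : j ∈ Finset.Icc 1 M.m₀) :
    M.cp j ∈ Finset.Ioo (o.lo M.n b j) (o.hi M.n b j) ∧
      o.minR M.n b j - b ≤ o.lo M.n b j ∧ o.hi M.n b j ≤ o.maxR M.n b j + b ∧
      M.cp (j - 1) ≤ o.lo M.n b j ∧ o.hi M.n b j ≤ M.cp (j + 1) := by
  obtain ⟨hj1, hj2⟩ := Finset.mem_Icc.1 hj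
  have hja : j ∈ Finset.Icc 1 (M.m₀ + 1) := Finset.mem_Icc.2 ⟨hj1, by omega⟩
  have hjb : j + 1 ∈ Finset.Icc 1 (M.m₀ + 1) := Finset.mem_Icc.2 ⟨by omega, by omega⟩
  obtain ⟨hc1, hc2⟩ := Model.cp_bounds hb hja
  have hs1 := Model.spacing_le hja
  have hs2 := Model.spacing_le hjb
  simp only [Nat.add_sub_cancel] at hs2
  have hs3 : 4 * b ≤ S * b := Nat.mul_le_mul_right _ hS1
  have hlast := Model.cpBlock_add_le_last hb hS hj
  have hg1 : 1 ≤ M.cpBlock b j := by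
    rw [Model.cpBlock_of_pos hj1]; exact Nat.le_add_left 1 _
  have hmin := h.minJ_mem (M.n / b) hj
  have hmax := h.maxJ_mem hj
  have hnmin := h.near j hj _ hmin
  have hnmax := h.near j hj _ hmax
  have hR1 : o.minR M.n b j = 1 + (o.minJ (M.n / b) j - 1) * b :=
    Model.blockEnd_of_lt (by omega)
  have hR2 : o.maxR M.n b j = 1 + (o.maxJ j - 1) * b := Model.blockEnd_of_lt (by omega)
  set g := M.cpBlock b j
  have hgb : g * b = (g - 1) * b + b := by
    rw [← Nat.succ_mul, Nat.succ_eq_add_one, Nat.sub_add_cancel hg1]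
  have hgb' : (g + 1 - 1) * b = (g - 1) * b + b := by rw [Nat.add_sub_cancel, hgb]
  rw [Finset.mem_Ioo, Output.lo, Output.hi]
  split_ifs with hcard
  · obtain ⟨a, ha⟩ := Finset.card_eq_one.1 hcard
    rw [ha, Finset.mem_singleton] at hmin hmax
    rw [hmin] at hR1 hnmin
    rw [hmax] at hR2
    -- For the cluster {g} the open interval reaches b to either side. For {g + 1} it begins at the
    -- start of block g, so t_j must not be that point; this is the extra clause of `Aligned`. The
    -- cluster {g, g + 1} below needs it too.
    rcases hnmin with rfl | ⟨rfl, hne⟩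
    · rw [hR1, hR2]
      omega
    · rw [hR1, hR2, hgb']
      omega
  · have hlt : o.minJ (M.n / b) j < o.maxJ j := by
      by_contra! hle
      apply hcard
      rw [Finset.card_eq_one]
      refine ⟨o.minJ (M.n / b) j, Finset.eq_singleton_iff_unique_mem.2 ⟨hmin, fun i hi => ?_⟩⟩
      have h1 := Aligned.le_maxJ hj hi
      have h2 := h.minJ_le (M.n / b) hj hi
      omega
    have e1 : o.minJ (M.n / b) j = g := by omega
    have e2 : o.maxJ j = g + 1 := by omega
    rw [hR1, hR2, e1, e2, hgb']
    omega

lemma sum_search_sub {f g : ℕ → ℝ} {a s t z : ℕ} (h1 : a ≤ s) (h2 : s ≤ t) (h3 : t ≤ z) :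
    (∑ i ∈ Finset.Ico a s, f i + ∑ i ∈ Finset.Ico s z, g i)
      - (∑ i ∈ Finset.Ico a t, f i + ∑ i ∈ Finset.Ico t z, g i) =
      ∑ i ∈ Finset.Ico s t, g i - ∑ i ∈ Finset.Ico s t, f i := by
  rw [← Finset.sum_Ico_consecutive f h1 h2, ← Finset.sum_Ico_consecutive g h2 h3]
  ring

end Geometry

/-! ### Regular samples -/

/-- Deterministic regularity of the data of a model: every stretch of length at least `1024 L`
inside a segment is regular, and the jumps have the expected energy. -/
structure Good (M : Model) (C₁ : ℝ) (x : ℕ → EuclideanSpace ℝ (Fin M.p)) : Prop where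
  regular : ∀ j ∈ Finset.Icc 1 (M.m₀ + 1), ∀ s t, M.cp (j - 1) ≤ s → t ≤ M.cp j → s ≤ t →
    1024 * M.logpn ≤ ((t - s : ℕ) : ℝ) → Regular C₁ M.logpn (M.A j) (Finset.Ico s t) x
  jump : ∀ j ∈ Finset.Icc 1 (M.m₀ + 1), ∀ s t, M.cp (j - 1) ≤ s → t ≤ M.cp j → s ≤ t →
    1024 * M.logpn ≤ ((t - s : ℕ) : ℝ) → ∀ j' ∈ Finset.Icc 1 M.m₀,
    ((t - s : ℕ) : ℝ) / (2 * C₁) * frobNorm (M.A (j' + 1) - M.A j') ^ 2 ≤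
      energy (Finset.Ico s t) x (M.A (j' + 1) - M.A j')

/-! ### Rates of the three steps on regular data -/

section Rates

variable {M : Model} {b : ℕ}

/-- Exchanging the estimate in one block for another matrix. -/
lemma objective_update {p n b i : ℕ} {lam₁ lam₂ : ℝ} (hlam₁ : 0 ≤ lam₁)
    (x : ℕ → EuclideanSpace ℝ (Fin p)) (Θ : ℕ → Matrix (Fin p) (Fin p) ℝ)
    (hi1 : 1 ≤ i) (hi : i ≤ n / b) (H : Matrix (Fin p) (Fin p) ℝ) :
    objective n b lam₁ lam₂ x
      (Function.update (Function.update Θ i (Θ i + H)) (i + 1) (Θ (i + 1) - H))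
      - objective n b lam₁ lam₂ x Θ ≤
    1 / (n : ℝ) * (∑ t ∈ Finset.Ico (blockEnd n b (i - 1)) (blockEnd n b i),
        residSq (partialSum Θ i + H) (x t)
      - ∑ t ∈ Finset.Ico (blockEnd n b (i - 1)) (blockEnd n b i), residSq (partialSum Θ i) (x t))
    + lam₁ * (2 * l1Norm H) + lam₂ * (l1Norm (partialSum Θ i + H) - l1Norm (partialSum Θ i)) := by
  set Θ' := Function.update (Function.update Θ i (Θ i + H)) (i + 1) (Θ (i + 1) - H) with hΘ'
  have hval : ∀ q, Θ' q = Θ q + ((if q = i then H else 0) - (if q = i + 1 then H else 0)) := by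
    intro q
    rw [hΘ']
    rcases eq_or_ne q (i + 1) with rfl | h1
    · simp [sub_eq_add_neg]
    · rcases eq_or_ne q i with rfl | h2
      · simp
      · simp [h1, h2]
  -- The added and the subtracted H cancel in all later partial sums, so no other block is affected.
  have hps : ∀ r, partialSum Θ' r = partialSum Θ r + if r = i then H else 0 := by
    intro r
    simp only [partialSum, hval, Finset.sum_add_distrib, Finset.sum_sub_distrib,
      Finset.sum_ite_eq', Finset.mem_Icc]
    congr 1
    rcases lt_trichotomy r i with h | h | h
    · simp [show ¬ (i ≤ r) by omega, show ¬ (i + 1 ≤ r) by omega, h.ne]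
    · subst h; simp [hi1]
    · simp [show i ≤ r by omega, show i + 1 ≤ r by omega, h.ne', hi1]
  have hmem : i ∈ Finset.Icc 1 (n / b) := Finset.mem_Icc.2 ⟨hi1, hi⟩
  have h1 : ∀ F : ℕ → Matrix (Fin p) (Fin p) ℝ → ℝ,
      ∑ r ∈ Finset.Icc 1 (n / b), F r (partialSum Θ' r) -
        ∑ r ∈ Finset.Icc 1 (n / b), F r (partialSum Θ r) =
      F i (partialSum Θ i + H) - F i (partialSum Θ i) := by
    intro F
    rw [← Finset.sum_sub_distrib, Finset.sum_eq_single i]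
    · rw [hps, if_pos rfl]
    · intro r _ hr
      rw [hps, if_neg hr, add_zero, sub_self]
    · exact fun h => absurd hmem h
  have h2 := h1 fun r A => ∑ t ∈ Finset.Ico (blockEnd n b (r - 1)) (blockEnd n b r),
    residSq A (x t)
  have h3 := h1 fun _ A => l1Norm A
  have h4 : ∑ r ∈ Finset.Icc 1 (n / b), l1Norm (Θ' r) -
      ∑ r ∈ Finset.Icc 1 (n / b), l1Norm (Θ r) ≤ 2 * l1Norm H := by
    rw [← Finset.sum_sub_distrib]
    calc _ ≤ ∑ r ∈ Finset.Icc 1 (n / b),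
          ((if r = i then l1Norm H else 0) + (if r = i + 1 then l1Norm H else 0)) := by
          refine Finset.sum_le_sum fun r _ => ?_
          rw [hval, sub_le_iff_le_add']
          refine (l1Norm_add_le _ _).trans (add_le_add_right ((l1Norm_sub_le _ _).trans ?_) _)
          have h0 : l1Norm (0 : Matrix (Fin p) (Fin p) ℝ) = 0 := by simp [l1Norm]
          split_ifs <;> simp [h0]
      _ ≤ l1Norm H + l1Norm H := by
          rw [Finset.sum_add_distrib]
          refine add_le_add ?_ ?_ <;> rw [Finset.sum_ite_eq'] <;> split_ifs <;>
            first | exact le_rfl | exact l1Norm_nonneg H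
      _ = _ := by ring
  have h5 := mul_le_mul_of_nonneg_left h4 hlam₁
  simp only [objective]
  rw [← h2, ← h3]
  linarith

lemma mul_penalty (hn : 0 < M.n) (hL : 0 ≤ M.logpn) (c : ℝ) :
    (M.n : ℝ) * M.penalty b c = c * Real.sqrt (b * M.logpn) := by
  have hn' : (0 : ℝ) < M.n := by exact_mod_cast hn
  rw [Model.penalty, mul_assoc c, ← Real.sqrt_mul (by positivity)]
  have e : M.logpn / M.n * (b / M.n) = (b * M.logpn) / (M.n : ℝ) ^ 2 := by field_simp
  rw [e, Real.sqrt_div (by positivity), Real.sqrt_sq hn'.le]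
  field_simp

lemma energy_neg {p : ℕ} (I : Finset ℕ) (x : ℕ → EuclideanSpace ℝ (Fin p))
    (D : Matrix (Fin p) (Fin p) ℝ) : energy I x (-D) = energy I x D := by
  have : ∀ l, (-D) l = -D l := fun _ => rfl
  simp [energy, quad, this, linForm_neg]

lemma coefMatrix_diag {p : ℕ} (V : Matrix (Fin p) (Fin p) ℝ) (l : Fin p) :
    coefMatrix V l l = 0 := by simp [coefMatrix]

lemma supp_card_le_dStar {j : ℕ} (hj : j ∈ Finset.Icc 1 (M.m₀ + 1)) :
    (supp (M.A j)).card ≤ M.dStar := by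
  exact Finset.le_sup (f := fun j => (supp (M.A j)).card) hj

lemma partialSum_diag {p : ℕ} {Θ : ℕ → Matrix (Fin p) (Fin p) ℝ} (h : Θ ∈ zeroDiag p) (i : ℕ)
    (l : Fin p) : partialSum Θ i l l = 0 := by
  rw [partialSum, Matrix.sum_apply]
  exact Finset.sum_eq_zero fun q _ => h q l

/-- The block estimates are accurate in every block without change point. -/
lemma Good.lasso {C₁ c₁ c₂ : ℝ} {x : ℕ → EuclideanSpace ℝ (Fin M.p)} (hgood : Good M C₁ x)
    (hC₁ : 0 < C₁) (hc₁ : 0 < c₁) (hc₂ : 2 * (2 * c₁ + 64 * C₁) ≤ c₂) (hb : 0 < b)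
    (hn : 0 < M.n) (hL : 0 < M.logpn) (hbL : 1024 * M.logpn ≤ b)
    (hsmall : 24576 * C₁ ^ 2 * (M.dStar * M.logpn) ≤ b)
    {Θ : ℕ → Matrix (Fin M.p) (Fin M.p) ℝ} (hΘ : Θ ∈ zeroDiag M.p)
    (hmin : IsMinOn (objective M.n b (M.penalty b c₁) (M.penalty b c₂) x) (zeroDiag M.p) Θ)
    {j i : ℕ} (hj : j ∈ Finset.Icc 1 (M.m₀ + 1)) (hi : M.InSegment b j i) :
    l1Norm (partialSum Θ i - M.A j) ≤
        4 * Real.sqrt M.dStar * frobNorm (partialSum Θ i - M.A j) ∧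
      frobNorm (partialSum Θ i - M.A j) ≤
        6 * C₁ * c₂ * Real.sqrt (M.dStar * M.logpn / b) := by
  obtain ⟨hb1, hb2⟩ := Model.blockEnd_sub_bounds hb hi.one_le hi.le
  set I := Finset.Ico (blockEnd M.n b (i - 1)) (blockEnd M.n b i) with hI
  have hcard : I.card = blockEnd M.n b i - blockEnd M.n b (i - 1) := Nat.card_Ico _ _
  have hb' : (0 : ℝ) < b := by exact_mod_cast hb
  have hn' : (0 : ℝ) < M.n := by exact_mod_cast hn
  have hI1 : (b : ℝ) ≤ I.card := by rw [hcard]; exact_mod_cast hb1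
  have hI2 : (I.card : ℝ) ≤ 2 * b := by rw [hcard]; exact_mod_cast hb2
  have hreg : Regular C₁ M.logpn (M.A j) I x := hgood.regular j hj _ _ hi.left hi.right
    (by omega) (by rw [← hcard]; linarith)
  set D := partialSum Θ i - M.A j with hD
  have hDdiag : ∀ l, D l l = 0 := fun l => by
    rw [hD, Matrix.sub_apply, partialSum_diag hΘ, Model.A, coefMatrix_diag, sub_zero]
  refine hreg.lasso_bound hC₁ hL (d := M.dStar) hb' hI1 hI2 hc₁.le hc₂ (supp_card_le_dStar hj)
    hsmall hDdiag ?_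
  have hpen : 0 ≤ M.penalty b c₁ := by unfold Model.penalty; positivity
  -- The competitor puts the true matrix A_j into block i and leaves all other block estimates
  -- alone.
  have hmem : Function.update (Function.update Θ i (Θ i + -D)) (i + 1) (Θ (i + 1) - -D) ∈
      zeroDiag M.p := by
    intro q l
    rcases eq_or_ne q (i + 1) with rfl | h1
    · rw [Function.update_self, Matrix.sub_apply, Matrix.neg_apply, hDdiag, hΘ]; simp
    · rw [Function.update_of_ne h1]
      rcases eq_or_ne q i with rfl | h2
      · rw [Function.update_self, Matrix.add_apply, Matrix.neg_apply, hDdiag, hΘ]; simp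
      · rw [Function.update_of_ne h2]; exact hΘ q l
  have h1 := isMinOn_iff.1 hmin _ hmem
  have h2 := objective_update (lam₂ := M.penalty b c₂) hpen x Θ hi.one_le hi.le (-D)
  have e1 : partialSum Θ i + -D = M.A j := by rw [hD]; abel
  have e2 : partialSum Θ i = M.A j + D := by rw [hD]; abel
  rw [e1, l1Norm_neg, ← hI] at h2
  -- Multiplication by n turns both penalty levels into c √(bL), the scale of the noise on one
  -- block.
  have h3 : (0 : ℝ) ≤ M.n * (1 / (M.n : ℝ) * (∑ t ∈ I, residSq (M.A j) (x t)
      - ∑ t ∈ I, residSq (partialSum Θ i) (x t)) + M.penalty b c₁ * (2 * l1Norm D)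
      + M.penalty b c₂ * (l1Norm (M.A j) - l1Norm (partialSum Θ i))) :=
    mul_nonneg hn'.le (by linarith)
  have h4 := sum_residSq_add (M.A j) D I x
  rw [← e2] at h4 ⊢
  have e3 := mul_penalty (b := b) hn hL.le c₁
  have e4 := mul_penalty (b := b) hn hL.le c₂
  have e5 : (M.n : ℝ) * (1 / (M.n : ℝ) * (∑ t ∈ I, residSq (M.A j) (x t)
      - ∑ t ∈ I, residSq (partialSum Θ i) (x t)) + M.penalty b c₁ * (2 * l1Norm D)
      + M.penalty b c₂ * (l1Norm (M.A j) - l1Norm (partialSum Θ i))) =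
      (∑ t ∈ I, residSq (M.A j) (x t) - ∑ t ∈ I, residSq (partialSum Θ i) (x t))
      + (M.n * M.penalty b c₁) * (2 * l1Norm D)
      + (M.n * M.penalty b c₂) * (l1Norm (M.A j) - l1Norm (partialSum Θ i)) := by
    field_simp
  rw [e5, e3, e4] at h3
  linarith

/-- On regular data every output of the procedure is accurate. -/
theorem Good.output_correct {C₁ C₂ C_A c₁ c₂ κ ρ z : ℝ} {S : ℕ}
    {x : ℕ → EuclideanSpace ℝ (Fin M.p)} (hgood : Good M C₁ x) (hM : M.Bounded C₁ C₂ C_A)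
    (hC₁ : 0 < C₁) (hC_A : 0 < C_A) (hc₁ : 0 < c₁) (hc₂ : 2 * (2 * c₁ + 64 * C₁) ≤ c₂)
    (hκ : 0 < κ) (hρ : 1 ≤ ρ) (hz : 0 < z)
    (hz1 : 2 * (6 * C₁ * c₂) ≤ κ * z) (hz2 : 2 * (6 * C₁ * c₂) < (1 - 2 * κ) * z)
    (hz3 : 8192 * C_A ^ 2 ≤ z ^ 2)
    (hz4 : 3 * C₁ * (6 * C₁ * c₂) ^ 2 / z ^ 2 + 12288 * C₁ * (6 * C₁ * c₂) ^ 2 / z ^ 2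
      + 32 * C₁ * (2 / z + 8 * (6 * C₁ * c₂) / (z * z)) < 1 / (4 * C₁))
    (hb : 0 < b) (hn : 0 < M.n) (hL : 0 < M.logpn) (hd : 0 < M.dStar)
    (hbL : 1024 * M.logpn ≤ b) (hsmall : 24576 * C₁ ^ 2 * (M.dStar * M.logpn) ≤ b)
    (hone : M.dStar * M.logpn ≤ b) (hS : S * b ≤ M.spacing) (hS1 : 4 ≤ S) (hρS : ρ < S - 1)
    (hjump : z * Real.sqrt (M.dStar * M.logpn / b) ≤ M.jump)
    {o : Output M.p} (ho : o ∈ M.outputs b c₁ c₂ κ ρ x) :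
    o.m = M.m₀ ∧ (∀ j ∈ Finset.Icc 1 M.m₀, |(o.τ j : ℝ) - (M.cp j : ℝ)| ≤
      z ^ 2 * M.dStar * M.logpn / M.jump ^ 2) ∧
    ∀ j ∈ Finset.Icc 1 (M.m₀ + 1), frobNorm (o.Ahat (M.n / b) j - M.A j) ≤
      6 * C₁ * c₂ * Real.sqrt (M.dStar * M.logpn / b) := by
  have ho' : IsOutput M.n b (M.penalty b c₁) (M.penalty b c₂) (κ * M.jump) (ρ * b) x o := ho
  set e := Real.sqrt (M.dStar * M.logpn / b) with he
  set B := 6 * C₁ * c₂ with hB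
  have hb' : (0 : ℝ) < b := by exact_mod_cast hb
  have hB0 : 0 < B := by
    have : 0 < c₂ := by linarith
    positivity
  have he0 : 0 ≤ e := Real.sqrt_nonneg _
  have he1 : e ≤ 1 := Real.sqrt_le_one.2 ((div_le_one hb').2 hone)
  have hjp := M.jump_pos
  have hlasso : ∀ j ∈ Finset.Icc 1 (M.m₀ + 1), ∀ i, M.InSegment b j i →
      l1Norm (partialSum o.Θ i - M.A j) ≤
        4 * Real.sqrt M.dStar * frobNorm (partialSum o.Θ i - M.A j) ∧
      frobNorm (partialSum o.Θ i - M.A j) ≤ B * e := fun j hj i hi =>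
    hgood.lasso hC₁ hc₁ hc₂ hb hn hL hbL hsmall ho'.mem_zeroDiag ho'.isMin hj hi
  have hacc : Accurate M b (B * e) o.Θ := fun j hj i hi => (hlasso j hj i hi).2
  have hκ1 : 2 * (B * e) ≤ κ * M.jump := by
    calc 2 * (B * e) = 2 * B * e := by ring
      _ ≤ κ * z * e := by gcongr
      _ = κ * (z * e) := by ring
      _ ≤ _ := by gcongr
  have hκ2 : 2 * (B * e) < (1 - 2 * κ) * M.jump := by
    have h1 : 2 * B * (z * e) ≤ 2 * B * M.jump := by gcongr
    have h2 := mul_lt_mul_of_pos_right hz2 hjp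
    -- Everything is multiplied by z, so that the strict inequality comes from ν > 0 even if e = 0.
    have h3 : z * (2 * (B * e)) < z * ((1 - 2 * κ) * M.jump) := by linarith
    exact lt_of_mul_lt_mul_left h3 hz.le
  have hnear := fun i hi => hacc.candidate_near (i := i) hb hS (by omega) hκ1 hi
  obtain ⟨hm, hJ⟩ := ho'.clustering.eq_of_near ho'.fewest hb hS hS1 (by nlinarith)
    (mul_lt_mul_of_pos_right hρS hb') (fun i hi => by
      obtain ⟨j, hj, h | h⟩ := hnear i hi
      · exact ⟨j, hj, Or.inl h⟩
      · exact ⟨j, hj, Or.inr h.1⟩)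
    (fun j hj => hacc.exists_candidate hb hS (by omega) hκ2 hj)
  have hal : Aligned M b o := by
    refine ⟨hm, fun j hj => (hJ j hj).1, fun j hj i hi => ?_⟩
    obtain ⟨h1, h2, h3⟩ := hJ j hj
    obtain ⟨j', hj', h4⟩ := hnear i (h2 hi)
    obtain ⟨hj1, hj2⟩ := Finset.mem_Icc.1 hj
    obtain ⟨hj1', hj2'⟩ := Finset.mem_Icc.1 hj'
    have h5 := h3 i hi
    rcases lt_trichotomy j j' with h | h | h
    · have := Model.cpBlock_add_le_of_lt (M := M) hb hS h (by omega)
      omega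
    · exact h ▸ h4
    · have := Model.cpBlock_add_le_of_lt (M := M) hb hS h (by omega)
      omega
  have hest : ∀ j ∈ Finset.Icc 1 (M.m₀ + 1),
      l1Norm (o.Ahat (M.n / b) j - M.A j) ≤
        4 * Real.sqrt M.dStar * frobNorm (o.Ahat (M.n / b) j - M.A j) ∧
      frobNorm (o.Ahat (M.n / b) j - M.A j) ≤ B * e := fun j hj =>
    hlasso j hj _ (hal.inSegment hb hS hS1 hj)
  refine ⟨hm, fun j hj => ?_, fun j hj => (hest j hj).2⟩
  obtain ⟨hj1, hj2⟩ := Finset.mem_Icc.1 hj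
  have hja : j ∈ Finset.Icc 1 (M.m₀ + 1) := Finset.mem_Icc.2 ⟨hj1, by omega⟩
  have hjb : j + 1 ∈ Finset.Icc 1 (M.m₀ + 1) := Finset.mem_Icc.2 ⟨by omega, by omega⟩
  obtain ⟨hw1, hw2, hw3, hw4, hw5⟩ := hal.search_window hb hS hS1 hj
  have hτ := ho'.mem_search j (hm ▸ hj)
  have hloss := ho'.search j (hm ▸ hj) _ hw1
  rw [Finset.mem_Ioo] at hw1 hτ
  have hdiag : ∀ i l, M.A i l l = 0 := fun i l => coefMatrix_diag _ l
  have hdiag' : ∀ i l, o.Ahat (M.n / b) i l l = 0 := fun i l =>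
    partialSum_diag ho'.mem_zeroDiag _ l
  have hdiff : M.A j - M.A (j + 1) = -(M.A (j + 1) - M.A j) := by abel
  have hjl := Model.jump_le hj
  -- If the bound fails, the stretch between τ_j and t_j is long enough for `Regular.loss_lt`, and
  -- t_j beats the minimizer τ_j. The two cases exchange the roles of the segments j and j + 1.
  by_contra! hc
  rw [div_lt_iff₀ (by positivity), mul_assoc] at hc
  rcases le_total (o.τ j) (M.cp j) with hle | hle
  · rw [abs_sub_comm, ← Nat.cast_sub hle, abs_of_nonneg (Nat.cast_nonneg _)] at hc
    have hlong := mul_le_of_long hC_A hL hd (supp_card_le_dStar hja) (supp_card_le_dStar hjb)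
      (hM.coef j hja) (hM.coef (j + 1) hjb) hjp hjl hz3 hc
    have hreg := hgood.regular j hja (o.τ j) (M.cp j) (by omega) le_rfl hle hlong
    have hje := hgood.jump j hja (o.τ j) (M.cp j) (by omega) le_rfl hle hlong j hj
    rw [← Nat.card_Ico] at hc hje
    have h1 := hreg.loss_lt hC₁ hL (hdiag _) (hdiag' j) (hdiag' (j + 1))
      (supp_card_le_dStar hja) (supp_card_le_dStar hjb) (hest j hja).2 (hest j hja).1
      (hest (j + 1) hjb).2 (hest (j + 1) hjb).1 hz hz hB0.le he0 he1 hjp hjump hjl hje hc hz4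
    have h2 := sum_search_sub (f := fun t => residSq (o.Ahat (M.n / b) j) (x t))
      (g := fun t => residSq (o.Ahat (M.n / b) (j + 1)) (x t))
      (a := o.minR M.n b j - b) (z := o.maxR M.n b j + b) (by omega) hle (by omega)
    simp only [Output.searchLoss] at hloss
    linarith
  · rw [← Nat.cast_sub hle, abs_of_nonneg (Nat.cast_nonneg _)] at hc
    have hjl' : M.jump ≤ frobNorm (M.A j - M.A (j + 1)) := by rwa [hdiff, frobNorm_neg]
    have hlong := mul_le_of_long hC_A hL hd (supp_card_le_dStar hjb) (supp_card_le_dStar hja)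
      (hM.coef (j + 1) hjb) (hM.coef j hja) hjp hjl' hz3 hc
    have hreg := hgood.regular (j + 1) hjb (M.cp j) (o.τ j) le_rfl (by omega) hle hlong
    have hje := hgood.jump (j + 1) hjb (M.cp j) (o.τ j) le_rfl (by omega) hle hlong j hj
    rw [← Nat.card_Ico] at hc hje
    rw [← frobNorm_neg, ← energy_neg, ← hdiff] at hje
    have h1 := hreg.loss_lt hC₁ hL (hdiag _) (hdiag' (j + 1)) (hdiag' j)
      (supp_card_le_dStar hjb) (supp_card_le_dStar hja) (hest (j + 1) hjb).2 (hest (j + 1) hjb).1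
      (hest j hja).2 (hest j hja).1 hz hz hB0.le he0 he1 hjp hjump hjl' hje hc hz4
    have h2 := sum_search_sub (f := fun t => residSq (o.Ahat (M.n / b) j) (x t))
      (g := fun t => residSq (o.Ahat (M.n / b) (j + 1)) (x t))
      (a := o.minR M.n b j - b) (z := o.maxR M.n b j + b) (by omega) hle (by omega)
    simp only [Output.searchLoss] at hloss
    linarith

end Rates

/-! ### The procedure has an output -/

section Existence

variable {p n b : ℕ}

lemma objective_congr {lam₁ lam₂ : ℝ} {x : ℕ → EuclideanSpace ℝ (Fin p)}
    {Θ Θ' : ℕ → Matrix (Fin p) (Fin p) ℝ} (h : ∀ i ∈ Finset.Icc 1 (n / b), Θ i = Θ' i) :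
    objective n b lam₁ lam₂ x Θ = objective n b lam₁ lam₂ x Θ' := by
  have hps : ∀ i ∈ Finset.Icc 1 (n / b), partialSum Θ i = partialSum Θ' i := fun i hi =>
    Finset.sum_congr rfl fun q hq => h q (Finset.mem_Icc.2 ⟨(Finset.mem_Icc.1 hq).1,
      (Finset.mem_Icc.1 hq).2.trans (Finset.mem_Icc.1 hi).2⟩)
  have h1 : ∑ i ∈ Finset.Icc 1 (n / b), l1Norm (Θ i) = ∑ i ∈ Finset.Icc 1 (n / b), l1Norm (Θ' i) :=
    Finset.sum_congr rfl fun i hi => by rw [h i hi]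
  have h2 : ∑ i ∈ Finset.Icc 1 (n / b), l1Norm (partialSum Θ i) =
      ∑ i ∈ Finset.Icc 1 (n / b), l1Norm (partialSum Θ' i) :=
    Finset.sum_congr rfl fun i hi => by rw [hps i hi]
  have h3 : ∑ i ∈ Finset.Icc 1 (n / b),
        ∑ t ∈ Finset.Ico (blockEnd n b (i - 1)) (blockEnd n b i), residSq (partialSum Θ i) (x t) =
      ∑ i ∈ Finset.Icc 1 (n / b),
        ∑ t ∈ Finset.Ico (blockEnd n b (i - 1)) (blockEnd n b i), residSq (partialSum Θ' i) (x t) :=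
    Finset.sum_congr rfl fun i hi => by rw [hps i hi]
  rw [objective, objective, h1, h2, h3]

lemma continuous_objective (lam₁ lam₂ : ℝ) (x : ℕ → EuclideanSpace ℝ (Fin p)) :
    Continuous (objective n b lam₁ lam₂ x) := by
  have h1 : ∀ i l k, Continuous fun Θ : ℕ → Matrix (Fin p) (Fin p) ℝ => Θ i l k :=
    fun i l k => (continuous_apply i).matrix_elem l k
  have h2 : ∀ i l k, Continuous fun Θ : ℕ → Matrix (Fin p) (Fin p) ℝ => partialSum Θ i l k := by
    intro i l k
    simp only [partialSum, Matrix.sum_apply]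
    exact continuous_finsetSum _ fun q _ => h1 q l k
  unfold objective l1Norm residSq
  fun_prop

/-- Since λ₁ > 0, the objective bounds each entry of Θ_1, …, Θ_k. The other coordinates do not enter
and can be set to zero, so a compact box contains a minimizer. -/
lemma exists_isMinOn_objective {lam₁ lam₂ : ℝ} (h₁ : 0 < lam₁) (h₂ : 0 ≤ lam₂)
    (x : ℕ → EuclideanSpace ℝ (Fin p)) :
    ∃ Θ ∈ zeroDiag p, IsMinOn (objective n b lam₁ lam₂ x) (zeroDiag p) Θ := by
  set F := objective n b lam₁ lam₂ x with hF
  have hdata : ∀ Θ, 0 ≤ 1 / (n : ℝ) * ∑ i ∈ Finset.Icc 1 (n / b),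
      ∑ t ∈ Finset.Ico (blockEnd n b (i - 1)) (blockEnd n b i), residSq (partialSum Θ i) (x t) :=
    fun Θ => mul_nonneg (by positivity) (Finset.sum_nonneg fun _ _ => Finset.sum_nonneg
      fun _ _ => Finset.sum_nonneg fun _ _ => sq_nonneg _)
  have hlow : ∀ Θ, ∀ i ∈ Finset.Icc 1 (n / b), ∀ l k, |Θ i l k| ≤ F Θ / lam₁ := by
    intro Θ i hi l k
    rw [le_div_iff₀ h₁]
    have e1 : |Θ i l k| ≤ l1Norm (Θ i) :=
      (Finset.single_le_sum (f := fun k => |Θ i l k|) (fun _ _ => abs_nonneg _)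
        (Finset.mem_univ k)).trans (Finset.single_le_sum (f := fun l => ∑ k, |Θ i l k|)
          (fun _ _ => Finset.sum_nonneg fun _ _ => abs_nonneg _) (Finset.mem_univ l))
    have e2 : l1Norm (Θ i) ≤ ∑ i ∈ Finset.Icc 1 (n / b), l1Norm (Θ i) :=
      Finset.single_le_sum (f := fun i => l1Norm (Θ i)) (fun _ _ => l1Norm_nonneg _) hi
    have e3 : 0 ≤ lam₂ * ∑ i ∈ Finset.Icc 1 (n / b), l1Norm (partialSum Θ i) :=
      mul_nonneg h₂ (Finset.sum_nonneg fun _ _ => l1Norm_nonneg _)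
    have e4 := mul_le_mul_of_nonneg_left (e1.trans e2) h₁.le
    have e5 := hdata Θ
    rw [hF, objective]
    linarith
  set R := F 0 / lam₁ with hR
  have hF0 : 0 ≤ F 0 := by
    rw [hF, objective]
    exact add_nonneg (add_nonneg (hdata 0) (mul_nonneg h₁.le (Finset.sum_nonneg
      fun _ _ => l1Norm_nonneg _))) (mul_nonneg h₂ (Finset.sum_nonneg fun _ _ => l1Norm_nonneg _))
  have hR0 : 0 ≤ R := by positivity
  set K : Set (ℕ → Matrix (Fin p) (Fin p) ℝ) :=
    {Θ | ∀ i l k, Θ i l k ∈ if l = k then ({0} : Set ℝ) else Set.Icc (-R) R} with hK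
  have hKc : IsCompact K := by
    have : IsCompact (Set.univ.pi fun _ : ℕ => Set.univ.pi fun l : Fin p => Set.univ.pi
        fun k : Fin p => if l = k then ({0} : Set ℝ) else Set.Icc (-R) R) := by
      refine isCompact_univ_pi fun _ => isCompact_univ_pi fun l => isCompact_univ_pi fun k => ?_
      split_ifs
      · exact isCompact_singleton
      · exact isCompact_Icc
    have e : K = (Set.univ.pi fun _ : ℕ => Set.univ.pi fun l : Fin p => Set.univ.pi
        fun k : Fin p => if l = k then ({0} : Set ℝ) else Set.Icc (-R) R) :=
      Set.ext fun Θ => ⟨fun h i _ l _ k _ => h i l k,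
        fun h i l k => h i trivial l trivial k trivial⟩
    rw [e]
    exact this
  have h0K : (0 : ℕ → Matrix (Fin p) (Fin p) ℝ) ∈ K := by
    intro i l k
    split_ifs <;> simp [hR0]
  obtain ⟨Θ, hΘK, hΘ⟩ := hKc.exists_isMinOn ⟨0, h0K⟩
    (continuous_objective (n := n) (b := b) lam₁ lam₂ x).continuousOn
  refine ⟨Θ, fun i l => by simpa using hΘK i l l, isMinOn_iff.2 fun Θ' hΘ' => ?_⟩
  by_cases hle : F Θ' ≤ F 0
  -- A competitor no worse than 0 falls into the box once its irrelevant coordinates are erased.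
  · set T : ℕ → Matrix (Fin p) (Fin p) ℝ := fun i => if i ∈ Finset.Icc 1 (n / b) then Θ' i else 0
      with hT
    have hTK : T ∈ K := by
      intro i l k
      by_cases hi : i ∈ Finset.Icc 1 (n / b)
      · rw [hT]
        simp only [if_pos hi]
        split_ifs with hlk
        · subst hlk; exact hΘ' i l
        · exact abs_le.1 ((hlow Θ' i hi l k).trans (by rw [hR]; gcongr))
      · rw [hT]
        simp only [if_neg hi]
        exact h0K i l k
    have h3 := isMinOn_iff.1 hΘ T hTK
    have h4 : objective n b lam₁ lam₂ x T = objective n b lam₁ lam₂ x Θ' :=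
      objective_congr fun i hi => by rw [hT]; simp only [if_pos hi]
    exact h3.trans h4.le
  · exact (isMinOn_iff.1 hΘ 0 h0K).trans (not_le.1 hle).le

/-- Singletons, enumerated in increasing order, are always admissible. -/
lemma exists_isClustering (r : ℕ → ℕ) {D : ℝ} (hD : 0 ≤ D) (I : Finset ℕ) :
    ∃ m J, IsClustering r D I m J := by
  set f := I.orderEmbOfFin rfl
  refine ⟨I.card, fun j => if h : j - 1 < I.card then {f ⟨j - 1, h⟩} else ∅, ?_, ?_, ?_, ?_⟩
  · intro j hj
    rw [Finset.mem_Icc] at hj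
    rw [dif_pos (by omega)]
    exact Finset.singleton_nonempty _
  · ext i
    simp only [Finset.mem_biUnion, Finset.mem_Icc]
    constructor
    · rintro ⟨j, hj, hi⟩
      rw [dif_pos (by omega), Finset.mem_singleton] at hi
      exact hi ▸ Finset.orderEmbOfFin_mem I rfl _
    · intro hi
      obtain ⟨a, ha⟩ : i ∈ Set.range f := by
        rw [Finset.range_orderEmbOfFin]; exact hi
      refine ⟨a + 1, ⟨by omega, a.2⟩, ?_⟩
      rw [dif_pos (by simp), Finset.mem_singleton, ← ha]
      rfl
  · intro j hj j' hj' hlt i hi i' hi'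
    rw [Finset.mem_Icc] at hj hj'
    rw [dif_pos (by omega), Finset.mem_singleton] at hi hi'
    rw [hi, hi']
    exact f.strictMono (Fin.mk_lt_mk.2 (by omega))
  · intro j hj i hi i' hi'
    rw [Finset.mem_Icc] at hj
    rw [dif_pos (by omega), Finset.mem_singleton] at hi hi'
    rw [hi, hi', sub_self, abs_zero]
    exact hD

/-- The search interval of a cluster is nonempty if blocks have at least two points. -/
lemma Output.search_nonempty {o : Output p} {D w : ℝ} (hb : 2 ≤ b)
    (hJ : IsClustering (blockEnd n b) D (candidates (n / b) w o.Θ) o.m o.J)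
    {j : ℕ} (hj : j ∈ Finset.Icc 1 o.m) :
    (Finset.Ioo (o.lo n b j) (o.hi n b j)).Nonempty := by
  have hj' := Finset.mem_Icc.1 hj
  have hsub : ∀ i ∈ o.J j, 2 ≤ i ∧ i ≤ n / b := by
    intro i hi
    have : i ∈ candidates (n / b) w o.Θ := by
      rw [← hJ.cover]
      exact Finset.mem_biUnion.2 ⟨j, hj, hi⟩
    exact Finset.mem_Icc.1 (Finset.mem_filter.1 this).1
  have hmin : o.minJ (n / b) j ∈ o.J j := by
    rw [Output.minJ, if_neg (by omega)]
    exact Nat.sInf_mem (s := (o.J j : Set ℕ)) (hJ.nonempty j hj)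
  have hmin' : ∀ i ∈ o.J j, o.minJ (n / b) j ≤ i := by
    intro i hi
    rw [Output.minJ, if_neg (by omega)]
    exact Nat.sInf_le hi
  have hmax : o.maxJ j ∈ o.J j := by
    rw [Output.maxJ, if_neg (by omega)]
    obtain ⟨i, hi, he⟩ := Finset.exists_mem_eq_sup (o.J j) (hJ.nonempty j hj) id
    rw [he]
    exact hi
  have hmax' : ∀ i ∈ o.J j, i ≤ o.maxJ j := by
    intro i hi
    rw [Output.maxJ, if_neg (by omega)]
    exact Finset.le_sup (f := id) hi
  have h1 := hsub _ hmin
  have h2 := hsub _ hmax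
  have hR1 : o.minR n b j = 1 + (o.minJ (n / b) j - 1) * b := Model.blockEnd_of_lt (by omega)
  have hR2 : o.maxR n b j = 1 + (o.maxJ j - 1) * b := Model.blockEnd_of_lt (by omega)
  have hle := hmin' _ hmax
  rw [Output.lo, Output.hi]
  split_ifs with hcard
  · have h3 : (o.minJ (n / b) j - 1) * b ≤ (o.maxJ j - 1) * b :=
      Nat.mul_le_mul_right _ (by omega)
    exact ⟨o.minR n b j, Finset.mem_Ioo.2 ⟨by omega, by omega⟩⟩
  · have hlt : o.minJ (n / b) j < o.maxJ j := by
      by_contra! hle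
      apply hcard
      rw [Finset.card_eq_one]
      refine ⟨o.minJ (n / b) j, Finset.eq_singleton_iff_unique_mem.2 ⟨hmin, fun i hi => ?_⟩⟩
      have h1 := hmax' _ hi
      have h2 := hmin' _ hi
      omega
    -- Distinct block starts are at least b ≥ 2 apart, so an integer lies strictly between them.
    have h3 : (o.minJ (n / b) j - 1 + 1) * b ≤ (o.maxJ j - 1) * b :=
      Nat.mul_le_mul_right _ (by omega)
    rw [add_mul] at h3
    exact ⟨o.minR n b j + 1, Finset.mem_Ioo.2 ⟨by omega, by omega⟩⟩

lemma exists_isOutput {lam₁ lam₂ w D : ℝ} (hb : 2 ≤ b) (h₁ : 0 < lam₁) (h₂ : 0 ≤ lam₂)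
    (hD : 0 ≤ D) (x : ℕ → EuclideanSpace ℝ (Fin p)) :
    ∃ o : Output p, IsOutput n b lam₁ lam₂ w D x o := by
  obtain ⟨Θ, hΘ, hmin⟩ := exists_isMinOn_objective (n := n) (b := b) h₁ h₂ x
  classical
  have hex : ∃ m, ∃ J, IsClustering (blockEnd n b) D (candidates (n / b) w Θ) m J :=
    exists_isClustering _ hD _
  obtain ⟨J, hJ⟩ := Nat.find_spec hex
  set o₀ : Output p := ⟨Θ, Nat.find hex, J, fun _ => 0⟩ with ho₀
  have hτ : ∀ j, ∃ s, j ∈ Finset.Icc 1 o₀.m → s ∈ Finset.Ioo (o₀.lo n b j) (o₀.hi n b j) ∧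
      ∀ s' ∈ Finset.Ioo (o₀.lo n b j) (o₀.hi n b j),
        o₀.searchLoss n b x j s ≤ o₀.searchLoss n b x j s' := by
    intro j
    by_cases hj : j ∈ Finset.Icc 1 o₀.m
    · obtain ⟨s, hs, hs'⟩ := Finset.exists_min_image _ (o₀.searchLoss n b x j)
        (Output.search_nonempty (o := o₀) hb hJ hj)
      exact ⟨s, fun _ => ⟨hs, hs'⟩⟩
    · exact ⟨0, fun h => absurd h hj⟩
  choose τ hτ using hτ
  exact ⟨⟨Θ, Nat.find hex, J, τ⟩, hΘ, hmin, hJ, fun m' J' h => Nat.find_min' hex ⟨J', h⟩,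
    fun j hj => (hτ j hj).1, fun j hj => (hτ j hj).2⟩

end Existence

/-! ### Gaussian quadratic forms -/

/-- Equivalent to exp(-(y + y²)) ≤ 1 - y near 0; with y = 2θ it bounds the moment generating
function of a centered χ² variable. -/
lemma exp_neg_add_sq_le {y : ℝ} (h1 : -(1 / 2) ≤ y) (h2 : y ≤ 1 / 2) :
    1 ≤ (1 - y) * Real.exp (y + y ^ 2) := by
  rcases le_total y 0 with h0 | h0
  · have := Real.add_one_le_exp (y + y ^ 2)
    have h3 : (1 - y) * (y + y ^ 2 + 1) ≤ (1 - y) * Real.exp (y + y ^ 2) := by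
      apply mul_le_mul_of_nonneg_left this; linarith
    nlinarith [mul_nonneg_of_nonpos_of_nonpos h0 (by nlinarith : -(y ^ 2) ≤ 0)]
  · have := Real.quadratic_le_exp_of_nonneg (by positivity : 0 ≤ y + y ^ 2)
    have h3 : (1 - y) * (1 + (y + y ^ 2) + (y + y ^ 2) ^ 2 / 2) ≤ (1 - y) * Real.exp (y + y ^ 2) := by
      apply mul_le_mul_of_nonneg_left this; linarith
    refine le_trans ?_ h3
    have h4 : 0 ≤ 1 - y - y ^ 2 - y ^ 3 := by
      have : y ^ 2 ≤ 1 / 4 := by nlinarith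
      have : y ^ 3 ≤ 1 / 8 := by nlinarith
      linarith
    have h5 := mul_nonneg (sq_nonneg y) h4
    nlinarith

lemma inv_sqrt_mul_exp_le {θ : ℝ} (h : |θ| ≤ 1 / 4) :
    (Real.sqrt (1 - 2 * θ))⁻¹ * Real.exp (-θ) ≤ Real.exp (2 * θ ^ 2) := by
  obtain ⟨h1, h2⟩ := abs_le.1 h
  have h3 := exp_neg_add_sq_le (y := 2 * θ) (by linarith) (by linarith)
  have hpos : 0 < Real.sqrt (1 - 2 * θ) := Real.sqrt_pos.2 (by linarith)
  rw [inv_mul_le_iff₀ hpos]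
  apply le_of_sq_le_sq _ (by positivity)
  rw [mul_pow, Real.sq_sqrt (by linarith), ← Real.exp_nat_mul, ← Real.exp_nat_mul]
  have e : Real.exp ((2 : ℕ) * -θ) * Real.exp (2 * θ + (2 * θ) ^ 2) =
      Real.exp ((2 : ℕ) * (2 * θ ^ 2)) := by
    rw [← Real.exp_add]; congr 1; push_cast; ring
  rw [← e]
  have := Real.exp_pos ((2 : ℕ) * -θ)
  nlinarith

lemma integral_exp_sq_gaussianReal {v : NNReal} (hv : v ≠ 0) (θ : ℝ) :
    ∫ z, Real.exp (θ * (z ^ 2 / v - 1)) ∂(gaussianReal 0 v) =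
      (Real.sqrt (1 - 2 * θ))⁻¹ * Real.exp (-θ) := by
  have hv' : (0 : ℝ) < v := by positivity
  rw [integral_gaussianReal_eq_integral_smul hv]
  have e : ∀ z : ℝ, gaussianPDFReal 0 v z • Real.exp (θ * (z ^ 2 / v - 1)) =
      ((Real.sqrt (2 * Real.pi * v))⁻¹ * Real.exp (-θ)) *
        Real.exp (-((1 - 2 * θ) / (2 * v)) * z ^ 2) := by
    intro z
    rw [gaussianPDFReal, smul_eq_mul]
    generalize (Real.sqrt (2 * Real.pi * v))⁻¹ = s
    rw [mul_assoc, mul_assoc, ← Real.exp_add, ← Real.exp_add]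
    congr 2
    field_simp
    ring
  simp_rw [e]
  rw [integral_const_mul, integral_gaussian]
  have h1 : Real.pi / ((1 - 2 * θ) / (2 * v)) = (2 * Real.pi * v) * (1 - 2 * θ)⁻¹ := by
    field_simp
  rw [h1, Real.sqrt_mul (x := 2 * Real.pi * v) (by positivity), Real.sqrt_inv]
  have : Real.sqrt (2 * Real.pi * v) ≠ 0 := (Real.sqrt_pos.2 (by positivity)).ne'
  field_simp

/-- The integral has a nonzero closed form, whereas a function that is not integrable has integral 0
by convention. -/
lemma integrable_exp_sq_gaussianReal {v : NNReal} (hv : v ≠ 0) {θ : ℝ} (hθ : θ < 1 / 2) :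
    Integrable (fun z => Real.exp (θ * (z ^ 2 / v - 1))) (gaussianReal 0 v) := by
  by_contra hc
  have h1 := integral_undef hc
  rw [integral_exp_sq_gaussianReal hv] at h1
  have : 0 < Real.sqrt (1 - 2 * θ) := Real.sqrt_pos.2 (by linarith)
  exact absurd h1 (by positivity)

/-- The variance of `v · x` for `x ∼ N(0, S)`. -/
def varForm {p : ℕ} (S : Matrix (Fin p) (Fin p) ℝ) (v : Fin p → ℝ) : ℝ := v ⬝ᵥ S.mulVec v

lemma measurable_linForm {p : ℕ} (v : Fin p → ℝ) : Measurable (linForm v) := by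
  unfold linForm
  fun_prop

lemma map_linForm_multivariateGaussian {p : ℕ} {S : Matrix (Fin p) (Fin p) ℝ}
    (hS : S.PosSemidef) (v : Fin p → ℝ) :
    (multivariateGaussian 0 S).map (linForm v) = gaussianReal 0 (varForm S v).toNNReal := by
  have e : linForm v = innerSL ℝ (WithLp.toLp 2 v) := by
    funext x
    simp [linForm, PiLp.inner_apply, mul_comm]
  rw [e, IsGaussian.map_eq_gaussianReal]
  congr 1
  · rw [(innerSL ℝ (WithLp.toLp 2 v)).integral_comp_id_comm IsGaussian.integrable_id]
    simp
  · congr 1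
    have h1 := covarianceBilin_multivariateGaussian (μ := 0) hS (WithLp.toLp 2 v) (WithLp.toLp 2 v)
    rw [covarianceBilin_apply_eq_cov IsGaussian.memLp_two_id, covariance_self (by fun_prop)] at h1
    exact h1

/-- The sum of the variances of the entries of `D x` for `x ∼ N(0, S)`. -/
def traceForm {p q : ℕ} (S : Matrix (Fin p) (Fin p) ℝ) (D : Matrix (Fin q) (Fin p) ℝ) : ℝ :=
  ∑ l, varForm S (D l)

lemma varForm_pos {p : ℕ} {S : Matrix (Fin p) (Fin p) ℝ} (hS : S.PosDef) {v : Fin p → ℝ}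
    (hv : v ≠ 0) : 0 < varForm S v := by
  have := hS.dotProduct_mulVec_pos hv
  simpa [varForm] using this

lemma varForm_nonneg {p : ℕ} {S : Matrix (Fin p) (Fin p) ℝ} (hS : S.PosDef) (v : Fin p → ℝ) :
    0 ≤ varForm S v := by
  by_cases hv : v = 0
  · simp [hv, varForm]
  · exact (varForm_pos hS hv).le

/-- The centered and normalized quadratic form `‖D x‖² / T - 1`. -/
def normalizedForm {p q : ℕ} (S : Matrix (Fin p) (Fin p) ℝ) (D : Matrix (Fin q) (Fin p) ℝ)
    (x : EuclideanSpace ℝ (Fin p)) : ℝ := (∑ l, linForm (D l) x ^ 2) / traceForm S D - 1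

lemma measurable_normalizedForm {p q : ℕ} (S : Matrix (Fin p) (Fin p) ℝ)
    (D : Matrix (Fin q) (Fin p) ℝ) : Measurable (normalizedForm S D) := by
  unfold normalizedForm
  refine Measurable.sub_const (Measurable.div_const (Finset.measurable_sum _ fun l _ => ?_) _) _
  exact (measurable_linForm _).pow_const 2

/-- The normalized form is a convex combination of centered χ² variables, one per row of D. Jensen's
inequality transfers their exponential moment bound with the same constants, although the rows are
dependent. -/
lemma exp_normalizedForm_le {p q : ℕ} {S : Matrix (Fin p) (Fin p) ℝ} (hS : S.PosDef)
    {D : Matrix (Fin q) (Fin p) ℝ} (hT : 0 < traceForm S D) (θ : ℝ)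
    (x : EuclideanSpace ℝ (Fin p)) :
    Real.exp (θ * normalizedForm S D x) ≤ ∑ l, varForm S (D l) / traceForm S D *
      Real.exp (θ * (linForm (D l) x ^ 2 / varForm S (D l) - 1)) := by
  have h1 : ∑ l, varForm S (D l) / traceForm S D = 1 := by
    rw [← Finset.sum_div]; exact div_self hT.ne'
  have h2 := convexOn_exp.map_sum_le (t := Finset.univ)
    (w := fun l => varForm S (D l) / traceForm S D)
    (p := fun l => θ * (linForm (D l) x ^ 2 / varForm S (D l) - 1))
    (fun l _ => div_nonneg (varForm_nonneg hS _) hT.le) h1 (fun _ _ => Set.mem_univ _)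
  simp only [smul_eq_mul] at h2
  refine le_trans (le_of_eq ?_) h2
  congr 1
  have h3 : ∀ l, varForm S (D l) / traceForm S D *
      (θ * (linForm (D l) x ^ 2 / varForm S (D l) - 1)) =
      θ * (linForm (D l) x ^ 2 / traceForm S D) - θ * (varForm S (D l) / traceForm S D) := by
    intro l
    -- A zero row has weight 0, so the division by its zero variance is harmless.
    by_cases hl : D l = 0
    · have e1 : linForm (D l) x = 0 := by rw [hl]; simp [linForm]
      have e2 : varForm S (D l) = 0 := by rw [hl]; simp [varForm]
      rw [e1, e2]; simp
    · have := (varForm_pos hS hl).ne'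
      field_simp
  rw [Finset.sum_congr rfl fun l _ => h3 l, Finset.sum_sub_distrib, ← Finset.mul_sum,
    ← Finset.mul_sum, h1, ← Finset.sum_div, normalizedForm]
  ring

lemma integral_exp_linForm_sq {p : ℕ} {S : Matrix (Fin p) (Fin p) ℝ} (hS : S.PosDef)
    {v : Fin p → ℝ} (hv : v ≠ 0) {θ : ℝ} (hθ : |θ| ≤ 1 / 4) :
    Integrable (fun x => Real.exp (θ * (linForm v x ^ 2 / varForm S v - 1)))
        (multivariateGaussian 0 S) ∧
      ∫ x, Real.exp (θ * (linForm v x ^ 2 / varForm S v - 1)) ∂(multivariateGaussian 0 S) ≤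
        Real.exp (2 * θ ^ 2) := by
  have hpos := varForm_pos hS hv
  have hmap := map_linForm_multivariateGaussian hS.posSemidef v
  have hθ' : θ < 1 / 2 := by linarith [(abs_le.1 hθ).2]
  have hnn : (varForm S v).toNNReal ≠ 0 := (Real.toNNReal_pos.2 hpos).ne'
  have hco : ((varForm S v).toNNReal : ℝ) = varForm S v := Real.coe_toNNReal _ hpos.le
  have h1 := integrable_exp_sq_gaussianReal hnn hθ'
  have h2 := integral_exp_sq_gaussianReal hnn θ
  rw [← hmap, hco] at h1 h2
  have hm : Measurable fun z : ℝ => Real.exp (θ * (z ^ 2 / varForm S v - 1)) := by fun_prop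
  rw [integral_map (measurable_linForm v).aemeasurable hm.aestronglyMeasurable] at h2
  refine ⟨(integrable_map_measure hm.aestronglyMeasurable
    (measurable_linForm v).aemeasurable).1 h1, ?_⟩
  rw [h2]
  exact inv_sqrt_mul_exp_le hθ

lemma integral_exp_normalizedForm {p q : ℕ} {S : Matrix (Fin p) (Fin p) ℝ} (hS : S.PosDef)
    {D : Matrix (Fin q) (Fin p) ℝ} (hT : 0 < traceForm S D) {θ : ℝ} (hθ : |θ| ≤ 1 / 4) :
    Integrable (fun x => Real.exp (θ * normalizedForm S D x)) (multivariateGaussian 0 S) ∧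
      ∫ x, Real.exp (θ * normalizedForm S D x) ∂(multivariateGaussian 0 S) ≤
        Real.exp (2 * θ ^ 2) := by
  have hterm : ∀ l, Integrable (fun x => varForm S (D l) / traceForm S D *
      Real.exp (θ * (linForm (D l) x ^ 2 / varForm S (D l) - 1))) (multivariateGaussian 0 S) ∧
      ∫ x, varForm S (D l) / traceForm S D *
        Real.exp (θ * (linForm (D l) x ^ 2 / varForm S (D l) - 1)) ∂(multivariateGaussian 0 S) ≤
      varForm S (D l) / traceForm S D * Real.exp (2 * θ ^ 2) := by
    intro l
    by_cases hl : D l = 0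
    · have e2 : varForm S (D l) = 0 := by rw [hl]; simp [varForm]
      simp [e2]
    · obtain ⟨h1, h2⟩ := integral_exp_linForm_sq hS hl hθ
      refine ⟨h1.const_mul _, ?_⟩
      rw [integral_const_mul]
      exact mul_le_mul_of_nonneg_left h2 (div_nonneg (varForm_nonneg hS _) hT.le)
  have hsum := integrable_finsetSum Finset.univ fun l _ => (hterm l).1
  have hle := exp_normalizedForm_le hS hT θ
  have hint : Integrable (fun x => Real.exp (θ * normalizedForm S D x))
      (multivariateGaussian 0 S) := by
    refine hsum.mono' ?_ (ae_of_all _ fun x => ?_)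
    · exact (((measurable_normalizedForm S D).const_mul θ).exp).aestronglyMeasurable
    · rw [Real.norm_eq_abs, abs_of_pos (Real.exp_pos _)]
      exact hle x
  refine ⟨hint, (integral_mono hint hsum hle).trans ?_⟩
  rw [integral_finsetSum _ fun l _ => (hterm l).1]
  refine (Finset.sum_le_sum fun l _ => (hterm l).2).trans (le_of_eq ?_)
  rw [← Finset.sum_mul, ← Finset.sum_div]
  change traceForm S D / traceForm S D * _ = _
  rw [div_self hT.ne', one_mul]

/-- Concentration of the energy of independent Gaussian vectors. -/
lemma measure_energy_ge_le {p q : ℕ} {Ω ι : Type*} [MeasurableSpace Ω] {μ : Measure Ω}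
    [IsProbabilityMeasure μ] [Fintype ι] {X : ι → Ω → EuclideanSpace ℝ (Fin p)}
    (hind : iIndepFun X μ) {S : Matrix (Fin p) (Fin p) ℝ} (hS : S.PosDef)
    (hlaw : ∀ i, HasLaw (X i) (multivariateGaussian 0 S) μ)
    {D : Matrix (Fin q) (Fin p) ℝ} (hT : 0 < traceForm S D) {u : ℝ} (hu0 : 0 ≤ u) (hu1 : u ≤ 1) :
    μ.real {ω | Fintype.card ι * u * traceForm S D ≤
        |∑ i, ∑ l, linForm (D l) (X i ω) ^ 2 - Fintype.card ι * traceForm S D|} ≤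
      2 * Real.exp (-(Fintype.card ι * u ^ 2 / 8)) := by
  set N : ℝ := (Fintype.card ι : ℝ) with hN
  have hN0 : 0 ≤ N := Nat.cast_nonneg _
  set Y : ι → Ω → ℝ := fun i ω => normalizedForm S D (X i ω) with hY
  have hYind : iIndepFun Y μ :=
    hind.comp (fun _ => normalizedForm S D) fun _ => measurable_normalizedForm S D
  have hYm : ∀ i, AEMeasurable (Y i) μ := fun i =>
    (measurable_normalizedForm S D).comp_aemeasurable (hlaw i).aemeasurable
  have hm : ∀ θ : ℝ, Measurable fun x => Real.exp (θ * normalizedForm S D x) := fun θ =>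
    ((measurable_normalizedForm S D).const_mul θ).exp
  have hYint : ∀ θ : ℝ, |θ| ≤ 1 / 4 → ∀ i, Integrable (fun ω => Real.exp (θ * Y i ω)) μ := by
    intro θ hθ i
    have := (integral_exp_normalizedForm hS hT hθ).1
    rw [← (hlaw i).map_eq] at this
    exact (integrable_map_measure (hm θ).aestronglyMeasurable (hlaw i).aemeasurable).1 this
  have hYmgf : ∀ θ : ℝ, |θ| ≤ 1 / 4 → ∀ i, mgf (Y i) μ θ ≤ Real.exp (2 * θ ^ 2) := by
    intro θ hθ i
    have := (integral_exp_normalizedForm hS hT hθ).2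
    rwa [← (hlaw i).map_eq, integral_map (hlaw i).aemeasurable (hm θ).aestronglyMeasurable] at this
  have hmgf : ∀ θ : ℝ, |θ| ≤ 1 / 4 → mgf (∑ i, Y i) μ θ ≤ Real.exp (N * (2 * θ ^ 2)) := by
    intro θ hθ
    rw [hYind.mgf_sum₀ hYm]
    refine (Finset.prod_le_prod (fun _ _ => mgf_nonneg) fun i _ => hYmgf θ hθ i).trans
      (le_of_eq ?_)
    rw [Finset.prod_const, ← Real.exp_nat_mul, Finset.card_univ]
  have hint : ∀ θ : ℝ, |θ| ≤ 1 / 4 → Integrable (fun ω => Real.exp (θ * (∑ i, Y i) ω)) μ :=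
    fun θ hθ => by
      rw [← mgf_pos_iff, hYind.mgf_sum₀ hYm]
      exact Finset.prod_pos fun i _ => mgf_pos (hYint θ hθ i)
  -- The choice θ = ±u/4 minimizes -θu + 2θ² for the respective tail and gives the exponent -N u²/8;
  -- u ≤ 1 keeps |θ| ≤ 1/4.
  have hθ1 : |u / 4| ≤ 1 / 4 := by rw [abs_of_nonneg (by positivity)]; linarith
  have hθ2 : |-(u / 4)| ≤ 1 / 4 := by rw [abs_neg]; exact hθ1
  have hup := measure_ge_le_exp_mul_mgf (N * u) (by positivity) (hint _ hθ1)
  have hlo := measure_le_le_exp_mul_mgf (-(N * u)) (by linarith) (hint _ hθ2)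
  have hup' : μ.real {ω | N * u ≤ (∑ i, Y i) ω} ≤ Real.exp (-(N * u ^ 2 / 8)) := by
    refine hup.trans ((mul_le_mul_of_nonneg_left (hmgf _ hθ1) (Real.exp_pos _).le).trans
      (le_of_eq ?_))
    rw [← Real.exp_add]; congr 1; ring
  have hlo' : μ.real {ω | (∑ i, Y i) ω ≤ -(N * u)} ≤ Real.exp (-(N * u ^ 2 / 8)) := by
    refine hlo.trans ((mul_le_mul_of_nonneg_left (hmgf _ hθ2) (Real.exp_pos _).le).trans
      (le_of_eq ?_))
    rw [← Real.exp_add]; congr 1; ring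
  have hsub : {ω | N * u * traceForm S D ≤
        |∑ i, ∑ l, linForm (D l) (X i ω) ^ 2 - N * traceForm S D|} ⊆
      {ω | N * u ≤ (∑ i, Y i) ω} ∪ {ω | (∑ i, Y i) ω ≤ -(N * u)} := by
    intro ω hω
    have e : ∑ i, ∑ l, linForm (D l) (X i ω) ^ 2 - N * traceForm S D =
        (∑ i, Y i) ω * traceForm S D := by
      rw [Finset.sum_apply]
      simp only [hY, normalizedForm, Finset.sum_sub_distrib, ← Finset.sum_div]
      rw [Finset.sum_const, Finset.card_univ, nsmul_eq_mul, mul_one, ← hN]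
      field_simp
    rw [Set.mem_ofPred_eq, e, abs_mul, abs_of_pos hT] at hω
    have h1 := le_of_mul_le_mul_right hω hT
    rcases le_abs.1 h1 with h | h
    · exact Or.inl h
    · exact Or.inr (by rw [Set.mem_ofPred_eq]; linarith)
  calc _ ≤ μ.real ({ω | N * u ≤ (∑ i, Y i) ω} ∪ {ω | (∑ i, Y i) ω ≤ -(N * u)}) :=
        measureReal_mono hsub
    _ ≤ _ := measureReal_union_le _ _
    _ ≤ _ := by linarith

/-! ### Variances of linear forms and regression residuals -/

section Covariance

variable {p : ℕ} {S : Matrix (Fin p) (Fin p) ℝ}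

open scoped MatrixOrder in
lemma varForm_bounds (hS : S.PosDef) {C₁ : ℝ}
    (h : ∀ z ∈ spectrum ℝ S, 1 / C₁ ≤ z ∧ z ≤ C₁) (v : Fin p → ℝ) :
    1 / C₁ * ∑ k, v k ^ 2 ≤ varForm S v ∧ varForm S v ≤ C₁ * ∑ k, v k ^ 2 := by
  have hv : v ⬝ᵥ v = ∑ k, v k ^ 2 := by simp [dotProduct, sq]
  have hsa : IsSelfAdjoint S := hS.isHermitian
  constructor
  · have h1 := (algebraMap_le_iff_le_spectrum (a := S) (r := 1 / C₁)).2 fun z hz => (h z hz).1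
    have h2 := (Matrix.le_iff.1 h1).dotProduct_mulVec_nonneg v
    rw [Matrix.sub_mulVec, dotProduct_sub, Algebra.algebraMap_eq_smul_one, Matrix.smul_mulVec,
      Matrix.one_mulVec, dotProduct_smul, star_trivial, hv, smul_eq_mul] at h2
    rw [varForm]
    linarith
  · have h1 := (le_algebraMap_iff_spectrum_le (a := S) (r := C₁)).2 fun z hz => (h z hz).2
    have h2 := (Matrix.le_iff.1 h1).dotProduct_mulVec_nonneg v
    rw [Matrix.sub_mulVec, dotProduct_sub, Algebra.algebraMap_eq_smul_one, Matrix.smul_mulVec,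
      Matrix.one_mulVec, dotProduct_smul, star_trivial, hv, smul_eq_mul] at h2
    rw [varForm]
    linarith

lemma varForm_add (hS : S.PosDef) (v w : Fin p → ℝ) :
    varForm S (v + w) = varForm S v + varForm S w + 2 * (v ⬝ᵥ S.mulVec w) := by
  have hsymm : w ⬝ᵥ S.mulVec v = v ⬝ᵥ S.mulVec w := by
    have ht : S.transpose = S := by simpa using hS.isHermitian.eq
    rw [Matrix.dotProduct_mulVec, ← Matrix.mulVec_transpose, ht, dotProduct_comm]
  simp only [varForm, Matrix.mulVec_add, dotProduct_add, add_dotProduct, hsymm]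
  ring

/-- The coefficients `v` of the regression residual: `x_l - ∑ A(l,k) x_k = v · x`. -/
def residVec (S : Matrix (Fin p) (Fin p) ℝ) (l : Fin p) : Fin p → ℝ :=
  Pi.single l 1 - coefMatrix S l

lemma linForm_residVec (l : Fin p) (x : EuclideanSpace ℝ (Fin p)) :
    linForm (residVec S l) x = x l - linForm (coefMatrix S l) x := by
  rw [residVec, linForm_sub, linForm_single]

lemma residVec_eq (hS : S.PosDef) (l : Fin p) : residVec S l = (S⁻¹ l l)⁻¹ • S⁻¹ l := by
  have hpos : 0 < S⁻¹ l l := hS.inv.diag_pos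
  funext k
  have e : residVec S l k = (Pi.single l 1 : Fin p → ℝ) k - coefMatrix S l k := rfl
  rw [e, Pi.smul_apply, smul_eq_mul, coefMatrix, Matrix.of_apply]
  split_ifs with h
  · subst h
    rw [Pi.single_eq_same, sub_zero, inv_mul_cancel₀ hpos.ne']
  · rw [Pi.single_eq_of_ne (Ne.symm h)]
    ring

lemma residVec_self (l : Fin p) : residVec S l l = 1 := by
  simp [residVec, coefMatrix]

/-- The residual direction is a multiple of a row of Ω = S⁻¹, so S cancels. For w l = 0 this says
that the residual of x_l is uncorrelated with w · x. -/
lemma residVec_dotProduct (hS : S.PosDef) (l : Fin p) (w : Fin p → ℝ) :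
    residVec S l ⬝ᵥ S.mulVec w = (S⁻¹ l l)⁻¹ * w l := by
  have hdet : IsUnit S.det := hS.det_pos.ne'.isUnit
  rw [residVec_eq hS, smul_dotProduct, smul_eq_mul]
  congr 1
  have h1 : S⁻¹.mulVec (S.mulVec w) = w := by
    rw [Matrix.mulVec_mulVec, Matrix.nonsing_inv_mul _ hdet, Matrix.one_mulVec]
  exact congrFun h1 l

/-- Pythagoras: x_l splits into its residual and an uncorrelated fitted value. -/
lemma varForm_residVec_le (hS : S.PosDef) (l : Fin p) :
    varForm S (residVec S l) ≤ varForm S (Pi.single l 1) := by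
  have e : (Pi.single l 1 : Fin p → ℝ) = residVec S l + coefMatrix S l := by
    rw [residVec, sub_add_cancel]
  rw [e, varForm_add hS, residVec_dotProduct hS, coefMatrix_diag, mul_zero, mul_zero, add_zero]
  have := varForm_nonneg hS (coefMatrix S l)
  linarith

/-- The value depends on c only through c², so c = 1 and c = -1 give equal means and polarization
leaves a centered difference. -/
lemma varForm_residVec_add (hS : S.PosDef) {l k : Fin p} (hlk : l ≠ k) {c : ℝ} :
    varForm S (residVec S l + c • Pi.single k 1) =
      varForm S (residVec S l) + c ^ 2 * varForm S (Pi.single k 1) := by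
  rw [varForm_add hS, residVec_dotProduct hS, Pi.smul_apply, Pi.single_eq_of_ne hlk, smul_zero,
    mul_zero, mul_zero, add_zero]
  congr 1
  simp only [varForm, Matrix.mulVec_smul, dotProduct_smul, smul_dotProduct, smul_eq_mul]
  ring

end Covariance

/-! ### Concentration for stretches of a sample -/

section Sample

variable {M : Model} {Ω : Type*} [MeasurableSpace Ω] {μ : Measure Ω} [IsProbabilityMeasure μ]
  {X : ℕ → Ω → EuclideanSpace ℝ (Fin M.p)}

lemma Model.IsSample.energy_concentration (hX : M.IsSample μ X) {j s t q : ℕ}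
    (hj : j ∈ Finset.Icc 1 (M.m₀ + 1)) (hs : M.cp (j - 1) ≤ s) (ht : t ≤ M.cp j)
    {D : Matrix (Fin q) (Fin M.p) ℝ} (hT : 0 < traceForm (M.Sigma j) D) {u : ℝ}
    (hu0 : 0 ≤ u) (hu1 : u ≤ 1) :
    μ.real {ω | ((t - s : ℕ) : ℝ) * u * traceForm (M.Sigma j) D ≤
        |energy (Finset.Ico s t) (fun i => X i ω) D - ((t - s : ℕ) : ℝ) * traceForm (M.Sigma j) D|} ≤
      2 * Real.exp (-(((t - s : ℕ) : ℝ) * u ^ 2 / 8)) := by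
  obtain ⟨hj1, hj2⟩ := Finset.mem_Icc.1 hj
  have h1 := Model.one_le_cp (M := M) (j := j - 1) (by omega)
  have h2 := Model.cp_le (M := M) hj2
  have hind : iIndepFun (fun i : Finset.Ico s t => X i) μ := by
    have hmem : ∀ i : Finset.Ico s t, (i : ℕ) ∈ Finset.Icc 1 M.n := fun i => by
      have := Finset.mem_Ico.1 i.2
      exact Finset.mem_Icc.2 ⟨by omega, by omega⟩
    exact hX.indep.precomp (g := fun i : Finset.Ico s t => (⟨i, hmem i⟩ : Finset.Icc 1 M.n))
      fun a b h => Subtype.ext (by simpa using h)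
  have hlaw : ∀ i : Finset.Ico s t, HasLaw (X i) (multivariateGaussian 0 (M.Sigma j)) μ :=
    fun i => hX.law j hj i (by
      have := Finset.mem_Ico.1 i.2
      exact Finset.mem_Ico.2 ⟨by omega, by omega⟩)
  have h3 := measure_energy_ge_le hind (M.posDef j hj) hlaw hT hu0 hu1
  rw [Fintype.card_coe, Nat.card_Ico] at h3
  have e : ∀ ω, energy (Finset.Ico s t) (fun i => X i ω) D =
      ∑ i : Finset.Ico s t, ∑ l, linForm (D l) (X i ω) ^ 2 := by
    intro ω
    rw [energy]
    simp only [quad]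
    rw [Finset.sum_comm, ← Finset.sum_coe_sort]
  simp only [e]
  exact h3

lemma Model.IsSample.quad_concentration (hX : M.IsSample μ X) {j s t : ℕ}
    (hj : j ∈ Finset.Icc 1 (M.m₀ + 1)) (hs : M.cp (j - 1) ≤ s) (ht : t ≤ M.cp j)
    {v : Fin M.p → ℝ} (hv : v ≠ 0) {u : ℝ} (hu0 : 0 ≤ u) (hu1 : u ≤ 1) :
    μ.real {ω | ((t - s : ℕ) : ℝ) * u * varForm (M.Sigma j) v ≤
        |quad (Finset.Ico s t) (fun i => X i ω) v - ((t - s : ℕ) : ℝ) * varForm (M.Sigma j) v|} ≤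
      2 * Real.exp (-(((t - s : ℕ) : ℝ) * u ^ 2 / 8)) := by
  set D : Matrix (Fin 1) (Fin M.p) ℝ := Matrix.of fun _ => v with hD
  have e1 : traceForm (M.Sigma j) D = varForm (M.Sigma j) v := by
    rw [traceForm, Fin.sum_univ_one]; rfl
  have e2 : ∀ ω, energy (Finset.Ico s t) (fun i => X i ω) D =
      quad (Finset.Ico s t) (fun i => X i ω) v := fun ω => by
    rw [energy, Fin.sum_univ_one]; rfl
  have h := hX.energy_concentration hj hs ht (D := D)
    (by rw [e1]; exact varForm_pos (M.posDef j hj) hv) hu0 hu1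
  simp only [e1, e2] at h
  exact h

end Sample

lemma Model.add_one_le_cp (M : Model) {j : ℕ} (hj : j ≤ M.m₀ + 1) : j + 1 ≤ M.cp j := by
  induction j with
  | zero => exact M.cp_zero.ge
  | succ j ih =>
    have h1 := M.cp_lt (j + 1) (Finset.mem_Icc.2 ⟨by omega, hj⟩)
    have h2 := ih (by omega)
    simp only [Nat.add_sub_cancel] at h1
    omega

lemma Model.m₀_add_one_le (M : Model) : M.m₀ + 1 ≤ M.n := by
  have h1 := M.add_one_le_cp (j := M.m₀ + 1) le_rfl
  rw [M.cp_last] at h1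
  omega

lemma Model.m₀_le (M : Model) : M.m₀ ≤ M.n := by
  have := M.m₀_add_one_le
  omega

/-! ### Regularity of all stretches with high probability -/

section Stretch

/-- The quadratic form of `v` is relatively `u`-close to its mean on `I`. -/
def QuadClose {p : ℕ} (S : Matrix (Fin p) (Fin p) ℝ) (I : Finset ℕ)
    (x : ℕ → EuclideanSpace ℝ (Fin p)) (u : ℝ) (v : Fin p → ℝ) : Prop :=
  v ≠ 0 → |quad I x v - I.card * varForm S v| < I.card * u * varForm S v

lemma quad_smul {p : ℕ} (I : Finset ℕ) (x : ℕ → EuclideanSpace ℝ (Fin p)) (c : ℝ)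
    (v : Fin p → ℝ) : quad I x (c • v) = c ^ 2 * quad I x v := by
  simp [quad, linForm_smul, mul_pow, Finset.mul_sum]

lemma signedSum_const {p : ℕ} (r : ℕ) (j : Fin p) :
    signedSum (fun _ : Fin r => (j, true)) = (r : ℝ) • Pi.single j (1 : ℝ) := by
  simp [signedSum, nsmul_eq_mul, Nat.cast_smul_eq_nsmul]

/-- Regularity follows from the concentration of finitely many quadratic forms. -/
lemma regular_of_quadClose {p : ℕ} {S : Matrix (Fin p) (Fin p) ℝ} (hS : S.PosDef) {C₁ L : ℝ}
    (hC₁ : 0 < C₁) (hspec : ∀ z ∈ spectrum ℝ S, 1 / C₁ ≤ z ∧ z ≤ C₁) (hL : 0 < L)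
    {I : Finset ℕ} {x : ℕ → EuclideanSpace ℝ (Fin p)} {r : ℕ} (hr : 0 < r)
    (hrI : (I.card : ℝ) ≤ 256 * L * r)
    (hf : ∀ f : Fin (r + 1) → Fin p × Bool, QuadClose S I x (1 / 2) (signedSum f))
    (hlk : ∀ l k, QuadClose S I x (16 * Real.sqrt (L / I.card)) (residVec S l + Pi.single k 1) ∧
      QuadClose S I x (16 * Real.sqrt (L / I.card)) (residVec S l - Pi.single k 1)) :
    Regular C₁ L (coefMatrix S) I x := by
  have hr' : (0 : ℝ) < r := by exact_mod_cast hr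
  have hI0 : (0 : ℝ) ≤ I.card := Nat.cast_nonneg _
  set β := 3 / 2 * C₁ * I.card with hβ
  have hβ0 : 0 ≤ β := by positivity
  have hsp : ∀ f : Fin (r + 1) → Fin p × Bool,
      I.card / (2 * C₁) * ∑ k, signedSum f k ^ 2 ≤ quad I x (signedSum f) ∧
      quad I x (signedSum f) ≤ β * ∑ k, signedSum f k ^ 2 := by
    intro f
    by_cases h0 : signedSum f = 0
    · simp [h0, quad, linForm]
    · obtain ⟨h1, h2⟩ := abs_lt.1 (hf f h0)
      obtain ⟨h3, h4⟩ := varForm_bounds hS hspec (signedSum f)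
      have h5 := mul_le_mul_of_nonneg_left h3 hI0
      have h6 := mul_le_mul_of_nonneg_left h4 hI0
      have e : I.card / (2 * C₁) * ∑ k, signedSum f k ^ 2 =
          1 / 2 * (I.card * (1 / C₁ * ∑ k, signedSum f k ^ 2)) := by field_simp
      rw [e, hβ]
      constructor <;> linarith
  have hsingle : ∀ j, quad I x (Pi.single j 1) ≤ β := by
    intro j
    have h1 := (hsp fun _ => (j, true)).2
    rw [signedSum_const, quad_smul] at h1
    simp only [Pi.smul_apply, smul_eq_mul, mul_pow, ← Finset.mul_sum, sum_single_sq] at h1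
    have h2 : (0 : ℝ) < ((r + 1 : ℕ) : ℝ) ^ 2 := by positivity
    exact le_of_mul_le_mul_left (by linarith) h2
  have hre := quad_bounds_of_signedSum hr (by positivity) hsingle hsp
  -- The constant is 384 = (3/2) · 256.
  have hβr : β / r ≤ 384 * C₁ * L := by
    rw [div_le_iff₀ hr', hβ]
    nlinarith
  have hmono : ∀ v : Fin p → ℝ, β / r * (∑ k, |v k|) ^ 2 ≤ 384 * C₁ * L * (∑ k, |v k|) ^ 2 :=
    fun v => mul_le_mul_of_nonneg_right hβr (sq_nonneg _)
  refine ⟨fun v => ?_, fun v => ?_, fun l k hne => ?_⟩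
  · linarith [(hre v).1, hmono v]
  · exact (hre v).2.trans (add_le_add_right (hmono v) _)
  · have hne0 : ∀ c : ℝ, residVec S l + c • Pi.single k 1 ≠ 0 := fun c h => by
      have := congrFun h l
      rw [Pi.add_apply, residVec_self, Pi.smul_apply, Pi.single_eq_of_ne hne] at this
      simp at this
    have hp := hne0 1
    have hm := hne0 (-1)
    have vp := varForm_residVec_add hS hne (c := 1)
    have vm := varForm_residVec_add hS hne (c := -1)
    rw [one_smul] at hp vp
    rw [neg_smul, one_smul, ← sub_eq_add_neg] at hm vm
    obtain ⟨h1, h2⟩ := abs_lt.1 ((hlk l k).1 hp)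
    obtain ⟨h3, h4⟩ := abs_lt.1 ((hlk l k).2 hm)
    rw [vp] at h1 h2
    rw [vm] at h3 h4
    set τ := varForm S (residVec S l) + varForm S (Pi.single k 1) with hτ
    have hτ' : varForm S (residVec S l) + (-1) ^ 2 * varForm S (Pi.single k 1) = τ := by
      rw [hτ]; ring
    rw [hτ'] at h3 h4
    have hτ'' : varForm S (residVec S l) + 1 ^ 2 * varForm S (Pi.single k 1) = τ := by
      rw [hτ]; ring
    rw [hτ''] at h1 h2
    have hτC : τ ≤ 2 * C₁ := by
      have e1 := (varForm_bounds hS hspec (Pi.single l 1)).2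
      have e2 := (varForm_bounds hS hspec (Pi.single k 1)).2
      rw [sum_single_sq] at e1 e2
      linarith [varForm_residVec_le hS l]
    -- Polarization. Each form deviates from the common mean |I| τ by less than 16 √(|I| L) τ with τ
    -- ≤ 2C₁; a quarter of the two deviations is 16 C₁ √(|I| L).
    have hpol : ∑ t ∈ I, (x t l - linForm (coefMatrix S l) (x t)) * x t k =
        (quad I x (residVec S l + Pi.single k 1) - quad I x (residVec S l - Pi.single k 1)) / 4 := by
      rw [quad, quad, ← Finset.sum_sub_distrib, Finset.sum_div]
      refine Finset.sum_congr rfl fun t _ => ?_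
      rw [linForm_add, linForm_sub, linForm_residVec, linForm_single]
      ring
    have hsq : I.card * Real.sqrt (L / I.card) = Real.sqrt (I.card * L) := by
      rcases hI0.eq_or_lt with h0 | hpos
      · rw [← h0]; simp
      · rw [show (I.card : ℝ) * L = I.card ^ 2 * (L / I.card) by field_simp,
          Real.sqrt_mul (x := (I.card : ℝ) ^ 2) (by positivity), Real.sqrt_sq hI0]
    have hbig : I.card * (16 * Real.sqrt (L / I.card)) * τ ≤
        32 * C₁ * Real.sqrt (I.card * L) := by
      rw [← hsq]
      have := mul_le_mul_of_nonneg_left hτC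
        (by positivity : 0 ≤ I.card * (16 * Real.sqrt (L / I.card)))
      linarith
    rw [hpol, abs_le]
    constructor <;> linarith

variable {M : Model} {Ω : Type*} [MeasurableSpace Ω] {μ : Measure Ω} [IsProbabilityMeasure μ]
  {X : ℕ → Ω → EuclideanSpace ℝ (Fin M.p)}

lemma Model.IsSample.measure_not_quadClose_le (hX : M.IsSample μ X) {j s t : ℕ}
    (hj : j ∈ Finset.Icc 1 (M.m₀ + 1)) (hs : M.cp (j - 1) ≤ s) (ht : t ≤ M.cp j)
    (v : Fin M.p → ℝ) {u : ℝ} (hu0 : 0 ≤ u) (hu1 : u ≤ 1) :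
    μ.real {ω | ¬ QuadClose (M.Sigma j) (Finset.Ico s t) (fun i => X i ω) u v} ≤
      2 * Real.exp (-(((t - s : ℕ) : ℝ) * u ^ 2 / 8)) := by
  by_cases hv : v = 0
  · have : {ω | ¬ QuadClose (M.Sigma j) (Finset.Ico s t) (fun i => X i ω) u v} = ∅ := by
      ext ω
      simp [QuadClose, hv]
    rw [this, measureReal_empty]
    positivity
  · refine le_trans (measureReal_mono fun ω hω => ?_) (hX.quad_concentration hj hs ht hv hu0 hu1)
    have h1 : ¬ QuadClose (M.Sigma j) (Finset.Ico s t) (fun i => X i ω) u v := hω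
    rw [QuadClose] at h1
    push Not at h1
    have h2 := h1.2
    rw [Nat.card_Ico] at h2
    exact h2

/-- A single stretch is irregular with small probability. -/
lemma Model.IsSample.measure_stretch_le (hX : M.IsSample μ X) {C₁ C₂ C_A : ℝ} (hC₁ : 0 < C₁)
    (hM : M.Bounded C₁ C₂ C_A) (hn : 2 ≤ M.n) {j s t : ℕ}
    (hj : j ∈ Finset.Icc 1 (M.m₀ + 1)) (hs : M.cp (j - 1) ≤ s) (ht : t ≤ M.cp j)
    (hlen : 1024 * M.logpn ≤ ((t - s : ℕ) : ℝ)) :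
    μ.real {ω | ¬ (Regular C₁ M.logpn (M.A j) (Finset.Ico s t) (fun i => X i ω) ∧
        ∀ j' ∈ Finset.Icc 1 M.m₀, ((t - s : ℕ) : ℝ) / (2 * C₁) *
          frobNorm (M.A (j' + 1) - M.A j') ^ 2 ≤
            energy (Finset.Ico s t) (fun i => X i ω) (M.A (j' + 1) - M.A j'))} ≤
      8 * Real.exp (-(14 * M.logpn)) := by
  set L := M.logpn with hLdef
  set ℓ := t - s with hℓ
  set N : ℕ := max M.p M.n with hN
  have hN2 : 2 ≤ N := hn.trans (le_max_right _ _)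
  have hNpos : (0 : ℝ) < N := by positivity
  have hexpL : Real.exp L = N := Real.exp_log hNpos
  have hL : 0 < L := Real.log_pos (by exact_mod_cast hN2)
  have hℓpos : (0 : ℝ) < ℓ := by linarith
  -- The sparsity r is as large as the union bound allows: at most (2p)^(r+1) ≤ exp(2L(r + 1))
  -- signed sums against a tail exp(-ℓ/32). Since 128 L r ≤ ℓ and 1024 L ≤ ℓ, the total exponent is
  -- at most 2L - ℓ/64 ≤ -14L.
  set r := ⌊(ℓ : ℝ) / (128 * L)⌋₊ with hr
  have hquot : 8 ≤ (ℓ : ℝ) / (128 * L) := by rw [le_div_iff₀ (by positivity)]; linarith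
  have hr1 : (r : ℝ) ≤ ℓ / (128 * L) := Nat.floor_le (by positivity)
  have hr2 : (ℓ : ℝ) / (128 * L) < r + 1 := Nat.lt_floor_add_one _
  have hrL : (r : ℝ) * (128 * L) ≤ ℓ := (le_div_iff₀ (by positivity)).1 hr1
  have hrpos : 0 < r := Nat.floor_pos.2 (by linarith)
  have hrI : (ℓ : ℝ) ≤ 256 * L * r := by
    have h1 : (ℓ : ℝ) / (128 * L) ≤ 2 * r := by linarith
    rw [div_le_iff₀ (by positivity)] at h1
    linarith
  -- With this u the tail exponent ℓu²/8 is 32 L, which beats the p² ≤ exp(2L) pairs.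
  set u := 16 * Real.sqrt (L / ℓ) with hu
  have hu0 : 0 ≤ u := by positivity
  have hu2 : u ^ 2 = 256 * (L / ℓ) := by
    rw [hu, mul_pow, Real.sq_sqrt (by positivity)]; norm_num
  have hu1 : u ≤ 1 := by
    apply le_of_sq_le_sq _ zero_le_one
    rw [hu2, one_pow, ← mul_div_assoc, div_le_one hℓpos]
    linarith
  have hcard : (Finset.Ico s t).card = ℓ := Nat.card_Ico _ _
  have hPD := M.posDef j hj
  have hspec := hM.eig j hj
  set E₁ : (Fin (r + 1) → Fin M.p × Bool) → Set Ω := fun f =>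
    {ω | ¬ QuadClose (M.Sigma j) (Finset.Ico s t) (fun i => X i ω) (1 / 2) (signedSum f)} with hE₁
  set E₂ : Fin M.p × Fin M.p → Set Ω := fun e =>
    {ω | ¬ QuadClose (M.Sigma j) (Finset.Ico s t) (fun i => X i ω) u
      (residVec (M.Sigma j) e.1 + Pi.single e.2 1)} with hE₂
  set E₃ : Fin M.p × Fin M.p → Set Ω := fun e =>
    {ω | ¬ QuadClose (M.Sigma j) (Finset.Ico s t) (fun i => X i ω) u
      (residVec (M.Sigma j) e.1 - Pi.single e.2 1)} with hE₃
  set E₄ : ℕ → Set Ω := fun j' => {ω | (ℓ : ℝ) * (1 / 2) *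
      traceForm (M.Sigma j) (M.A (j' + 1) - M.A j') ≤
      |energy (Finset.Ico s t) (fun i => X i ω) (M.A (j' + 1) - M.A j') -
        (ℓ : ℝ) * traceForm (M.Sigma j) (M.A (j' + 1) - M.A j')|} with hE₄
  have htrace : ∀ j' ∈ Finset.Icc 1 M.m₀,
      0 < traceForm (M.Sigma j) (M.A (j' + 1) - M.A j') ∧
      1 / C₁ * frobNorm (M.A (j' + 1) - M.A j') ^ 2 ≤
        traceForm (M.Sigma j) (M.A (j' + 1) - M.A j') := by
    intro j' hj'
    have h1 : 1 / C₁ * frobNorm (M.A (j' + 1) - M.A j') ^ 2 ≤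
        traceForm (M.Sigma j) (M.A (j' + 1) - M.A j') := by
      rw [frobNorm_sq, Finset.mul_sum, traceForm]
      exact Finset.sum_le_sum fun l _ => (varForm_bounds hPD hspec _).1
    have h2 := frobNorm_pos (sub_ne_zero.2 (M.change j' hj') : M.A (j' + 1) - M.A j' ≠ 0)
    exact ⟨lt_of_lt_of_le (by positivity) h1, h1⟩
  have hsub : {ω | ¬ (Regular C₁ L (M.A j) (Finset.Ico s t) (fun i => X i ω) ∧
        ∀ j' ∈ Finset.Icc 1 M.m₀, (ℓ : ℝ) / (2 * C₁) *
          frobNorm (M.A (j' + 1) - M.A j') ^ 2 ≤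
            energy (Finset.Ico s t) (fun i => X i ω) (M.A (j' + 1) - M.A j'))} ⊆
      (⋃ f ∈ Finset.univ, E₁ f) ∪ (⋃ e ∈ Finset.univ, E₂ e) ∪ (⋃ e ∈ Finset.univ, E₃ e) ∪
        ⋃ j' ∈ Finset.Icc 1 M.m₀, E₄ j' := by
    intro ω hω
    by_contra hc
    simp only [Set.mem_union, Set.mem_iUnion, not_or, not_exists, Finset.mem_univ,
      true_imp_iff] at hc
    obtain ⟨⟨⟨hc1, hc2⟩, hc3⟩, hc4⟩ := hc
    apply hω
    constructor
    · refine regular_of_quadClose hPD hC₁ hspec hL hrpos (by rw [hcard]; exact hrI)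
        (fun f => not_not.1 (hc1 f)) fun l k => ?_
      rw [hcard]
      exact ⟨not_not.1 (hc2 (l, k)), not_not.1 (hc3 (l, k))⟩
    · intro j' hj'
      have h1 : ¬ ((ℓ : ℝ) * (1 / 2) * traceForm (M.Sigma j) (M.A (j' + 1) - M.A j') ≤
          |energy (Finset.Ico s t) (fun i => X i ω) (M.A (j' + 1) - M.A j') -
            (ℓ : ℝ) * traceForm (M.Sigma j) (M.A (j' + 1) - M.A j')|) := hc4 j' hj'
      have h2 := (abs_lt.1 (not_le.1 h1)).1
      have h3 := mul_le_mul_of_nonneg_left (htrace j' hj').2 hℓpos.le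
      have e : (ℓ : ℝ) / (2 * C₁) * frobNorm (M.A (j' + 1) - M.A j') ^ 2 =
          1 / 2 * (ℓ * (1 / C₁ * frobNorm (M.A (j' + 1) - M.A j') ^ 2)) := by field_simp
      rw [e]
      linarith
  have hpN : (M.p : ℝ) ≤ N := by exact_mod_cast le_max_left _ _
  have hN2' : (2 : ℝ) ≤ N := by exact_mod_cast hN2
  have hexp32 : Real.exp (-(ℓ * u ^ 2 / 8)) = Real.exp (-(32 * L)) := by
    rw [hu2]; congr 1; field_simp; ring
  have hb1 : μ.real (⋃ f ∈ Finset.univ, E₁ f) ≤ 2 * Real.exp (-(14 * L)) := by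
    refine (measureReal_biUnion_finset_le _ _).trans ((Finset.sum_le_sum fun f _ =>
      hX.measure_not_quadClose_le hj hs ht _ (by norm_num) (by norm_num)).trans ?_)
    rw [Finset.sum_const, nsmul_eq_mul, Finset.card_univ, Fintype.card_fun, Fintype.card_prod,
      Fintype.card_fin, Fintype.card_fin, Fintype.card_bool]
    have h1 : (((M.p * 2) ^ (r + 1) : ℕ) : ℝ) ≤ Real.exp (((r + 1 : ℕ) : ℝ) * (2 * L)) := by
      rw [Real.exp_nat_mul]
      push_cast
      refine pow_le_pow_left₀ (by positivity) ?_ _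
      rw [two_mul, Real.exp_add, hexpL]
      exact mul_le_mul hpN hN2' (by norm_num) hNpos.le
    calc _ ≤ Real.exp (((r + 1 : ℕ) : ℝ) * (2 * L)) * (2 * Real.exp (-(ℓ * (1 / 2) ^ 2 / 8))) :=
          mul_le_mul_of_nonneg_right h1 (by positivity)
      _ = 2 * Real.exp (((r + 1 : ℕ) : ℝ) * (2 * L) - ℓ * (1 / 2) ^ 2 / 8) := by
          rw [sub_eq_add_neg, Real.exp_add]; ring
      _ ≤ _ := by
          gcongr
          push_cast
          linarith
  have hpp : ((M.p * M.p : ℕ) : ℝ) ≤ Real.exp (2 * L) := by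
    rw [two_mul, Real.exp_add, hexpL]
    push_cast
    exact mul_le_mul hpN hpN (by positivity) hNpos.le
  have hpair : ((M.p * M.p : ℕ) : ℝ) * (2 * Real.exp (-(32 * L))) ≤ 2 * Real.exp (-(14 * L)) := by
    calc _ ≤ Real.exp (2 * L) * (2 * Real.exp (-(32 * L))) :=
          mul_le_mul_of_nonneg_right hpp (by positivity)
      _ = 2 * Real.exp (2 * L - 32 * L) := by rw [sub_eq_add_neg, Real.exp_add]; ring
      _ ≤ _ := by gcongr; linarith
  have hb2 : μ.real (⋃ e ∈ Finset.univ, E₂ e) ≤ 2 * Real.exp (-(14 * L)) := by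
    refine (measureReal_biUnion_finset_le _ _).trans ((Finset.sum_le_sum fun f _ =>
      hX.measure_not_quadClose_le hj hs ht _ hu0 hu1).trans ?_)
    rw [Finset.sum_const, nsmul_eq_mul, Finset.card_univ, Fintype.card_prod,
      Fintype.card_fin, hexp32]
    exact hpair
  have hb3 : μ.real (⋃ e ∈ Finset.univ, E₃ e) ≤ 2 * Real.exp (-(14 * L)) := by
    refine (measureReal_biUnion_finset_le _ _).trans ((Finset.sum_le_sum fun f _ =>
      hX.measure_not_quadClose_le hj hs ht _ hu0 hu1).trans ?_)
    rw [Finset.sum_const, nsmul_eq_mul, Finset.card_univ, Fintype.card_prod,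
      Fintype.card_fin, hexp32]
    exact hpair
  have hb4 : μ.real (⋃ j' ∈ Finset.Icc 1 M.m₀, E₄ j') ≤ 2 * Real.exp (-(14 * L)) := by
    refine (measureReal_biUnion_finset_le _ _).trans ((Finset.sum_le_sum fun j' hj' =>
      hX.energy_concentration hj hs ht (htrace j' hj').1 (u := 1 / 2) (by norm_num)
        (by norm_num)).trans ?_)
    rw [Finset.sum_const, nsmul_eq_mul, Nat.card_Icc, Nat.add_sub_cancel]
    have h1 : (M.m₀ : ℝ) ≤ Real.exp L := by
      rw [hexpL]
      exact_mod_cast M.m₀_le.trans (le_max_right _ _)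
    calc _ ≤ Real.exp L * (2 * Real.exp (-(ℓ * (1 / 2) ^ 2 / 8))) :=
          mul_le_mul_of_nonneg_right h1 (by positivity)
      _ = 2 * Real.exp (L - ℓ * (1 / 2) ^ 2 / 8) := by
          rw [sub_eq_add_neg, Real.exp_add]; ring
      _ ≤ _ := by gcongr; linarith
  calc _ ≤ _ := measureReal_mono hsub
    _ ≤ _ := measureReal_union_le _ _
    _ ≤ _ := add_le_add_left (measureReal_union_le _ _) _
    _ ≤ _ := add_le_add_left (add_le_add_left (measureReal_union_le _ _) _) _
    _ ≤ _ := by linarith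

lemma Model.IsSample.measure_not_good_le (hX : M.IsSample μ X) {C₁ C₂ C_A : ℝ} (hC₁ : 0 < C₁)
    (hM : M.Bounded C₁ C₂ C_A) (hn : 2 ≤ M.n) :
    μ.real {ω | ¬ Good M C₁ (fun i => X i ω)} ≤ 8 / M.n := by
  set G : ℕ × ℕ × ℕ → Set Ω := fun e => {ω | e.1 ∈ Finset.Icc 1 (M.m₀ + 1) ∧
    M.cp (e.1 - 1) ≤ e.2.1 ∧ e.2.2 ≤ M.cp e.1 ∧ 1024 * M.logpn ≤ ((e.2.2 - e.2.1 : ℕ) : ℝ) ∧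
    ¬ (Regular C₁ M.logpn (M.A e.1) (Finset.Ico e.2.1 e.2.2) (fun i => X i ω) ∧
        ∀ j' ∈ Finset.Icc 1 M.m₀, ((e.2.2 - e.2.1 : ℕ) : ℝ) / (2 * C₁) *
          frobNorm (M.A (j' + 1) - M.A j') ^ 2 ≤
            energy (Finset.Ico e.2.1 e.2.2) (fun i => X i ω) (M.A (j' + 1) - M.A j'))} with hG
  set T := Finset.Icc 1 (M.m₀ + 1) ×ˢ Finset.range (M.n + 2) ×ˢ Finset.range (M.n + 2) with hT
  have hsub : {ω | ¬ Good M C₁ (fun i => X i ω)} ⊆ ⋃ e ∈ T, G e := by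
    intro ω hω
    by_contra hc
    simp only [Set.mem_iUnion, not_exists] at hc
    have hkey : ∀ j ∈ Finset.Icc 1 (M.m₀ + 1), ∀ s t, M.cp (j - 1) ≤ s → t ≤ M.cp j → s ≤ t →
        1024 * M.logpn ≤ ((t - s : ℕ) : ℝ) →
        Regular C₁ M.logpn (M.A j) (Finset.Ico s t) (fun i => X i ω) ∧
        ∀ j' ∈ Finset.Icc 1 M.m₀, ((t - s : ℕ) : ℝ) / (2 * C₁) *
          frobNorm (M.A (j' + 1) - M.A j') ^ 2 ≤
            energy (Finset.Ico s t) (fun i => X i ω) (M.A (j' + 1) - M.A j') := by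
      intro j hj s t hs ht hst hlen
      have h1 := Model.cp_le (M := M) (Finset.mem_Icc.1 hj).2
      by_contra hbad
      exact hc (j, s, t) (Finset.mem_product.2 ⟨hj, Finset.mem_product.2
        ⟨Finset.mem_range.2 (show s < _ by omega), Finset.mem_range.2 (show t < _ by omega)⟩⟩)
        ⟨hj, hs, ht, hlen, hbad⟩
    exact hω ⟨fun j hj s t hs ht hst hlen => (hkey j hj s t hs ht hst hlen).1,
      fun j hj s t hs ht hst hlen => (hkey j hj s t hs ht hst hlen).2⟩
  have hG8 : ∀ e ∈ T, μ.real (G e) ≤ 8 * Real.exp (-(14 * M.logpn)) := by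
    intro e _
    by_cases h : e.1 ∈ Finset.Icc 1 (M.m₀ + 1) ∧ M.cp (e.1 - 1) ≤ e.2.1 ∧ e.2.2 ≤ M.cp e.1 ∧
        1024 * M.logpn ≤ ((e.2.2 - e.2.1 : ℕ) : ℝ)
    · exact (measureReal_mono fun ω hω => hω.2.2.2.2).trans
        (hX.measure_stretch_le hC₁ hM hn h.1 h.2.1 h.2.2.1 h.2.2.2)
    · have : G e = ∅ := by
        ext ω
        simp only [hG, Set.mem_empty_iff_false, iff_false]
        rintro ⟨h1, h2, h3, h4, -⟩
        exact h ⟨h1, h2, h3, h4⟩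
      rw [this, measureReal_empty]
      positivity
  set N : ℕ := max M.p M.n with hN
  have hnN : M.n ≤ N := le_max_right _ _
  have hN2 : 2 ≤ N := hn.trans hnN
  have hNpos : (0 : ℝ) < N := by positivity
  have hexpL : Real.exp M.logpn = N := Real.exp_log hNpos
  -- At most N⁵ triples (j, s, t), each failing with probability at most 8 N⁻¹⁴, where N = p ∨ n.
  have hcardT : T.card ≤ N ^ 5 := by
    rw [hT, Finset.card_product, Finset.card_product, Finset.card_range, Nat.card_Icc,
      Nat.add_sub_cancel]
    have h1 : M.m₀ + 1 ≤ N := M.m₀_add_one_le.trans hnN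
    have h2 : M.n + 2 ≤ N ^ 2 := by nlinarith
    calc _ ≤ N * (N ^ 2 * N ^ 2) := Nat.mul_le_mul h1 (Nat.mul_le_mul h2 h2)
      _ = N ^ 5 := by ring
  have hexp14 : Real.exp (-(14 * M.logpn)) = ((N : ℝ) ^ 14)⁻¹ := by
    rw [Real.exp_neg, ← hexpL, ← Real.exp_nat_mul]; norm_num
  calc _ ≤ μ.real (⋃ e ∈ T, G e) := measureReal_mono hsub (measure_ne_top _ _)
    _ ≤ _ := measureReal_biUnion_finset_le _ _
    _ ≤ _ := Finset.sum_le_sum hG8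
    _ = T.card * (8 * ((N : ℝ) ^ 14)⁻¹) := by rw [Finset.sum_const, nsmul_eq_mul, hexp14]
    _ ≤ (N : ℝ) ^ 5 * (8 * ((N : ℝ) ^ 14)⁻¹) := by
        gcongr
        exact_mod_cast hcardT
    _ = 8 / (N : ℝ) ^ 9 := by field_simp
    _ ≤ 8 / M.n := by
        have h1 : (1 : ℝ) ≤ N := by exact_mod_cast (by omega : 1 ≤ N)
        have h2 : (N : ℝ) ≤ (N : ℝ) ^ 9 := le_self_pow₀ h1 (by norm_num)
        have h3 : (M.n : ℝ) ≤ N := by exact_mod_cast hnN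
        have h4 : (0 : ℝ) < M.n := by exact_mod_cast (by omega : 0 < M.n)
        exact div_le_div_of_nonneg_left (by norm_num) h4 (h3.trans h2)

end Stretch

/-! ### Choice of constants and asymptotic conditions -/

lemma Model.dStar_pos (M : Model) : 0 < M.dStar := by
  by_contra! hc
  have hzero : ∀ j ∈ Finset.Icc 1 (M.m₀ + 1), M.A j = 0 := by
    intro j hj
    have h1 := (supp_card_le_dStar hj).trans hc
    have h2 : supp (M.A j) = ∅ := Finset.card_eq_zero.1 (Nat.le_zero.1 h1)
    ext l k
    by_contra h3
    have : (l, k) ∈ supp (M.A j) := Finset.mem_filter.2 ⟨Finset.mem_univ _, h3⟩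
    simp [h2] at this
  have h1 := M.one_le_m₀
  refine M.change 1 (Finset.mem_Icc.2 ⟨le_rfl, h1⟩) ?_
  exact (hzero 2 (Finset.mem_Icc.2 ⟨by omega, by omega⟩)).trans
    (hzero 1 (Finset.mem_Icc.2 ⟨le_rfl, by omega⟩)).symm

/-- Constants for which the deterministic analysis applies. -/
lemma exists_jump_constant {C₁ B κ : ℝ} (C_A : ℝ) (hC₁ : 0 < C₁) (hκ : 0 < κ)
    (hκ' : κ < 1 / 2) :
    ∃ z : ℝ, 0 < z ∧ 2 * B ≤ κ * z ∧ 2 * B < (1 - 2 * κ) * z ∧ 8192 * C_A ^ 2 ≤ z ^ 2 ∧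
      3 * C₁ * B ^ 2 / z ^ 2 + 12288 * C₁ * B ^ 2 / z ^ 2
        + 32 * C₁ * (2 / z + 8 * B / (z * z)) < 1 / (4 * C₁) := by
  have h1 : ∀ᶠ z : ℝ in atTop, 2 * B ≤ κ * z :=
    (tendsto_id.const_mul_atTop hκ).eventually_ge_atTop _
  have h2 : ∀ᶠ z : ℝ in atTop, 2 * B < (1 - 2 * κ) * z :=
    (tendsto_id.const_mul_atTop (by linarith : 0 < 1 - 2 * κ)).eventually_gt_atTop _
  have h3 : ∀ᶠ z : ℝ in atTop, 8192 * C_A ^ 2 ≤ z ^ 2 :=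
    (tendsto_pow_atTop two_ne_zero).eventually_ge_atTop _
  have hsq : Tendsto (fun z : ℝ => z ^ 2) atTop atTop := tendsto_pow_atTop two_ne_zero
  have hsq' : Tendsto (fun z : ℝ => z * z) atTop atTop := by simpa [sq] using hsq
  have h4 : Tendsto (fun z : ℝ => 3 * C₁ * B ^ 2 / z ^ 2 + 12288 * C₁ * B ^ 2 / z ^ 2
      + 32 * C₁ * (2 / z + 8 * B / (z * z))) atTop (𝓝 (0 + 0 + 32 * C₁ * (0 + 0))) :=
    ((tendsto_const_nhds.div_atTop hsq).add (tendsto_const_nhds.div_atTop hsq)).add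
      (((tendsto_const_nhds.div_atTop tendsto_id).add
        (tendsto_const_nhds.div_atTop hsq')).const_mul _)
  have h5 := h4.eventually_lt_const (u := 1 / (4 * C₁)) (by simp only [add_zero, mul_zero]; positivity)
  obtain ⟨z, hz0, hz1, hz2, hz3, hz4⟩ :=
    ((eventually_gt_atTop 0).and (h1.and (h2.and (h3.and h5)))).exists
  exact ⟨z, hz0, hz1, hz2, hz3, hz4⟩

/-- The conditions of the deterministic analysis hold eventually. -/
lemma Asymptotics.eventually_conditions {M : ℕ → Model} {b : ℕ → ℕ} {z : ℝ}
    (h : Asymptotics M b z) {C₁ : ℝ} (hC₁ : 0 < C₁) (S : ℕ) :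
    ∀ᶠ i in atTop, 2 ≤ (M i).n ∧ 2 ≤ b i ∧ 0 < (M i).logpn ∧ 1024 * (M i).logpn ≤ b i ∧
      24576 * C₁ ^ 2 * ((M i).dStar * (M i).logpn) ≤ b i ∧ (M i).dStar * (M i).logpn ≤ b i ∧
      S * b i ≤ (M i).spacing ∧
      z * Real.sqrt (((M i).dStar : ℝ) * (M i).logpn / (b i : ℝ)) ≤ (M i).jump := by
  have hn := h.size.eventually_ge_atTop 2
  have e1 := h.block.eventually_lt_const (u := 1 / 1024) (by norm_num)
  have e2 := h.block.eventually_lt_const (u := 1 / (24576 * C₁ ^ 2)) (by positivity)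
  have e3 := h.spacing.eventually_ge_atTop (S : ℝ)
  filter_upwards [hn, e1, e2, e3, h.jump] with i hn e1 e2 e3 hj
  have hb : (0 : ℝ) < b i := by exact_mod_cast h.block_pos i
  have hd : (1 : ℝ) ≤ (M i).dStar := by exact_mod_cast (M i).dStar_pos
  have hN : (2 : ℝ) ≤ ((max (M i).p (M i).n : ℕ) : ℝ) := by
    exact_mod_cast hn.trans (le_max_right _ _)
  have hL2 : Real.log 2 ≤ (M i).logpn := Real.log_le_log (by norm_num) hN
  have hlog := Real.log_two_gt_d9
  have hL : 0 < (M i).logpn := by linarith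
  rw [← mul_div_assoc, div_lt_div_iff₀ hb (by positivity)] at e1 e2
  -- Because d ≥ 1, the condition on dL/b also controls L/b. In particular b ≥ 1024 log 2, which
  -- gives b ≥ 2.
  have hdL : (M i).logpn ≤ (M i).dStar * (M i).logpn := le_mul_of_one_le_left hL.le hd
  have hb2 : (2 : ℝ) ≤ b i := by linarith
  refine ⟨hn, by exact_mod_cast hb2, hL, by linarith, by linarith, by linarith, ?_, hj⟩
  rw [le_div_iff₀ hb] at e3
  exact_mod_cast e3

lemma Model.penalty_pos {M : Model} {b : ℕ} {c : ℝ} (hc : 0 < c) (hn : 0 < M.n) (hb : 0 < b)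
    (hL : 0 < M.logpn) : 0 < M.penalty b c := by
  have h1 : (0 : ℝ) < M.n := by exact_mod_cast hn
  have h2 : (0 : ℝ) < b := by exact_mod_cast hb
  unfold Model.penalty
  positivity

/-- A Frobenius error of the order of the noise level leaves few false positives. -/
lemma card_false_positives_le {p d : ℕ} {A A' : Matrix (Fin p) (Fin p) ℝ} {B cη C L b : ℝ}
    (hcη : 0 < cη) (hC : cη ≤ C) (hL : 0 < L) (hb : 0 < b)
    (h : frobNorm (A - A') ≤ B * Real.sqrt (d * L / b)) :
    ((supp (hardThreshold (C * Real.sqrt (L / b)) A) \ supp A').card : ℝ) ≤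
      B ^ 2 / cη ^ 2 * d := by
  have hLb : 0 < L / b := div_pos hL hb
  have h1 := card_supp_hardThreshold_sdiff (C * Real.sqrt (L / b))
    (mul_nonneg (hcη.le.trans hC) (Real.sqrt_nonneg _)) A A'
  set s : ℝ := ((supp (hardThreshold (C * Real.sqrt (L / b)) A) \ supp A').card : ℝ)
  have hs : 0 ≤ s := Nat.cast_nonneg _
  have h2 : frobNorm (A - A') ^ 2 ≤ B ^ 2 * (d * (L / b)) := by
    calc _ ≤ (B * Real.sqrt (d * L / b)) ^ 2 := pow_le_pow_left₀ (frobNorm_nonneg _) h 2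
      _ = _ := by rw [mul_pow, Real.sq_sqrt (by positivity), mul_div_assoc]
  rw [mul_pow, Real.sq_sqrt hLb.le] at h1
  have h3 : s * cη ^ 2 * (L / b) ≤ B ^ 2 * d * (L / b) := by
    calc s * cη ^ 2 * (L / b) ≤ s * C ^ 2 * (L / b) := by gcongr
      _ ≤ _ := by linarith
  have h4 := le_of_mul_le_mul_right h3 hLb
  rw [div_mul_eq_mul_div, le_div_iff₀ (by positivity)]
  exact h4

end TBFL
end

theorem theorem5 (C₁ C₂ C_A : ℝ) (hC₁ : 0 < C₁) (hC₂ : 0 < C₂) (hC_A : 0 < C_A)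
    (c₁ : ℝ) (hc₁ : 0 < c₁) :
    ∃ L : ℝ, 0 < L ∧ ∀ c₂ : ℝ, L ≤ c₂ →
      ∀ κ ρ : ℝ, 0 < κ → κ < 1 / 2 → 1 ≤ ρ →
      ∃ c₀ : ℝ, 0 < c₀ ∧ ∃ K : ℝ, 0 < K ∧
      ∀ (M : ℕ → TBFL.Model) (b : ℕ → ℕ),
        (∀ i, (M i).Bounded C₁ C₂ C_A) → TBFL.Asymptotics M b c₀ →
      ∀ (Ω : ℕ → Type*) [∀ i, MeasurableSpace (Ω i)]
        (μ : (i : ℕ) → Measure (Ω i)) [∀ i, IsProbabilityMeasure (μ i)]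
        (X : (i : ℕ) → ℕ → Ω i → EuclideanSpace ℝ (Fin (M i).p)),
        (∀ i, (M i).IsSample (μ i) (X i)) →
      -- the procedure is well defined
      (∀ᶠ i in atTop, ∀ x : ℕ → EuclideanSpace ℝ (Fin (M i).p),
        ((M i).outputs (b i) c₁ c₂ κ ρ x).Nonempty) ∧
      -- number and locations of the change points
      Tendsto (fun i => μ i {ω | ∃ o ∈ (M i).outputs (b i) c₁ c₂ κ ρ (fun t => X i t ω),
        ¬ (o.m = (M i).m₀ ∧ ∀ j ∈ Finset.Icc 1 (M i).m₀,
          |(o.τ j : ℝ) - ((M i).cp j : ℝ)|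
            ≤ K * ((M i).dStar : ℝ) * (M i).logpn / (M i).jump ^ 2)}) atTop (𝓝 0) ∧
      -- Frobenius rate of the coefficient matrices
      (∀ ε : ℝ, 0 < ε → ∃ B : ℝ, 0 < B ∧ ∀ᶠ i in atTop,
        μ i {ω | ∃ o ∈ (M i).outputs (b i) c₁ c₂ κ ρ (fun t => X i t ω),
          ¬ (o.m = (M i).m₀ ∧ ∀ j ∈ Finset.Icc 1 ((M i).m₀ + 1),
            TBFL.frobNorm (o.Ahat ((M i).n / b i) j - (M i).A j)
              ≤ B * Real.sqrt (((M i).dStar : ℝ) * (M i).logpn / (b i : ℝ)))}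
          ≤ ENNReal.ofReal ε) ∧
      -- false positives after thresholding
      (∀ (cη : ℝ) (C : ℕ → ℕ → ℝ), 0 < cη →
        (∀ i, ∀ j ∈ Finset.Icc 1 ((M i).m₀ + 1), cη ≤ C i j) →
        ∀ ε : ℝ, 0 < ε → ∃ B : ℝ, 0 < B ∧ ∀ᶠ i in atTop,
        μ i {ω | ∃ o ∈ (M i).outputs (b i) c₁ c₂ κ ρ (fun t => X i t ω),
          ¬ (o.m = (M i).m₀ ∧ ∀ j ∈ Finset.Icc 1 ((M i).m₀ + 1),
            ((TBFL.supp (TBFL.hardThreshold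
                (C i j * Real.sqrt ((M i).logpn / (b i : ℝ))) (o.Ahat ((M i).n / b i) j))
              \ TBFL.supp ((M i).A j)).card : ℝ)
              ≤ B * ((M i).dStar : ℝ))}
          ≤ ENNReal.ofReal ε) := by
  refine ⟨2 * (2 * c₁ + 64 * C₁), by positivity, fun c₂ hc₂ κ ρ hκ hκ' hρ => ?_⟩
  have hc₂pos : 0 < c₂ := lt_of_lt_of_le (by positivity) hc₂
  obtain ⟨z, hz, hz1, hz2, hz3, hz4⟩ :=
    TBFL.exists_jump_constant (B := 6 * C₁ * c₂) C_A hC₁ hκ hκ'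
  -- One number z serves as c₀ and as the constant Q of `Regular.loss_lt`, whose length condition
  -- then gives K = z².
  refine ⟨z, hz, z ^ 2, by positivity, fun M b hM hAs Ω _ μ _ X hX => ?_⟩
  -- Segments of at least S blocks separate clusters of diameter ρb, as ρ < S - 1, and leave room
  -- for pure blocks, as S ≥ 4.
  set S : ℕ := ⌈ρ⌉₊ + 4 with hS
  have hρS : ρ < (S : ℝ) - 1 := by
    have := Nat.le_ceil ρ
    rw [hS]
    push_cast
    linarith
  have hcond := hAs.eventually_conditions hC₁ S
  have hdet : ∀ᶠ i in atTop, ∀ ω, TBFL.Good (M i) C₁ (fun t => X i t ω) →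
      ∀ o ∈ (M i).outputs (b i) c₁ c₂ κ ρ (fun t => X i t ω), o.m = (M i).m₀ ∧
        (∀ j ∈ Finset.Icc 1 (M i).m₀, |(o.τ j : ℝ) - ((M i).cp j : ℝ)|
          ≤ z ^ 2 * ((M i).dStar : ℝ) * (M i).logpn / (M i).jump ^ 2) ∧
        ∀ j ∈ Finset.Icc 1 ((M i).m₀ + 1),
          TBFL.frobNorm (o.Ahat ((M i).n / b i) j - (M i).A j)
            ≤ 6 * C₁ * c₂ * Real.sqrt (((M i).dStar : ℝ) * (M i).logpn / (b i : ℝ)) := by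
    filter_upwards [hcond] with i ⟨h1, h2, h3, h4, h5, h6, h7, h8⟩ ω hgood o ho
    exact hgood.output_correct (hM i) hC₁ hC_A hc₁ hc₂ hκ hρ hz hz1 hz2 hz3 hz4 (by omega)
      (by omega) h3 (M i).dStar_pos h4 h5 h6 h7 (by omega) hρS h8 ho
  -- The failure events involve all outputs and are not shown to be measurable; monotonicity of the
  -- outer measure suffices.
  have hprob : ∀ᶠ i in atTop, ∀ E : Set (Ω i),
      (∀ ω ∈ E, ¬ TBFL.Good (M i) C₁ (fun t => X i t ω)) →
      μ i E ≤ ENNReal.ofReal (8 / (M i).n) := by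
    filter_upwards [hcond] with i ⟨h1, _⟩ E hE
    have hsub : E ⊆ {ω | ¬ TBFL.Good (M i) C₁ (fun t => X i t ω)} := fun ω hω => hE ω hω
    calc μ i E ≤ μ i {ω | ¬ TBFL.Good (M i) C₁ (fun t => X i t ω)} := measure_mono hsub
      _ = ENNReal.ofReal ((μ i).real {ω | ¬ TBFL.Good (M i) C₁ (fun t => X i t ω)}) :=
          (ofReal_measureReal (measure_ne_top _ _)).symm
      _ ≤ _ := ENNReal.ofReal_le_ofReal ((hX i).measure_not_good_le hC₁ (hM i) h1)
  have hlim : Tendsto (fun i => (8 : ℝ) / (M i).n) atTop (𝓝 0) :=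
    tendsto_const_nhds.div_atTop (tendsto_natCast_atTop_atTop.comp hAs.size)
  have hsmall : ∀ ε : ℝ, 0 < ε → ∀ᶠ i in atTop, ∀ E : Set (Ω i),
      (∀ ω ∈ E, ¬ TBFL.Good (M i) C₁ (fun t => X i t ω)) → μ i E ≤ ENNReal.ofReal ε := by
    intro ε hε
    filter_upwards [hprob, hlim.eventually_lt_const hε] with i hi hε' E hE
    exact (hi E hE).trans (ENNReal.ofReal_le_ofReal hε'.le)
  refine ⟨?_, ?_, ?_, ?_⟩
  · filter_upwards [hcond] with i ⟨h1, h2, h3, _⟩ x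
    exact TBFL.exists_isOutput h2
      (TBFL.Model.penalty_pos hc₁ (by omega) (by omega) h3)
      (TBFL.Model.penalty_pos hc₂pos (by omega) (by omega) h3).le (by positivity) x
  · have hlim' : Tendsto (fun i => ENNReal.ofReal (8 / (M i).n)) atTop (𝓝 0) := by
      rw [← ENNReal.ofReal_zero]
      exact ENNReal.tendsto_ofReal hlim
    refine tendsto_of_tendsto_of_tendsto_of_le_of_le' tendsto_const_nhds hlim'
      (Eventually.of_forall fun _ => zero_le) ?_
    filter_upwards [hdet, hprob] with i hi hp
    refine hp _ ?_
    rintro ω ⟨o, ho, hbad⟩ hgood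
    have := hi ω hgood o ho
    exact hbad ⟨this.1, this.2.1⟩
  · intro ε hε
    -- The constant does not depend on ε: the bound holds with probability tending to one.
    refine ⟨6 * C₁ * c₂, by positivity, ?_⟩
    filter_upwards [hdet, hsmall ε hε] with i hi hp
    refine hp _ ?_
    rintro ω ⟨o, ho, hbad⟩ hgood
    have := hi ω hgood o ho
    exact hbad ⟨this.1, this.2.2⟩
  · intro cη C hcη hC ε hε
    refine ⟨(6 * C₁ * c₂) ^ 2 / cη ^ 2, by positivity, ?_⟩
    filter_upwards [hcond, hdet, hsmall ε hε] with i ⟨h1, h2, h3, _⟩ hi hp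
    refine hp _ ?_
    rintro ω ⟨o, ho, hbad⟩ hgood
    have := hi ω hgood o ho
    exact hbad ⟨this.1, fun j hj => TBFL.card_false_positives_le hcη (hC i j hj) h3
      (by exact_mod_cast (by omega : 0 < b i)) (this.2.2 j hj)⟩
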